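/- **Data.** Let $\ell\ge 1$, let $\Omega\subset\mathbb R^\ell$ be a bounded connected open set, let $\Gamma_D\subset\partial\Omega$ be measurable with positive $(\ell-1)$-dimensional measure (Dirichlet part; the rest of $\partial\Omega$ is impervious), $T>0$, $Q_T=(0,T)\times\Omega$, ${\bf g}\in\mathbb R^\ell$. There are two phases $\alpha\in\{l,g\}$ (liquid, gas). Assume: * the mobilities $M_\alpha:[0,1]\to\mathbb R^+$ are continuous and nondecreasing, $M_\alpha(0)=0$, and $M_l(s)+M_g(1-s)\ge m_0>0$ for all $s\in[0,1]$; they are extended outside $[0,1]$ by constants; * $f_P,f_I\in L^2(Q_T)$ are nonnegative; the injected saturations $s^I_\alpha$ are measurable with $0\le s^I_\alpha\le 1$ a.e.; * $p^0_\alpha\in L^2(\Omega)$, $0\le s^0_\alpha\le 1$ and $s^0_l+s^0_g=1$ a.e.; * the porosity is measurable with $0<\phi_0\le\phi\le\phi_1$ a.e. in $\Omega$; the densities $\rho_\alpha\in C^1(\mathbb R)$ are nondecreasing with $0<\rho_m\le\rho_\alpha\le\rho_M$; * the capillary pressure $p_c\in C^1([0,1];\mathbb R^+)$ satisfies $p_c'\le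 -\underline{p_c}<0$, $p_c(1)=0$ and $p_c(0)\le \bar P$. **Mesh.** An admissible mesh $\mathcal T$ of $\Omega$ is a finite family of pairwise disjoint open bounded convex polytopes $K\subset\Omega$ with $\overline{\bigcup K}=\overline\Omega$, and points $x_K\in K$. Write $L\in N(K)$ if $L\ne K$ and $\sigma_{K|L}=\overline K\cap\overline L$ has positive $(\ell-1)$-measure $|\sigma_{K|L}|$. One assumes $\partial K=(\overline K\cap\partial\Omega)\cup\bigcup_{L\in N(K)}\sigma_{K|L}$ and that the line $(x_K,x_L)$ is orthogonal to $\sigma_{K|L}$ for $L\in N(K)$. Put $d_{K|L}=|x_K-x_L|$, and let $\eta_{K|L}$ be the unit normal outward to $K$. A Dirichlet face $\sigma$ of $K$ is the intersection with $\Gamma_D$ of a facet of $K$ (when it has positive measure); $d_{K|\sigma}$ is the distance from $x_K$ to the hyperplane of that facet, $\eta_{K|\sigma}$ its outward normal. Let $N^*(K)$ be $N(K)$ together with the Dirichlet faces of $K$, and for $L\in N^*(K)$ let $\tau_{K|L}=|\sigma_{K|L}|/d_{K|L}$ (with $\sigma_{K|\sigma}=\sigma$ for a Dirichlet face). Fix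 $\xi>0$ and assume $\sum_{L\in N^*(K)}|\sigma_{K|L}|d_{K|L}\le\xi|K|$ for every $K$. Time is discretized by $t^n=n\,\delta t$, $0\le n\le N+1$, $\delta t=T/(N+1)$. **Scheme.** The unknowns are real numbers $p^n_{\alpha,K},s^n_{\alpha,K}$ ($0\le n\le N+1$). At a Dirichlet face the outer values are $p_{l,\sigma}=p_{g,\sigma}=0$, $s_{l,\sigma}=1$, $s_{g,\sigma}=0$. The initial values $p^0_{\alpha,K},s^0_{\alpha,K}$ are the means of $p^0_\alpha,s^0_\alpha$ over $K$, and for $0\le n\le N$ and all $K$, $\alpha$, with $x^\pm=\max(\pm x,0)$, $$|K|\phi_K\frac{\rho_\alpha(p^{n+1}_{\alpha,K})s^{n+1}_{\alpha,K}-\rho_\alpha(p^{n}_{\alpha,K})s^{n}_{\alpha,K}}{\delta t}+\sum_{L\in N^*(K)}\tau_{K|L}\,\rho^{n+1}_{\alpha,K|L}\,G_\alpha(s^{n+1}_{\alpha,K},s^{n+1}_{\alpha,L};p^{n+1}_{\alpha,L}-p^{n+1}_{\alpha,K})$$ $$+\sum_{L\in N^*(K)}|\sigma_{K|L}|(\rho^{n+1}_{\alpha,K|L})^2\big(M_\alpha(s^{n+1}_{\alpha,K})({\bf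 g}\cdot\eta_{K|L})^+-M_\alpha(s^{n+1}_{\alpha,L})({\bf g}\cdot\eta_{K|L})^-\big)+|K|\rho_\alpha(p^{n+1}_{\alpha,K})s^{n+1}_{\alpha,K}f^{n+1}_{P,K}=|K|\rho_\alpha(p^{n+1}_{\alpha,K})(s^I_{\alpha,K})^{n+1}f^{n+1}_{I,K},$$ $$p_c(s^{n+1}_{l,K})=p^{n+1}_{g,K}-p^{n+1}_{l,K},\qquad s^{n+1}_{l,K}+s^{n+1}_{g,K}=1 .$$ Here $G_\alpha(a,b;c)=-M_\alpha(b)c^++M_\alpha(a)c^-$; $\phi_K$ is the mean of $\phi$ over $K$, and $f^{n+1}_{P,K},f^{n+1}_{I,K},(s^I_{\alpha,K})^{n+1}$ are means over $(t^n,t^{n+1})\times K$; $1/\rho^{n+1}_{\alpha,K|L}$ is the mean value of $1/\rho_\alpha$ between $p^{n+1}_{\alpha,K}$ and $p^{n+1}_{\alpha,L}$ (the value of $1/\rho_\alpha$ there if they coincide). (A value of $s_l$ outside $[0,1]$ is not excluded beforehand; $p_c$ may be any function there.) The upwind saturation $s^{n+1}_{\alpha,K|L}$ is $s^{n+1}_{\alpha,K}$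 if $p^{n+1}_{\alpha,L}\le p^{n+1}_{\alpha,K}$ and $s^{n+1}_{\alpha,L}$ otherwise. The global pressure is $p=p_g+\tilde p(s_l)$ with $\tilde p(s)=-\int_0^s\frac{M_l(z)}{M_l(z)+M_g(1-z)}p_c'(z)\,dz$ (also at Dirichlet faces). **Proposition.** There is a constant $C>0$ which depends only on $\Omega$, $\Gamma_D$, $T$, $M_\alpha$, $p^0_\alpha$, $s^0_\alpha$, $s^I_\alpha$, $f_P$, $f_I$, ${\bf g}$ and on the constants $\phi_0,\phi_1,\rho_m,\rho_M,\bar P,\xi$, but not on the mesh nor on $N$, such that every solution of the scheme satisfies, for $\alpha=l,g$, $$\sum_{n=0}^{N}\delta t\sum_{K\in\mathcal T}\sum_{L\in N^*(K)}\tau_{K|L}\,M_\alpha(s^{n+1}_{\alpha,K|L})\,|p^{n+1}_{\alpha,L}-p^{n+1}_{\alpha,K}|^2\le C,\qquad \sum_{n=0}^{N}\delta t\sum_{K\in\mathcal T}\sum_{L\in N^*(K)}\tau_{K|L}\,|p^{n+1}_{L}-p^{n+1}_{K}|^2\le C .$$ -/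

import Mathlib

open MeasureTheory Set
open scoped MeasureTheory

namespace TwoPhaseFV

noncomputable section

/-- The two phases: the wetting (liquid) phase and the gas phase. -/
inductive Phase
  | liq
  | gas

/-- The Euclidean space of dimension `l`. -/
abbrev Space (l : ℕ) := EuclideanSpace ℝ (Fin l)

/-- The `(l-1)`-dimensional Lebesgue measure of a subset of a hyperplane of the `l`-dimensional
space (the Euclidean Hausdorff measure, normalised to agree with Lebesgue measure). -/
def area (l : ℕ) (S : Set (Space l)) : ℝ := (μHE[l - 1] S).toReal

/-! ### The data of the continuous problem -/

/-- The domain `Ω`, the part `ΓD` of its boundary where both pressures are prescribed to be zero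
(the rest of the boundary is impervious), the final time, the mobilities (functions of the
saturation of their own phase, of which only the values on `[0,1]` matter), the gravity vector,
the initial data, the injected saturations and the production and injection terms; functions of
time and space are functions of the pair `(t, x)`. -/
structure ProblemData (l : ℕ) where
  Ω : Set (Space l)
  ΓD : Set (Space l)
  T : ℝ
  M : Phase → ℝ → ℝ
  grav : Space l
  p0 : Phase → Space l → ℝ
  s0 : Phase → Space l → ℝ
  sI : Phase → ℝ × Space l → ℝ
  fP : ℝ × Space l → ℝ
  fI : ℝ × Space l → ℝ

/-- The space-time cylinder `(0,T) × Ω`. -/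
def ProblemData.cylinder {l : ℕ} (D : ProblemData l) : Set (ℝ × Space l) :=
  Ioo 0 D.T ×ˢ D.Ω

/-- Standing assumptions on the domain, the mobilities, the sources and the initial data. -/
structure ProblemData.Admissible {l : ℕ} (D : ProblemData l) : Prop where
  isOpen : IsOpen D.Ω
  isBounded : Bornology.IsBounded D.Ω
  isConnected : IsConnected D.Ω
  dirichlet_subset : D.ΓD ⊆ frontier D.Ω
  dirichlet_measurable : MeasurableSet D.ΓD
  dirichlet_pos : 0 < μHE[l - 1] D.ΓD
  T_pos : 0 < D.T
  mobility_cont : ∀ α, ContinuousOn (D.M α) (Icc 0 1)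
  mobility_mono : ∀ α, MonotoneOn (D.M α) (Icc 0 1)
  mobility_nonneg : ∀ α, ∀ a ∈ Icc (0 : ℝ) 1, 0 ≤ D.M α a
  mobility_zero : ∀ α, D.M α 0 = 0
  mobility_total : ∃ m₀ : ℝ, 0 < m₀ ∧
    ∀ a ∈ Icc (0 : ℝ) 1, m₀ ≤ D.M Phase.liq a + D.M Phase.gas (1 - a)
  fP_memLp : MemLp D.fP 2 (volume.restrict D.cylinder)
  fI_memLp : MemLp D.fI 2 (volume.restrict D.cylinder)
  fP_nonneg : ∀ᵐ z ∂volume.restrict D.cylinder, 0 ≤ D.fP z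
  fI_nonneg : ∀ᵐ z ∂volume.restrict D.cylinder, 0 ≤ D.fI z
  sI_meas : ∀ α, AEStronglyMeasurable (D.sI α) (volume.restrict D.cylinder)
  sI_mem : ∀ α, ∀ᵐ z ∂volume.restrict D.cylinder, D.sI α z ∈ Icc (0 : ℝ) 1
  p0_memLp : ∀ α, MemLp (D.p0 α) 2 (volume.restrict D.Ω)
  s0_meas : ∀ α, AEStronglyMeasurable (D.s0 α) (volume.restrict D.Ω)
  s0_mem : ∀ α, ∀ᵐ x ∂volume.restrict D.Ω, D.s0 α x ∈ Icc (0 : ℝ) 1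
  s0_add : ∀ᵐ x ∂volume.restrict D.Ω, D.s0 Phase.liq x + D.s0 Phase.gas x = 1

/-- The porosity, the densities (functions of the pressure of their own phase) and the capillary
pressure (a function of the liquid saturation, of which only the values on `[0,1]` matter). -/
structure RockFluid (l : ℕ) where
  φ : Space l → ℝ
  ρ : Phase → ℝ → ℝ
  pc : ℝ → ℝ

/-- Standing assumptions on the porosity, the densities and the capillary pressure. The equality
`pc 1 = 0` is what the capillary law `pc = p_gas - p_liq` and the Dirichlet condition
`p_liq = p_gas = 0` require of a nonnegative decreasing function. -/
structure RockFluid.Admissible {l : ℕ} (R : RockFluid l) (Ω : Set (Space l))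
    (φ₀ φ₁ ρm ρM pcMax : ℝ) : Prop where
  φ_meas : AEStronglyMeasurable R.φ (volume.restrict Ω)
  φ_bounds : ∀ᵐ x ∂volume.restrict Ω, φ₀ ≤ R.φ x ∧ R.φ x ≤ φ₁
  ρ_contDiff : ∀ α, ContDiff ℝ 1 (R.ρ α)
  ρ_mono : ∀ α, Monotone (R.ρ α)
  ρ_bounds : ∀ α q, ρm ≤ R.ρ α q ∧ R.ρ α q ≤ ρM
  pc_contDiff : ContDiffOn ℝ 1 R.pc (Icc 0 1)
  pc_nonneg : ∀ a ∈ Icc (0 : ℝ) 1, 0 ≤ R.pc a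
  pc_deriv : ∃ c : ℝ, 0 < c ∧ ∀ a ∈ Icc (0 : ℝ) 1, derivWithin R.pc (Icc 0 1) a ≤ -c
  pc_one : R.pc 1 = 0
  pc_zero_le : R.pc 0 ≤ pcMax

/-! ### Admissible meshes -/

/-- The interface `σ_{K|L}` of two control volumes. -/
def interface {l : ℕ} (K L : Set (Space l)) : Set (Space l) := closure K ∩ closure L

/-- Two distinct control volumes are neighbours when their interface has positive
`(l-1)`-dimensional measure. -/
def Adjacent {l : ℕ} (K L : Set (Space l)) : Prop := K ≠ L ∧ 0 < μHE[l - 1] (interface K L)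

/-- An admissible mesh of `Ω`, with Dirichlet boundary `ΓD` and regularity constant `ξ`. Each
control volume is an open bounded convex polytope, given as the intersection of the half-spaces
`⟪ν, x⟫ < height K ν` where `ν` runs over finitely many unit vectors (its outward normals). -/
structure AdmissibleMesh {l : ℕ} (Ω ΓD : Set (Space l)) (ξ : ℝ) where
  card : ℕ
  cell : Fin card → Set (Space l)
  center : Fin card → Space l
  normals : Fin card → Finset (Space l)
  height : Fin card → Space l → ℝ
  norm_normals : ∀ K, ∀ ν ∈ normals K, ‖ν‖ = 1
  cell_eq : ∀ K, cell K = {x | ∀ ν ∈ normals K, inner ℝ ν x < height K ν}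
  cell_bounded : ∀ K, Bornology.IsBounded (cell K)
  cell_subset : ∀ K, cell K ⊆ Ω
  closure_cells : closure (⋃ K, cell K) = closure Ω
  cell_disjoint : ∀ K L, K ≠ L → cell K ∩ cell L = ∅
  frontier_cell : ∀ K, frontier (cell K) =
    (closure (cell K) ∩ frontier Ω) ∪
      ⋃ L ∈ {L | Adjacent (cell K) (cell L)}, interface (cell K) (cell L)
  center_mem : ∀ K, center K ∈ cell K
  orthogonal : ∀ K L, Adjacent (cell K) (cell L) →
    ∀ y ∈ interface (cell K) (cell L), ∀ z ∈ interface (cell K) (cell L),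
      inner ℝ (center L - center K) (y - z) = 0
  /-- Regularity: the sum of `|σ| d_σ` over the faces of `K` that carry a flux, namely the
  interfaces with the neighbours and the Dirichlet faces, is at most `ξ |K|`. (The contribution of
  the Dirichlet faces is never more than `l |K|`, so that its presence only affects the value of
  `ξ`.) -/
  regular : ∀ K,
    (open Classical in
      ∑ L with Adjacent (cell K) (cell L),
        area l (interface (cell K) (cell L)) * dist (center K) (center L)) +
      ∑ ν ∈ normals K, area l (closure (cell K) ∩ {x | inner ℝ ν x = height K ν} ∩ ΓD) *
        (height K ν - inner ℝ ν (center K)) ≤ ξ * volume.real (cell K)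

namespace AdmissibleMesh

variable {l : ℕ} {Ω ΓD : Set (Space l)} {ξ : ℝ} (𝒯 : AdmissibleMesh Ω ΓD ξ)

/-- The set `N(K)` of neighbours of `K`. -/
def nbrs (K : Fin 𝒯.card) : Finset (Fin 𝒯.card) :=
  open Classical in Finset.univ.filter fun L => Adjacent (𝒯.cell K) (𝒯.cell L)

/-- `|σ_{K|L}|`. -/
def areaInt (K L : Fin 𝒯.card) : ℝ := area l (interface (𝒯.cell K) (𝒯.cell L))

/-- `d_{K|L}`. -/
def distInt (K L : Fin 𝒯.card) : ℝ := dist (𝒯.center K) (𝒯.center L)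

/-- The transmissivity `τ_{K|L}`. -/
def τ (K L : Fin 𝒯.card) : ℝ := 𝒯.areaInt K L / 𝒯.distInt K L

/-- The unit normal `η_{K|L}` to `σ_{K|L}`, outward to `K`. -/
def η (K L : Fin 𝒯.card) : Space l := (𝒯.distInt K L)⁻¹ • (𝒯.center L - 𝒯.center K)

/-- The Dirichlet face of `K` with outward normal `ν`: the part of that facet of `K` which lies on
the Dirichlet boundary (empty or negligible if the facet does not meet the Dirichlet boundary). -/
def dirFace (K : Fin 𝒯.card) (ν : Space l) : Set (Space l) :=
  closure (𝒯.cell K) ∩ {x | inner ℝ ν x = 𝒯.height K ν} ∩ ΓD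

/-- The measure of a Dirichlet face. -/
def areaDir (K : Fin 𝒯.card) (ν : Space l) : ℝ := area l (𝒯.dirFace K ν)

/-- The distance from `x_K` to the hyperplane of the facet of `K` with outward normal `ν`. -/
def distDir (K : Fin 𝒯.card) (ν : Space l) : ℝ := 𝒯.height K ν - inner ℝ ν (𝒯.center K)

/-- The transmissivity of a Dirichlet face. -/
def τDir (K : Fin 𝒯.card) (ν : Space l) : ℝ := 𝒯.areaDir K ν / 𝒯.distDir K ν

end AdmissibleMesh

/-! ### The numerical scheme -/

/-- Extension of a function on `[0,1]` by constants. -/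
def ext01 (f : ℝ → ℝ) (a : ℝ) : ℝ := f (max 0 (min 1 a))

/-- The upwind flux `G(a,b,c) = -M(b) c⁺ + M(a) c⁻`. -/
def upwindFlux (M : ℝ → ℝ) (a b c : ℝ) : ℝ :=
  -(ext01 M b) * max c 0 + ext01 M a * max (-c) 0

/-- The density on an interface between the pressures `a` and `b`: the inverse of the mean value
of `1/ρ` between `a` and `b`. -/
def interfaceDensity (ρ : ℝ → ℝ) (a b : ℝ) : ℝ :=
  open Classical in
    if a = b then ρ a else ((b - a)⁻¹ * ∫ ζ in a..b, (ρ ζ)⁻¹)⁻¹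

/-- The numerical mass flux of a phase, out of the side with saturation `sK` and pressure `pK`
towards the side with saturation `sL` and pressure `pL`, through a face of measure `A`; `d` is the
distance used in the difference quotient, `gn` the normal component of gravity. -/
def faceFlux (M ρ : ℝ → ℝ) (A d gn sK sL pK pL : ℝ) : ℝ :=
  A / d * interfaceDensity ρ pK pL * upwindFlux M sK sL (pL - pK) +
    A * interfaceDensity ρ pK pL ^ 2 *
      (ext01 M sK * max gn 0 - ext01 M sL * max (-gn) 0)

/-- The saturations on the Dirichlet boundary: there the capillary pressure is zero, that is,
the liquid saturation is one. -/
def satDir : Phase → ℝ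
  | Phase.liq => 1
  | Phase.gas => 0

/-- The upwind saturation on a face: that of `K` if the pressure difference is nonpositive. -/
def upwindSat (sK sL pK pL : ℝ) : ℝ :=
  open Classical in if pL - pK ≤ 0 then sK else sL

section Scheme

variable {l : ℕ} (D : ProblemData l) (R : RockFluid l) {ξ : ℝ}
  (𝒯 : AdmissibleMesh D.Ω D.ΓD ξ) (N : ℕ)

/-- The uniform time step: the nodes are `t^n = n δt` for `n = 0, …, N+1`, with `t^(N+1) = T`. -/
def timeStep : ℝ := D.T / (N + 1)

/-- Mean value of a function of space on a control volume. -/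
def cellMean (f : Space l → ℝ) (K : Fin 𝒯.card) : ℝ := ⨍ x in 𝒯.cell K, f x

/-- Mean value of a function of time and space on `(t^n, t^(n+1)) × K`. -/
def cylMean (f : ℝ × Space l → ℝ) (n : ℕ) (K : Fin 𝒯.card) : ℝ :=
  ⨍ z in Ioo (n * timeStep D N) ((n + 1) * timeStep D N) ×ˢ 𝒯.cell K, f z

/-- Total outward numerical mass flux of the phase `α` from the control volume `K`, for given
cell values `p` and `s` of its pressure and saturation: sum over the neighbours and over the
Dirichlet faces. No flux goes through the impervious part of the boundary. -/
def netFlux (α : Phase) (p s : Fin 𝒯.card → ℝ) (K : Fin 𝒯.card) : ℝ :=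
  ∑ L ∈ 𝒯.nbrs K, faceFlux (D.M α) (R.ρ α) (𝒯.areaInt K L) (𝒯.distInt K L)
      (inner ℝ D.grav (𝒯.η K L)) (s K) (s L) (p K) (p L) +
    ∑ ν ∈ 𝒯.normals K, faceFlux (D.M α) (R.ρ α) (𝒯.areaDir K ν) (𝒯.distDir K ν)
      (inner ℝ D.grav ν) (s K) (satDir α) (p K) 0

/-- `p α n K` and `s α n K`, `n = 0, …, N+1`, are the discrete pressures and saturations of a
solution of the scheme. -/
structure IsSolution (p s : Phase → ℕ → Fin 𝒯.card → ℝ) : Prop where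
  init_p : ∀ α K, p α 0 K = cellMean D 𝒯 (D.p0 α) K
  init_s : ∀ α K, s α 0 K = cellMean D 𝒯 (D.s0 α) K
  mass : ∀ α, ∀ n ≤ N, ∀ K,
    volume.real (𝒯.cell K) * cellMean D 𝒯 R.φ K *
        ((R.ρ α (p α (n + 1) K) * s α (n + 1) K - R.ρ α (p α n K) * s α n K) / timeStep D N) +
      netFlux D R 𝒯 α (p α (n + 1)) (s α (n + 1)) K +
      volume.real (𝒯.cell K) * R.ρ α (p α (n + 1) K) * s α (n + 1) K *
        cylMean D 𝒯 N D.fP n K =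
    volume.real (𝒯.cell K) * R.ρ α (p α (n + 1) K) * cylMean D 𝒯 N (D.sI α) n K *
        cylMean D 𝒯 N D.fI n K
  capillary : ∀ n ≤ N, ∀ K,
    R.pc (s Phase.liq (n + 1) K) = p Phase.gas (n + 1) K - p Phase.liq (n + 1) K
  sat_add : ∀ n ≤ N, ∀ K, s Phase.liq (n + 1) K + s Phase.gas (n + 1) K = 1

/-- The capillary term `p̃(a) = -∫₀ᵃ M_liq(z)/M(z) pc'(z) dz`, where
`M(z) = M_liq(z) + M_gas(1-z)`. -/
def capTilde (a : ℝ) : ℝ :=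
  -∫ z in (0 : ℝ)..a, D.M Phase.liq z / (D.M Phase.liq z + D.M Phase.gas (1 - z)) *
    derivWithin R.pc (Icc 0 1) z

/-- The global pressure `p = p_gas + p̃(s_liq)`. -/
def globalPressure (pgas sliq : ℝ) : ℝ := pgas + capTilde D R sliq

/-- The discrete energy of the phase `α`:
`∑ₙ δt ∑_K ∑_L τ_{K|L} M_α(s_{α,K|L}^{n+1}) |p_{α,L}^{n+1} - p_{α,K}^{n+1}|²`, where `L` runs over
the neighbours and the Dirichlet faces of `K`. -/
def phaseEnergy (p s : Phase → ℕ → Fin 𝒯.card → ℝ) (α : Phase) : ℝ :=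
  ∑ n ∈ Finset.range (N + 1), timeStep D N * ∑ K,
    (∑ L ∈ 𝒯.nbrs K, 𝒯.τ K L *
        ext01 (D.M α) (upwindSat (s α (n + 1) K) (s α (n + 1) L)
          (p α (n + 1) K) (p α (n + 1) L)) *
        |p α (n + 1) L - p α (n + 1) K| ^ 2 +
      ∑ ν ∈ 𝒯.normals K, 𝒯.τDir K ν *
        ext01 (D.M α) (upwindSat (s α (n + 1) K) (satDir α) (p α (n + 1) K) 0) *
        |0 - p α (n + 1) K| ^ 2)

/-- The discrete energy of the global pressure:
`∑ₙ δt ∑_K ∑_L τ_{K|L} |p_L^{n+1} - p_K^{n+1}|²`, where `L` runs over the neighbours and the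
Dirichlet faces of `K`. -/
def globalEnergy (p s : Phase → ℕ → Fin 𝒯.card → ℝ) : ℝ :=
  ∑ n ∈ Finset.range (N + 1), timeStep D N * ∑ K,
    (∑ L ∈ 𝒯.nbrs K, 𝒯.τ K L *
        |globalPressure D R (p Phase.gas (n + 1) L) (s Phase.liq (n + 1) L) -
          globalPressure D R (p Phase.gas (n + 1) K) (s Phase.liq (n + 1) K)| ^ 2 +
      ∑ ν ∈ 𝒯.normals K, 𝒯.τDir K ν *
        |globalPressure D R 0 (satDir Phase.liq) -
          globalPressure D R (p Phase.gas (n + 1) K) (s Phase.liq (n + 1) K)| ^ 2)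

end Scheme

end

end TwoPhaseFV

open TwoPhaseFV

namespace TwoPhaseFV

noncomputable section

open scoped ENNReal Topology

/-! The estimate is an energy estimate. With `g_α` the primitive of `1/ρ_α` vanishing at zero
pressure (`enthalpy`), multiply the balance of phase `α` in `K` by `g_α(p_{α,K})` and sum over
phases and cells. The interface density is exactly the number for which `ρ_{K|L} (g(p_K) - g(p_L)) =
p_K - p_L`, so the upwind flux produces `τ M_α |p_L - p_K|²`.

The accumulation term dominates the increment of a bounded-below energy (`cellEnergy_sub_le`):
concavity of `g_α` produces the nonnegative density `ρ g - p`, and the leftover terms `p_α (s_α' -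
s_α)` combine through the capillary law into the increment of minus the primitive of `p_c`.
Saturations lie in `[0,1]` by a discrete maximum principle, so this energy is at least `-pcMax` per
unit pore volume.

Gravity is upwinded by its own sign, hence its mobility may exceed the one in the energy.
`global_jump_bounds` deals with this. On any face the squared jump of the global pressure, times
`m₀`, is at most the sum of the two upwind energies; and where the mobility of a phase is larger on
the low-pressure side, its pressure jump is at most that of the global pressure. Young's inequality
then absorbs gravity, leaving an error `|σ| d` per face that mesh regularity sums up.

The sources require `L²` control of the pressures. Each differs from the global pressure by a
bounded amount, so a discrete Poincaré inequality with a constant independent of the mesh is enough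
(`exists_poincare_two`). It comes from a relative isoperimetric inequality for unions of cells
(`exists_volume_region_le`), by the coarea formula and the substitution of `u²` for the function.
The isoperimetric inequality rests on one geometric fact: a set `σ` moved along a vector sweeps a
volume at most a constant times its `(l-1)`-measure. Chaining convex pieces inside the connected
`Ω`, and sweeping a piece of a Dirichlet face into the domain, yields it. Boundary regularity is
replaced by the existence of one fixed mesh `𝒯₀`, whose finitely many convex cells cover the closure
of `Ω`; if there is no mesh, there is nothing to prove. -/

/-! ### Sweeping a set along a vector -/

/-- The union of the segments `[y, y + w]` with `y ∈ t`. -/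
def sweep {l : ℕ} (t : Set (Space l)) (w : Space l) : Set (Space l) :=
  {x | ∃ y ∈ t, ∃ r ∈ Icc (0 : ℝ) 1, x = y + r • w}

theorem sweep_mono {l : ℕ} {s t : Set (Space l)} (h : s ⊆ t) (w : Space l) :
    sweep s w ⊆ sweep t w := by
  rintro x ⟨y, hy, r, hr, rfl⟩
  exact ⟨y, h hy, r, hr, rfl⟩

theorem sweep_iUnion {l : ℕ} {ι : Type*} (t : ι → Set (Space l)) (w : Space l) :
    sweep (⋃ i, t i) w = ⋃ i, sweep (t i) w := by
  ext x
  simp only [sweep, mem_iUnion, mem_ofPred_eq]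
  constructor
  · rintro ⟨y, ⟨i, hi⟩, h⟩
    exact ⟨i, y, hi, h⟩
  · rintro ⟨i, y, hi, h⟩
    exact ⟨y, ⟨i, hi⟩, h⟩

/-- The parameter `s` of a swept point is rounded down to a multiple of `1/m`. This costs at most
`‖w‖ / m ≤ r`, and replacing the base point by `y` costs at most another `r`. -/
theorem sweep_subset_closedBalls {l : ℕ} {t : Set (Space l)} {y : Space l} (hy : y ∈ t)
    (hb : Bornology.IsBounded t) (w : Space l) {r : ℝ} (hd : Metric.diam t ≤ r)
    {m : ℕ} (hm : 0 < m) (hw : ‖w‖ ≤ m * r) :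
    sweep t w ⊆ ⋃ j ∈ Finset.range (m + 1),
      Metric.closedBall (y + ((j : ℝ) / m) • w) (2 * r) := by
  rintro x ⟨z, hz, s, ⟨hs0, hs1⟩, rfl⟩
  have hm' : (0 : ℝ) < m := by exact_mod_cast hm
  have hsm : 0 ≤ s * m := by positivity
  simp only [mem_iUnion, Finset.mem_range, exists_prop, Metric.mem_closedBall]
  refine ⟨⌊s * m⌋₊, ?_, ?_⟩
  · have : ⌊s * m⌋₊ ≤ m := by
      apply Nat.floor_le_of_le
      nlinarith
    omega
  · have h1 := Nat.floor_le hsm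
    have h2 := Nat.lt_floor_add_one (s * m)
    set j : ℝ := (⌊s * m⌋₊ : ℝ)
    have h3 : |s - j / m| ≤ 1 / m := by
      have : s - j / m = (s * m - j) / m := by field_simp
      rw [this, abs_div, abs_of_pos hm', abs_of_nonneg (by linarith)]
      gcongr
      linarith
    rw [dist_eq_norm]
    have : z + s • w - (y + (j / m) • w) = (z - y) + (s - j / m) • w := by
      rw [sub_smul]; abel
    rw [this]
    calc ‖(z - y) + (s - j / m) • w‖ ≤ ‖z - y‖ + ‖(s - j / m) • w‖ := norm_add_le _ _
      _ ≤ r + 1 / m * ‖w‖ := by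
        rw [norm_smul, Real.norm_eq_abs, ← dist_eq_norm]
        gcongr
        exact (Metric.dist_le_diam_of_mem hb hz hy).trans hd
      _ ≤ r + r := by
        gcongr
        rw [one_div, inv_mul_le_iff₀ hm']
        exact hw
      _ = 2 * r := by ring

/-- The volume of the unit ball times `2 ^ l`. -/
def sweepConst (l : ℕ) : ℝ := 2 ^ l * volume.real (Metric.ball (0 : Space l) 1)

theorem sweepConst_pos (l : ℕ) : 0 < sweepConst l :=
  mul_pos (by positivity) (ENNReal.toReal_pos (Metric.measure_ball_pos _ _ one_pos).ne'
    measure_ball_lt_top.ne)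

theorem sweepConst_nonneg (l : ℕ) : 0 ≤ sweepConst l := (sweepConst_pos l).le

/-- About `‖w‖ / r` balls of radius `2r` cover the sweep, each of volume of order `r ^ l`; one power
of `r` cancels and the codimension-one scaling `r ^ (l - 1)` remains. The strict inequality keeps
`r` positive even when `t` is a single point. -/
theorem volumeReal_sweep_le_of_lt {l : ℕ} (hl : 1 ≤ l) {t : Set (Space l)} (hne : t.Nonempty)
    (hb : Bornology.IsBounded t) (w : Space l) {r : ℝ} (hd : Metric.diam t < r) :
    volume (sweep t w) ≤ ENNReal.ofReal (sweepConst l * (‖w‖ + 3 * r) * r ^ (l - 1)) := by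
  obtain ⟨y, hy⟩ := hne
  have hr : 0 < r := Metric.diam_nonneg.trans_lt hd
  set m : ℕ := ⌈‖w‖ / r⌉₊ + 1 with hm
  have hm2 : (m : ℝ) + 1 ≤ ‖w‖ / r + 3 := by
    have := Nat.ceil_lt_add_one (a := ‖w‖ / r) (by positivity)
    rw [hm]; push_cast; linarith
  have hw : ‖w‖ ≤ m * r := by
    have := Nat.le_ceil (‖w‖ / r)
    rw [← div_le_iff₀ hr, hm]; push_cast; linarith
  have : NeZero l := ⟨by omega⟩
  calc volume (sweep t w)
      ≤ volume (⋃ j ∈ Finset.range (m + 1),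
        Metric.closedBall (y + ((j : ℝ) / m) • w) (2 * r)) :=
        measure_mono (sweep_subset_closedBalls hy hb w hd.le (by omega) hw)
    _ ≤ ∑ j ∈ Finset.range (m + 1),
        volume (Metric.closedBall (y + ((j : ℝ) / m) • w) (2 * r)) :=
        measure_biUnion_finset_le _ _
    _ = (m + 1 : ℕ) * (ENNReal.ofReal ((2 * r) ^ l) * volume (Metric.ball (0 : Space l) 1)) := by
        simp_rw [Measure.addHaar_closedBall volume _ (by positivity : 0 ≤ 2 * r),
          finrank_euclideanSpace_fin]
        simp
    _ = ENNReal.ofReal ((m + 1) * ((2 * r) ^ l * volume.real (Metric.ball (0 : Space l) 1))) := by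
        rw [ENNReal.ofReal_mul (by positivity), ENNReal.ofReal_mul (by positivity),
          Measure.real, ENNReal.ofReal_toReal measure_ball_lt_top.ne]
        congr
        rw [← Nat.cast_add_one, ENNReal.ofReal_natCast]
    _ ≤ _ := by
        apply ENNReal.ofReal_le_ofReal
        have h1 : (2 * r) ^ l = 2 ^ l * r ^ (l - 1) * r := by
          rw [mul_pow, mul_assoc, ← pow_succ, Nat.sub_add_cancel hl]
        have h2 : (m + 1) * r ≤ ‖w‖ + 3 * r := by
          calc (m + 1) * r ≤ (‖w‖ / r + 3) * r := by gcongr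
            _ = _ := by field_simp
        rw [h1, sweepConst]
        calc (m + 1) * (2 ^ l * r ^ (l - 1) * r * volume.real (Metric.ball (0 : Space l) 1))
            = 2 ^ l * volume.real (Metric.ball (0 : Space l) 1) * ((m + 1) * r) * r ^ (l - 1) := by
              ring
          _ ≤ _ := by gcongr

theorem volume_sweep_le_diam {l : ℕ} (hl : 1 ≤ l) {t : Set (Space l)} (w : Space l)
    (ht : Metric.ediam t ≤ 1) :
    volume (sweep t w) ≤ ENNReal.ofReal (sweepConst l * (‖w‖ + 3)) *
      ⨆ _ : t.Nonempty, Metric.ediam t ^ ((l - 1 : ℕ) : ℝ) := by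
  rcases t.eq_empty_or_nonempty with rfl | hne
  · have : sweep (∅ : Set (Space l)) w = ∅ := by ext x; simp [sweep]
    simp [this]
  have hfin : Metric.ediam t ≠ ⊤ := (ht.trans_lt ENNReal.one_lt_top).ne
  have hb : Bornology.IsBounded t := Metric.isBounded_iff_ediam_ne_top.2 hfin
  have hd1 : Metric.diam t ≤ 1 := by
    rw [Metric.diam]; exact ENNReal.toReal_le_of_le_ofReal zero_le_one (by simpa using ht)
  -- The previous bound needs a radius strictly above the diameter; it is let decrease to the
  -- diameter.
  have hlim : Filter.Tendsto
      (fun r : ℝ => ENNReal.ofReal (sweepConst l * (‖w‖ + 3 * r) * r ^ (l - 1)))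
      (𝓝[>] (Metric.diam t))
      (𝓝 (ENNReal.ofReal (sweepConst l * (‖w‖ + 3 * Metric.diam t) * Metric.diam t ^ (l - 1)))) := by
    refine Filter.Tendsto.mono_left ?_ nhdsWithin_le_nhds
    exact (ENNReal.continuous_ofReal.comp (by fun_prop)).tendsto _
  have key := ge_of_tendsto hlim (b := volume (sweep t w))
    (by filter_upwards [self_mem_nhdsWithin] with r hr
        exact volumeReal_sweep_le_of_lt hl hne hb w hr)
  refine key.trans ?_
  have := sweepConst_nonneg l
  have hd0 : 0 ≤ Metric.diam t := Metric.diam_nonneg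
  rw [iSup_pos hne, ENNReal.rpow_natCast, ← ENNReal.ofReal_toReal hfin,
    ← ENNReal.ofReal_pow ENNReal.toReal_nonneg, ← ENNReal.ofReal_mul (by positivity)]
  apply ENNReal.ofReal_le_ofReal
  change _ ≤ sweepConst l * (‖w‖ + 3) * Metric.diam t ^ (l - 1)
  gcongr
  linarith

/-- The volume swept by a set is controlled by its Hausdorff measure of codimension one. -/
theorem volume_sweep_le_hausdorff {l : ℕ} (hl : 1 ≤ l) (σ : Set (Space l)) (w : Space l) :
    volume (sweep σ w) ≤ ENNReal.ofReal (sweepConst l * (‖w‖ + 3)) * μH[((l - 1 : ℕ) : ℝ)] σ := by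
  set c := ENNReal.ofReal (sweepConst l * (‖w‖ + 3))
  have hc : c ≠ 0 := by
    have := sweepConst_pos l
    exact (ENNReal.ofReal_pos.2 (by positivity)).ne'
  -- Only the covers by sets of diameter at most 1 are kept from the supremum over scales; they
  -- bound the Hausdorff measure from below, and at this scale the volume estimate has a uniform
  -- constant.
  have h1 : (⨅ (t : ℕ → Set (Space l)) (_ : σ ⊆ ⋃ n, t n) (_ : ∀ n, Metric.ediam (t n) ≤ 1),
      ∑' n, ⨆ _ : (t n).Nonempty, Metric.ediam (t n) ^ ((l - 1 : ℕ) : ℝ)) ≤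
      μH[((l - 1 : ℕ) : ℝ)] σ := by
    rw [Measure.hausdorffMeasure_apply]
    exact le_iSup₂_of_le (1 : ℝ≥0∞) one_pos le_rfl
  refine le_trans ?_ (mul_le_mul_right h1 c)
  rw [ENNReal.mul_iInf_of_ne hc (by simp [c])]
  refine le_iInf fun t => ?_
  rw [ENNReal.mul_iInf_of_ne hc (by simp [c])]
  refine le_iInf fun hσ => ?_
  rw [ENNReal.mul_iInf_of_ne hc (by simp [c])]
  refine le_iInf fun ht => ?_
  calc volume (sweep σ w) ≤ volume (⋃ n, sweep (t n) w) := by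
        rw [← sweep_iUnion]; exact measure_mono (sweep_mono hσ w)
    _ ≤ ∑' n, volume (sweep (t n) w) := measure_iUnion_le _
    _ ≤ ∑' n, c * ⨆ _ : (t n).Nonempty, Metric.ediam (t n) ^ ((l - 1 : ℕ) : ℝ) :=
        ENNReal.tsum_le_tsum fun n => volume_sweep_le_diam hl w (ht n)
    _ = _ := ENNReal.tsum_mul_left

/-- Changes the Hausdorff measure into its Euclidean normalisation, at the price of the inverse
scalar factor, and makes the constant uniform for `w` in a ball. -/
theorem exists_volume_sweep_le {l : ℕ} (hl : 1 ≤ l) (B : ℝ) :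
    ∃ c : ℝ≥0∞, c ≠ ⊤ ∧ ∀ (w : Space l), ‖w‖ ≤ B → ∀ σ : Set (Space l),
      volume (sweep σ w) ≤ c * μHE[l - 1] σ := by
  set a := Measure.addHaarScalarFactor (volume : Measure (EuclideanSpace ℝ (Fin (l - 1))))
    μH[((l - 1 : ℕ) : ℝ)] with ha
  have ha0 : a ≠ 0 := Measure.addHaarScalarFactor_volume_hausdorffMeasure_ne_zero (l - 1)
  refine ⟨ENNReal.ofReal (sweepConst l * (B + 3)) * (a : ℝ≥0∞)⁻¹, ?_, fun w hw σ => ?_⟩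
  · exact ENNReal.mul_ne_top (by simp) (by simpa using ha0)
  · have h : μHE[l - 1] σ = (a : ℝ≥0∞) * μH[((l - 1 : ℕ) : ℝ)] σ := by
      rw [Measure.euclideanHausdorffMeasure_def]; rfl
    rw [h, mul_assoc, ← mul_assoc _ (a : ℝ≥0∞),
      ENNReal.inv_mul_cancel (by simpa using ha0) (by simp), one_mul]
    refine (volume_sweep_le_hausdorff hl σ w).trans ?_
    have := sweepConst_nonneg l
    gcongr

/-! ### Measures of pieces of hyperplanes -/

/-- The set lies in an isometric copy of the orthogonal complement of `v`, where the measure is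
Lebesgue measure of dimension `l - 1`. Since `area` is a `toReal`, this finiteness is what lets
areas be compared with measures. -/
theorem hausdorff_hyperplane_lt_top {l : ℕ} {v : Space l} (hv : v ≠ 0)
    {σ : Set (Space l)} (hb : Bornology.IsBounded σ)
    (hσ : ∀ y ∈ σ, ∀ z ∈ σ, inner ℝ v (y - z) = 0) : μHE[l - 1] σ < ⊤ := by
  rcases σ.eq_empty_or_nonempty with rfl | ⟨z, hz⟩
  · simp
  set V : Submodule ℝ (Space l) := (ℝ ∙ v)ᗮ
  have hfin : Module.finrank ℝ V = l - 1 := by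
    have h := Submodule.finrank_add_finrank_orthogonal (ℝ ∙ v)
    rw [finrank_span_singleton hv, finrank_euclideanSpace_fin] at h
    change 1 + Module.finrank ℝ V = l at h
    omega
  set f : V → Space l := fun u => (u : Space l) + z
  have hf : Isometry f := (IsometryEquiv.addRight z).isometry.comp isometry_subtype_coe
  have hsub : σ ⊆ f '' (f ⁻¹' σ) := by
    intro y hy
    refine ⟨⟨y - z, Submodule.mem_orthogonal_singleton_iff_inner_right.2 (hσ y hy z hz)⟩, ?_, ?_⟩
    · simpa [f] using hy
    · simp [f]
  refine (measure_mono hsub).trans_lt ?_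
  rw [hf.euclideanHausdorffMeasure_image, ← hfin,
    InnerProductSpace.euclideanHausdorffMeasure_eq_volume]
  exact (hf.antilipschitz.isBounded_preimage hb).measure_lt_top

/-- Slicing by hyperplanes orthogonal to `v`: since `w` is transversal to `F`, the slices of the
sweep contain translates of `F` for an interval of heights of positive length. -/
theorem volume_sweep_pos {l : ℕ} {v w : Space l} {h : ℝ}
    (hvw : inner ℝ v w ≠ 0) {F : Set (Space l)} (hF : MeasurableSet F)
    (hFv : ∀ y ∈ F, inner ℝ v y = h) (hpos : 0 < μHE[l - 1] F) : 0 < volume (sweep F w) := by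
  have hv : v ≠ 0 := by rintro rfl; simp at hvw
  -- Transversality makes the parametrisation by `F × [0,1]` injective, so the sweep is a continuous
  -- injective image of a Borel set.
  have hmeas : MeasurableSet (sweep F w) := by
    have : sweep F w = (fun q : Space l × ℝ => q.1 + q.2 • w) '' (F ×ˢ Icc (0 : ℝ) 1) := by
      ext x
      simp only [sweep, mem_ofPred_eq, mem_image, mem_prod, Prod.exists]
      constructor
      · rintro ⟨y, hy, r, hr, rfl⟩; exact ⟨y, r, ⟨hy, hr⟩, rfl⟩
      · rintro ⟨y, r, ⟨hy, hr⟩, rfl⟩; exact ⟨y, hy, r, hr, rfl⟩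
    rw [this]
    refine (hF.prod measurableSet_Icc).image_of_continuousOn_injOn (by fun_prop) ?_
    rintro ⟨y, r⟩ ⟨hy, -⟩ ⟨y', r'⟩ ⟨hy', -⟩ heq
    simp only at heq
    have h1 := congrArg (fun z => inner ℝ v z) heq
    simp only [inner_add_right, inner_smul_right, hFv y hy, hFv y' hy', add_right_inj] at h1
    have h2 : r = r' := mul_right_cancel₀ hvw h1
    subst h2
    simpa using heq
  obtain ⟨y₀, hy₀⟩ : F.Nonempty := by
    by_contra hne
    rw [not_nonempty_iff_eq_empty] at hne
    simp [hne] at hpos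
  have hvol : (volume : Measure (Space l)) = μHE[l] :=
    (EuclideanSpace.euclideanHausdorffMeasure_eq_volume l).symm
  have hco := EuclideanGeometry.euclideanHausdorffMeasure_eq_lintegral y₀ hv hmeas
  rw [finrank_euclideanSpace_fin] at hco
  rw [hvol, hco]
  have hv2 : (0 : ℝ) < inner ℝ v v := by
    rw [real_inner_self_eq_norm_sq]; positivity
  -- In the units of the slicing, a displacement by `w` raises the height by `κ`; the slice at
  -- height `x` thus contains `F` translated by `(x / κ) w`.
  set κ : ℝ := inner ℝ v w / inner ℝ v v with hκ
  have hκ0 : κ ≠ 0 := div_ne_zero hvw hv2.ne'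
  set J : Set ℝ := (fun x : ℝ => κ⁻¹ * x) ⁻¹' Icc (0 : ℝ) 1
  have hJm : MeasurableSet J := measurableSet_Icc.preimage (by fun_prop)
  have hJ : 0 < volume J := by
    rw [Real.volume_preimage_mul_left (inv_ne_zero hκ0)]
    simp [hκ0]
  refine ENNReal.mul_pos (by simpa using hv) (ne_of_gt ?_)
  calc (0 : ℝ≥0∞) < μHE[l - 1] F * volume J := ENNReal.mul_pos hpos.ne' hJ.ne'
    _ = ∫⁻ x in J, μHE[l - 1] F := by simp
    _ ≤ ∫⁻ x in J, μHE[l - 1] (sweep F w ∩ AffineSubspace.mk' (x • v +ᵥ y₀) (ℝ ∙ v)ᗮ) := by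
        refine setLIntegral_mono' hJm fun x hx => ?_
        have htr : μHE[l - 1] F = μHE[l - 1] ((fun y => (κ⁻¹ * x) • w + y) '' F) :=
          ((IsometryEquiv.addLeft ((κ⁻¹ * x) • w)).isometry.euclideanHausdorffMeasure_image _).symm
        rw [htr]
        refine measure_mono ?_
        rintro _ ⟨y, hy, rfl⟩
        refine ⟨⟨y, hy, κ⁻¹ * x, hx, add_comm _ _⟩, ?_⟩
        rw [SetLike.mem_coe, AffineSubspace.mem_mk', Submodule.mem_orthogonal_singleton_iff_inner_right]
        simp only [vsub_eq_sub, vadd_eq_add, inner_sub_right, inner_add_right, inner_smul_right,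
          hFv y hy, hFv y₀ hy₀]
        rw [hκ]
        field_simp
        ring
    _ ≤ _ := setLIntegral_le_lintegral _ _

/-! ### Elementary geometry of admissible meshes -/

namespace AdmissibleMesh

variable {l : ℕ} {Ω ΓD : Set (Space l)} {ξ : ℝ} (𝒯 : AdmissibleMesh Ω ΓD ξ)

theorem isOpen_cell (K : Fin 𝒯.card) : IsOpen (𝒯.cell K) := by
  have : {x : Space l | ∀ ν ∈ 𝒯.normals K, inner ℝ ν x < 𝒯.height K ν} =
      ⋂ ν ∈ 𝒯.normals K, {x | inner ℝ ν x < 𝒯.height K ν} := by ext; simp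
  rw [𝒯.cell_eq, this]
  exact isOpen_biInter_finset fun ν _ => isOpen_lt (by fun_prop) continuous_const

theorem convex_cell (K : Fin 𝒯.card) : Convex ℝ (𝒯.cell K) := by
  have : {x : Space l | ∀ ν ∈ 𝒯.normals K, inner ℝ ν x < 𝒯.height K ν} =
      ⋂ ν ∈ 𝒯.normals K, {x | inner ℝ ν x < 𝒯.height K ν} := by ext; simp
  rw [𝒯.cell_eq, this]
  exact convex_iInter₂ fun ν _ => convex_halfSpace_lt (innerSL ℝ ν).isLinear _

theorem inner_le_height_of_mem_closure {K : Fin 𝒯.card} {ν : Space l} (hν : ν ∈ 𝒯.normals K)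
    {x : Space l} (hx : x ∈ closure (𝒯.cell K)) : inner ℝ ν x ≤ 𝒯.height K ν := by
  have hc : IsClosed {x : Space l | inner ℝ ν x ≤ 𝒯.height K ν} :=
    isClosed_le (by fun_prop) continuous_const
  refine closure_minimal ?_ hc hx
  intro y hy
  rw [𝒯.cell_eq] at hy
  exact (hy ν hν).le

theorem closure_cell_subset (K : Fin 𝒯.card) : closure (𝒯.cell K) ⊆ closure Ω :=
  closure_mono (𝒯.cell_subset K)

theorem closure_eq_iUnion : closure Ω = ⋃ K, closure (𝒯.cell K) := by
  rw [← 𝒯.closure_cells, closure_iUnion_of_finite]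

theorem cell_injective {K L : Fin 𝒯.card} (h : K ≠ L) : 𝒯.cell K ≠ 𝒯.cell L := by
  intro heq
  have h1 := 𝒯.cell_disjoint K L h
  rw [heq, inter_self] at h1
  exact (h1 ▸ 𝒯.center_mem L : 𝒯.center L ∈ (∅ : Set (Space l)))

theorem mem_nbrs {K L : Fin 𝒯.card} :
    L ∈ 𝒯.nbrs K ↔ Adjacent (𝒯.cell K) (𝒯.cell L) := by simp [nbrs]

theorem ne_of_mem_nbrs {K L : Fin 𝒯.card} (h : L ∈ 𝒯.nbrs K) : K ≠ L := by
  rintro rfl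
  exact (𝒯.mem_nbrs.1 h).1 rfl

theorem mem_nbrs_comm {K L : Fin 𝒯.card} : L ∈ 𝒯.nbrs K ↔ K ∈ 𝒯.nbrs L := by
  rw [mem_nbrs, mem_nbrs, Adjacent, Adjacent, interface, interface, inter_comm, ne_comm]

theorem areaInt_comm (K L : Fin 𝒯.card) : 𝒯.areaInt K L = 𝒯.areaInt L K := by
  rw [areaInt, areaInt, interface, interface, inter_comm]

theorem distInt_comm (K L : Fin 𝒯.card) : 𝒯.distInt K L = 𝒯.distInt L K := dist_comm _ _

theorem areaInt_nonneg (K L : Fin 𝒯.card) : 0 ≤ 𝒯.areaInt K L := ENNReal.toReal_nonneg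

theorem areaDir_nonneg (K : Fin 𝒯.card) (ν : Space l) : 0 ≤ 𝒯.areaDir K ν :=
  ENNReal.toReal_nonneg

theorem center_ne {K L : Fin 𝒯.card} (h : K ≠ L) : 𝒯.center K ≠ 𝒯.center L := by
  intro heq
  have h1 : 𝒯.center L ∈ 𝒯.cell K ∩ 𝒯.cell L := ⟨heq ▸ 𝒯.center_mem K, 𝒯.center_mem L⟩
  rw [𝒯.cell_disjoint K L h] at h1
  exact h1

theorem distInt_pos {K L : Fin 𝒯.card} (h : L ∈ 𝒯.nbrs K) : 0 < 𝒯.distInt K L :=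
  dist_pos.2 (𝒯.center_ne (𝒯.ne_of_mem_nbrs h))

theorem distDir_pos {K : Fin 𝒯.card} {ν : Space l} (h : ν ∈ 𝒯.normals K) :
    0 < 𝒯.distDir K ν := by
  have := 𝒯.center_mem K
  rw [𝒯.cell_eq] at this
  exact sub_pos.2 (this ν h)

theorem isBounded_closure_cell (K : Fin 𝒯.card) : Bornology.IsBounded (closure (𝒯.cell K)) :=
  (𝒯.cell_bounded K).closure

theorem isBounded_closure (𝒯 : AdmissibleMesh Ω ΓD ξ) : Bornology.IsBounded (closure Ω) := by
  rw [𝒯.closure_eq_iUnion]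
  exact Bornology.isBounded_iUnion.2 𝒯.isBounded_closure_cell

theorem volume_closure_ne_top (𝒯 : AdmissibleMesh Ω ΓD ξ) : volume (closure Ω) ≠ ⊤ :=
  𝒯.isBounded_closure.measure_lt_top.ne

/-- The orthogonality condition enters here: it places the interface in a hyperplane, so its measure
is finite and `areaInt` carries it faithfully. -/
theorem measure_interface_eq_ofReal {K L : Fin 𝒯.card} (h : L ∈ 𝒯.nbrs K) :
    μHE[l - 1] (interface (𝒯.cell K) (𝒯.cell L)) = ENNReal.ofReal (𝒯.areaInt K L) := by
  refine (ENNReal.ofReal_toReal (hausdorff_hyperplane_lt_top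
    (v := 𝒯.center L - 𝒯.center K) ?_ ?_ ?_).ne).symm
  · exact sub_ne_zero.2 (𝒯.center_ne (𝒯.ne_of_mem_nbrs h)).symm
  · exact (𝒯.isBounded_closure_cell K).subset inter_subset_left
  · exact 𝒯.orthogonal K L (𝒯.mem_nbrs.1 h)

theorem measure_interface_eq_zero {K L : Fin 𝒯.card} (hne : K ≠ L) (h : L ∉ 𝒯.nbrs K) :
    μHE[l - 1] (interface (𝒯.cell K) (𝒯.cell L)) = 0 := by
  by_contra h0
  exact h (𝒯.mem_nbrs.2 ⟨𝒯.cell_injective hne, pos_iff_ne_zero.2 h0⟩)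

theorem measure_dirFace_eq_ofReal {K : Fin 𝒯.card} {ν : Space l} (h : ν ∈ 𝒯.normals K) :
    μHE[l - 1] (𝒯.dirFace K ν) = ENNReal.ofReal (𝒯.areaDir K ν) := by
  refine (ENNReal.ofReal_toReal (hausdorff_hyperplane_lt_top (v := ν) ?_ ?_ ?_).ne).symm
  · rintro rfl
    simpa using 𝒯.norm_normals K 0 h
  · exact (𝒯.isBounded_closure_cell K).subset (inter_subset_left.trans inter_subset_left)
  · rintro y ⟨⟨-, hy⟩, -⟩ z ⟨⟨-, hz⟩, -⟩
    rw [inner_sub_right, show inner ℝ ν y = _ from hy, show inner ℝ ν z = _ from hz, sub_self]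

/-- A point of the Dirichlet boundary in the closure of a cell lies on a Dirichlet face of it. -/
theorem exists_mem_dirFace (hΩ : IsOpen Ω) (hΓ : ΓD ⊆ frontier Ω) {K : Fin 𝒯.card} {y : Space l}
    (hy : y ∈ ΓD) (hyK : y ∈ closure (𝒯.cell K)) : ∃ ν ∈ 𝒯.normals K, y ∈ 𝒯.dirFace K ν := by
  have h1 : y ∉ 𝒯.cell K := fun h => by
    have := hΓ hy
    rw [hΩ.frontier_eq] at this
    exact this.2 (𝒯.cell_subset K h)
  rw [𝒯.cell_eq] at h1
  simp only [mem_ofPred_eq, not_forall, not_lt] at h1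
  obtain ⟨ν, hν, hle⟩ := h1
  exact ⟨ν, hν, ⟨hyK, (𝒯.inner_le_height_of_mem_closure hν hyK).antisymm hle⟩, hy⟩

/-! ### Perimeters of unions of cells -/

/-- The closed region occupied by a family of cells. -/
def region (S : Finset (Fin 𝒯.card)) : Set (Space l) := ⋃ K ∈ S, closure (𝒯.cell K)

/-- The perimeter inside the domain of a family of cells. -/
def perimeter (S : Finset (Fin 𝒯.card)) : ℝ≥0∞ :=
  ∑ K ∈ S, ∑ L ∈ Sᶜ, μHE[l - 1] (interface (𝒯.cell K) (𝒯.cell L))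

/-- The measure of the Dirichlet faces of a family of cells. -/
def dirPerimeter (S : Finset (Fin 𝒯.card)) : ℝ≥0∞ :=
  ∑ K ∈ S, ∑ ν ∈ 𝒯.normals K, μHE[l - 1] (𝒯.dirFace K ν)

theorem isClosed_region (S : Finset (Fin 𝒯.card)) : IsClosed (𝒯.region S) :=
  isClosed_biUnion_finset fun _ _ => isClosed_closure

theorem region_subset (S : Finset (Fin 𝒯.card)) : 𝒯.region S ⊆ closure Ω :=
  iUnion₂_subset fun K _ => 𝒯.closure_cell_subset K

theorem closure_subset_region_union (S : Finset (Fin 𝒯.card)) :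
    closure Ω ⊆ 𝒯.region S ∪ 𝒯.region Sᶜ := by
  rw [𝒯.closure_eq_iUnion]
  refine iUnion_subset fun K x hx => ?_
  by_cases hK : K ∈ S
  · exact Or.inl (mem_biUnion hK hx)
  · exact Or.inr (mem_biUnion (show K ∈ Sᶜ by simpa using hK) hx)

theorem perimeter_compl (S : Finset (Fin 𝒯.card)) : 𝒯.perimeter Sᶜ = 𝒯.perimeter S := by
  rw [perimeter, perimeter, Finset.sum_comm, compl_compl]
  simp_rw [interface, inter_comm]

/-- A segment of the closed domain that joins a family of cells to its complement crosses an
interface. -/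
theorem exists_mem_interface {S : Finset (Fin 𝒯.card)} {a b : Space l} (ha : a ∈ 𝒯.region S)
    (hb : b ∈ 𝒯.region Sᶜ) (hab : segment ℝ a b ⊆ closure Ω) :
    ∃ K ∈ S, ∃ L ∈ Sᶜ, ∃ z ∈ segment ℝ a b, z ∈ interface (𝒯.cell K) (𝒯.cell L) := by
  obtain ⟨z, hz, hzA, hzB⟩ := (isPreconnected_closed_iff.1 (convex_segment a b).isPreconnected)
    (𝒯.region S) (𝒯.region Sᶜ) (𝒯.isClosed_region S) (𝒯.isClosed_region Sᶜ)
    (hab.trans (𝒯.closure_subset_region_union S)) ⟨a, left_mem_segment ℝ a b, ha⟩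
    ⟨b, right_mem_segment ℝ a b, hb⟩
  simp only [region, mem_iUnion] at hzA hzB
  obtain ⟨K, hK, hzK⟩ := hzA
  obtain ⟨L, hL, hzL⟩ := hzB
  exact ⟨K, hK, L, hL, z, hz, hzK, hzL⟩

/-- A point from which a segment directed by `-w`, of length at most that of `w`, meets an interface
lies in the sweep of this interface along `w`. Hence the perimeter controls the volume of such
points. -/
theorem volume_crossing_le {c : ℝ≥0∞} {w : Space l}
    (hc : ∀ σ : Set (Space l), volume (sweep σ w) ≤ c * μHE[l - 1] σ) {S : Finset (Fin 𝒯.card)} :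
    volume (⋃ K ∈ S, ⋃ L ∈ Sᶜ, sweep (interface (𝒯.cell K) (𝒯.cell L)) w) ≤
      c * 𝒯.perimeter S := by
  rw [perimeter, Finset.mul_sum]
  refine (measure_biUnion_finset_le _ _).trans (Finset.sum_le_sum fun K _ => ?_)
  rw [Finset.mul_sum]
  exact (measure_biUnion_finset_le _ _).trans (Finset.sum_le_sum fun L _ => hc _)

theorem volume_dirSweep_le {c : ℝ≥0∞} {w : Space l}
    (hc : ∀ σ : Set (Space l), volume (sweep σ w) ≤ c * μHE[l - 1] σ) {S : Finset (Fin 𝒯.card)} :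
    volume (⋃ K ∈ S, ⋃ ν ∈ 𝒯.normals K, sweep (𝒯.dirFace K ν) w) ≤ c * 𝒯.dirPerimeter S := by
  rw [dirPerimeter, Finset.mul_sum]
  refine (measure_biUnion_finset_le _ _).trans (Finset.sum_le_sum fun K _ => ?_)
  rw [Finset.mul_sum]
  exact (measure_biUnion_finset_le _ _).trans (Finset.sum_le_sum fun L _ => hc _)

end AdmissibleMesh

/-! ### Linked sets and the relative isoperimetric inequality -/

/-- Two sets are linked when no admissible mesh can separate them by a family of cells of small
perimeter. -/
def Linked {l : ℕ} (Ω ΓD : Set (Space l)) (ξ : ℝ) (E F : Set (Space l)) : Prop :=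
  ∃ C : ℝ≥0∞, C ≠ ⊤ ∧ ∀ (𝒯 : AdmissibleMesh Ω ΓD ξ) (S : Finset (Fin 𝒯.card)),
    volume (E ∩ 𝒯.region S) * volume (F ∩ 𝒯.region Sᶜ) ≤ C * 𝒯.perimeter S

section Linked

variable {l : ℕ} {Ω ΓD : Set (Space l)} {ξ : ℝ} {E F G : Set (Space l)}

theorem Linked.symm (h : Linked Ω ΓD ξ E F) : Linked Ω ΓD ξ F E := by
  obtain ⟨C, hC, h⟩ := h
  refine ⟨C, hC, fun 𝒯 S => ?_⟩
  have := h 𝒯 Sᶜ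
  rwa [compl_compl, 𝒯.perimeter_compl, mul_comm] at this

theorem Linked.mono {E' F' : Set (Space l)} (h : Linked Ω ΓD ξ E F) (hE : E' ⊆ E) (hF : F' ⊆ F) :
    Linked Ω ΓD ξ E' F' := by
  obtain ⟨C, hC, h⟩ := h
  exact ⟨C, hC, fun 𝒯 S => le_trans (by gcongr) (h 𝒯 S)⟩

theorem Linked.trans (hE : volume E ≠ ⊤) (hF : volume F ≠ ⊤) (hG : G ⊆ closure Ω)
    (hG0 : volume G ≠ 0) (hGt : volume G ≠ ⊤) (h₁ : Linked Ω ΓD ξ E G)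
    (h₂ : Linked Ω ΓD ξ G F) : Linked Ω ΓD ξ E F := by
  obtain ⟨C₁, hC₁, h₁⟩ := h₁
  obtain ⟨C₂, hC₂, h₂⟩ := h₂
  refine ⟨(volume G)⁻¹ * (C₁ * volume F + C₂ * volume E), ?_, fun 𝒯 S => ?_⟩
  · exact ENNReal.mul_ne_top (by simpa using hG0)
      (ENNReal.add_ne_top.2 ⟨ENNReal.mul_ne_top hC₁ hF, ENNReal.mul_ne_top hC₂ hE⟩)
  · have hGle : volume G ≤ volume (G ∩ 𝒯.region S) + volume (G ∩ 𝒯.region Sᶜ) := by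
      refine le_trans (measure_mono ?_) (measure_union_le _ _)
      rw [← inter_union_distrib_left]
      exact fun x hx => ⟨hx, 𝒯.closure_subset_region_union S (hG hx)⟩
    set a := volume (E ∩ 𝒯.region S)
    set b := volume (F ∩ 𝒯.region Sᶜ)
    have ha : a ≤ volume E := measure_mono inter_subset_left
    have hb : b ≤ volume F := measure_mono inter_subset_left
    rw [mul_assoc, ← ENNReal.div_eq_inv_mul, ENNReal.le_div_iff_mul_le (Or.inl hG0) (Or.inl hGt)]
    calc a * b * volume G
        ≤ a * b * (volume (G ∩ 𝒯.region S) + volume (G ∩ 𝒯.region Sᶜ)) := by gcongr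
      _ = (a * volume (G ∩ 𝒯.region Sᶜ)) * b + (volume (G ∩ 𝒯.region S) * b) * a := by ring
      _ ≤ (C₁ * 𝒯.perimeter S) * volume F + (C₂ * 𝒯.perimeter S) * volume E := by
          exact add_le_add (mul_le_mul' (h₁ 𝒯 S) hb) (mul_le_mul' (h₂ 𝒯 S) ha)
      _ = (C₁ * volume F + C₂ * volume E) * 𝒯.perimeter S := by ring

theorem Linked.iUnion {ι κ : Type*} [Fintype ι] [Fintype κ] {E : ι → Set (Space l)}
    {F : κ → Set (Space l)} (h : ∀ i j, Linked Ω ΓD ξ (E i) (F j)) :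
    Linked Ω ΓD ξ (⋃ i, E i) (⋃ j, F j) := by
  choose C hC h using h
  refine ⟨∑ i, ∑ j, C i j, by simp [ENNReal.sum_eq_top, hC], fun 𝒯 S => ?_⟩
  calc volume ((⋃ i, E i) ∩ 𝒯.region S) * volume ((⋃ j, F j) ∩ 𝒯.region Sᶜ)
      ≤ (∑ i, volume (E i ∩ 𝒯.region S)) * ∑ j, volume (F j ∩ 𝒯.region Sᶜ) := by
        rw [iUnion_inter, iUnion_inter]
        gcongr <;> exact measure_iUnion_fintype_le _ _
    _ = ∑ i, ∑ j, volume (E i ∩ 𝒯.region S) * volume (F j ∩ 𝒯.region Sᶜ) :=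
        Finset.sum_mul_sum _ _ _ _
    _ ≤ ∑ i, ∑ j, C i j * 𝒯.perimeter S := by
        exact Finset.sum_le_sum fun i _ => Finset.sum_le_sum fun j _ => h i j 𝒯 S
    _ = _ := by simp_rw [Finset.sum_mul]

/-- Measurable subsets of a bounded convex subset of the closed domain are linked. -/
theorem linked_of_convex (hl : 1 ≤ l) {Q : Set (Space l)} (hQ : Convex ℝ Q)
    (hQb : Bornology.IsBounded Q) (hQΩ : Q ⊆ closure Ω) (hE : E ⊆ Q) (hF : F ⊆ Q)
    (hEm : MeasurableSet E) (hFm : MeasurableSet F) : Linked Ω ΓD ξ E F := by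
  obtain ⟨c, hc, hsw⟩ := exists_volume_sweep_le hl (Metric.diam Q)
  refine ⟨c * volume (Metric.closedBall (0 : Space l) (Metric.diam Q)),
    ENNReal.mul_ne_top hc measure_closedBall_lt_top.ne, fun 𝒯 S => ?_⟩
  set X := E ∩ 𝒯.region S with hX
  set Y := F ∩ 𝒯.region Sᶜ with hY
  have hXm : MeasurableSet X := hEm.inter (𝒯.isClosed_region S).measurableSet
  have hYm : MeasurableSet Y := hFm.inter (𝒯.isClosed_region Sᶜ).measurableSet
  have hpres := measurePreserving_prod_add (volume : Measure (Space l)) (volume : Measure (Space l))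
  -- The shear `(x, w) ↦ (x, x + w)` preserves the product measure, so the product of the volumes is
  -- the integral over `w` of the volume of the points `x` of `X` with `x + w` in `Y`.
  rw [← Measure.prod_prod, ← hpres.measure_preimage (hXm.prod hYm).nullMeasurableSet,
    Measure.prod_apply_symm (hpres.measurable (hXm.prod hYm))]
  have hle : ∀ w : Space l, volume ((fun x => (x, w)) ⁻¹'
      ((fun z : Space l × Space l => (z.1, z.1 + z.2)) ⁻¹' X ×ˢ Y)) ≤
      (Metric.closedBall (0 : Space l) (Metric.diam Q)).indicator
        (fun _ => c * 𝒯.perimeter S) w := by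
    intro w
    by_cases hw : w ∈ Metric.closedBall (0 : Space l) (Metric.diam Q)
    · rw [indicator_of_mem hw]
      have hw' : ‖-w‖ ≤ Metric.diam Q := by simpa using hw
      refine le_trans (measure_mono ?_) (𝒯.volume_crossing_le (hsw (-w) hw'))
      rintro x ⟨⟨hxE, hxA⟩, hyF, hyB⟩
      simp only at hyF hyB hxE hxA
      -- Convexity of `Q` keeps the segment from `x` to `x + w` in the closed domain, so it crosses
      -- an interface at some `x + θ w`; backwards, `x` is swept along `-w`.
      obtain ⟨K, hK, L, hL, z, hz, hzi⟩ := 𝒯.exists_mem_interface hxA hyB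
        ((hQ.segment_subset (hE hxE) (hF hyF)).trans hQΩ)
      rw [segment_eq_image'] at hz
      obtain ⟨θ, hθ, rfl⟩ := hz
      refine mem_biUnion hK (mem_biUnion hL ⟨_, hzi, θ, hθ, ?_⟩)
      simp
    · rw [indicator_of_notMem hw]
      rw [nonpos_iff_eq_zero]
      convert measure_empty (μ := (volume : Measure (Space l)))
      ext x
      simp only [mem_preimage, mem_prod, mem_empty_iff_false, iff_false]
      rintro ⟨⟨hxE, hxA⟩, hyF, hyB⟩
      apply hw
      have := Metric.dist_le_diam_of_mem hQb (hF hyF) (hE hxE)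
      simpa [dist_eq_norm] using this
  calc _ ≤ ∫⁻ w, (Metric.closedBall (0 : Space l) (Metric.diam Q)).indicator
        (fun _ => c * 𝒯.perimeter S) w := lintegral_mono hle
    _ = c * 𝒯.perimeter S * volume (Metric.closedBall (0 : Space l) (Metric.diam Q)) := by
        rw [lintegral_indicator measurableSet_closedBall]; simp
    _ = _ := by ring

/-- Connectedness: the points having a ball linked to the reference ball form an open set containing
`x₀`. It is closed relative to `Ω`, because a ball around a limit point shares a small ball with one
already linked, and linkage is transitive through a set of positive volume. -/
theorem linked_balls (hl : 1 ≤ l) (hΩ : IsOpen Ω) (hconn : IsConnected Ω) {x₀ : Space l} {r₀ : ℝ}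
    (hr₀ : 0 < r₀) (hx₀ : Metric.ball x₀ r₀ ⊆ Ω) {y : Space l} (hy : y ∈ Ω) :
    ∃ r > 0, Metric.ball y r ⊆ Ω ∧ Linked Ω ΓD ξ (Metric.ball x₀ r₀) (Metric.ball y r) := by
  set u : Set (Space l) := {y | ∃ r > 0, Metric.ball y r ⊆ Ω ∧
    Linked Ω ΓD ξ (Metric.ball x₀ r₀) (Metric.ball y r)} with hu
  suffices Ω ⊆ u from this hy
  refine hconn.isPreconnected.subset_of_closure_inter_subset ?_ ?_ ?_
  · refine Metric.isOpen_iff.2 fun x ⟨r, hr, hrΩ, hL⟩ => ⟨r, hr, fun z hz => ?_⟩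
    obtain ⟨ε, hε, hsub⟩ := Metric.isOpen_iff.1 Metric.isOpen_ball z hz
    exact ⟨ε, hε, hsub.trans hrΩ, hL.mono subset_rfl hsub⟩
  · exact ⟨x₀, hx₀ (Metric.mem_ball_self hr₀), r₀, hr₀, hx₀,
      linked_of_convex hl (convex_ball x₀ r₀) Metric.isBounded_ball (hx₀.trans subset_closure)
        subset_rfl subset_rfl measurableSet_ball measurableSet_ball⟩
  · rintro z ⟨hzu, hzΩ⟩
    obtain ⟨ε, hε, hεΩ⟩ := Metric.isOpen_iff.1 hΩ z hzΩ
    obtain ⟨x, ⟨r, hr, hrΩ, hL⟩, hxz⟩ := Metric.mem_closure_iff.1 hzu ε hε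
    rw [dist_comm] at hxz
    obtain ⟨δ, hδ, hsub⟩ := Metric.isOpen_iff.1 (Metric.isOpen_ball.inter Metric.isOpen_ball) x
      (⟨hxz, Metric.mem_ball_self hr⟩ : x ∈ Metric.ball z ε ∩ Metric.ball x r)
    refine ⟨ε, hε, hεΩ, Linked.trans (G := Metric.ball x δ) measure_ball_lt_top.ne
      measure_ball_lt_top.ne ?_ (Metric.measure_ball_pos _ _ hδ).ne' measure_ball_lt_top.ne
      (hL.mono subset_rfl (hsub.trans inter_subset_right)) ?_⟩
    · exact (hsub.trans inter_subset_left).trans (hεΩ.trans subset_closure)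
    · exact linked_of_convex hl (convex_ball z ε) Metric.isBounded_ball (hεΩ.trans subset_closure)
        (hsub.trans inter_subset_left) subset_rfl measurableSet_ball measurableSet_ball

/-- The chain of balls cannot reach the boundary with a uniform constant. The cells of the fixed
mesh `𝒯₀` can: each is convex, hence linked in its entirety to a small ball around its centre, and
finitely many of them cover the closed domain. -/
theorem linked_closure (hl : 1 ≤ l) (hΩ : IsOpen Ω) (hconn : IsConnected Ω)
    (𝒯₀ : AdmissibleMesh Ω ΓD ξ) : Linked Ω ΓD ξ (closure Ω) (closure Ω) := by
  obtain ⟨x₀, hx₀⟩ := hconn.nonempty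
  obtain ⟨r₀, hr₀, hr₀Ω⟩ := Metric.isOpen_iff.1 hΩ x₀ hx₀
  have hfin : ∀ K, volume (closure (𝒯₀.cell K)) ≠ ⊤ := fun K =>
    (𝒯₀.isBounded_closure_cell K).measure_lt_top.ne
  have hcell : ∀ K, Linked Ω ΓD ξ (Metric.ball x₀ r₀) (closure (𝒯₀.cell K)) := by
    intro K
    obtain ⟨r, hr, -, hL⟩ := linked_balls (ΓD := ΓD) (ξ := ξ) hl hΩ hconn hr₀ hr₀Ω
      (𝒯₀.cell_subset K (𝒯₀.center_mem K))
    obtain ⟨δ, hδ, hsub⟩ := Metric.isOpen_iff.1 ((𝒯₀.isOpen_cell K).inter Metric.isOpen_ball)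
      (𝒯₀.center K) (⟨𝒯₀.center_mem K, Metric.mem_ball_self hr⟩ :
        𝒯₀.center K ∈ 𝒯₀.cell K ∩ Metric.ball (𝒯₀.center K) r)
    have hδK : Metric.ball (𝒯₀.center K) δ ⊆ closure (𝒯₀.cell K) :=
      (hsub.trans inter_subset_left).trans subset_closure
    refine Linked.trans measure_ball_lt_top.ne (hfin K) (hδK.trans (𝒯₀.closure_cell_subset K))
      (Metric.measure_ball_pos _ _ hδ).ne' measure_ball_lt_top.ne
      (hL.mono subset_rfl (hsub.trans inter_subset_right)) ?_
    exact linked_of_convex hl (𝒯₀.convex_cell K).closure (𝒯₀.isBounded_closure_cell K)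
      (𝒯₀.closure_cell_subset K) hδK subset_rfl measurableSet_ball isClosed_closure.measurableSet
  have hball0 := (Metric.measure_ball_pos volume x₀ hr₀).ne'
  have hfinal := Linked.iUnion fun K L => Linked.trans (hfin K) (hfin L) (hr₀Ω.trans subset_closure)
    hball0 measure_ball_lt_top.ne (hcell K).symm (hcell L)
  rwa [← 𝒯₀.closure_eq_iUnion] at hfinal

/-- Relative isoperimetric inequality for families of cells, with the Dirichlet faces counted in
the perimeter. -/
theorem exists_volume_region_le (hl : 1 ≤ l) (hΩ : IsOpen Ω) (hconn : IsConnected Ω)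
    (hΓ : ΓD ⊆ frontier Ω) (hΓm : MeasurableSet ΓD) (hΓpos : 0 < μHE[l - 1] ΓD)
    (𝒯₀ : AdmissibleMesh Ω ΓD ξ) :
    ∃ C : ℝ≥0∞, C ≠ ⊤ ∧ ∀ (𝒯 : AdmissibleMesh Ω ΓD ξ) (S : Finset (Fin 𝒯.card)),
      volume (𝒯.region S) ≤ C * (𝒯.perimeter S + 𝒯.dirPerimeter S) := by
  -- The finitely many Dirichlet faces of `𝒯₀` cover the Dirichlet boundary, so they cannot all be
  -- null.
  obtain ⟨K₀, ν, hν, hpos⟩ : ∃ K, ∃ ν ∈ 𝒯₀.normals K, 0 < μHE[l - 1] (𝒯₀.dirFace K ν) := by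
    by_contra! hcon
    refine hΓpos.ne' (measure_mono_null (t := ⋃ K, ⋃ ν ∈ 𝒯₀.normals K, 𝒯₀.dirFace K ν) ?_ ?_)
    · intro y hy
      have hy' : y ∈ closure Ω := frontier_subset_closure (hΓ hy)
      rw [𝒯₀.closure_eq_iUnion, mem_iUnion] at hy'
      obtain ⟨K, hK⟩ := hy'
      obtain ⟨ν, hν, h⟩ := 𝒯₀.exists_mem_dirFace hΩ hΓ hy hK
      exact mem_iUnion.2 ⟨K, mem_biUnion hν h⟩
    · refine measure_iUnion_null fun K => (measure_biUnion_null_iff (Finset.countable_toSet _)).2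
        fun ν hν => le_antisymm (hcon K ν hν) bot_le
  -- Every point of the face is moved into the open cell by some vector of a countable dense family;
  -- one of these vectors therefore works for a part of the face of positive measure.
  obtain ⟨w, hw⟩ : ∃ w : Space l,
      0 < μHE[l - 1] (𝒯₀.dirFace K₀ ν ∩ {y | y + w ∈ 𝒯₀.cell K₀}) := by
    by_contra! hcon
    refine hpos.ne' (measure_mono_null (t := ⋃ n : ℕ, 𝒯₀.dirFace K₀ ν ∩
      {y | y + TopologicalSpace.denseSeq (Space l) n ∈ 𝒯₀.cell K₀}) ?_
      (measure_iUnion_null fun n => le_antisymm (hcon _) bot_le))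
    intro y hy
    obtain ⟨n, hn⟩ := (TopologicalSpace.denseRange_denseSeq (Space l)).exists_mem_open
      (s := {w | y + w ∈ 𝒯₀.cell K₀}) ((𝒯₀.isOpen_cell K₀).preimage (by fun_prop))
      ⟨𝒯₀.center K₀ - y, by simpa using 𝒯₀.center_mem K₀⟩
    exact mem_iUnion.2 ⟨n, hy, hn⟩
  set F := 𝒯₀.dirFace K₀ ν ∩ {y | y + w ∈ 𝒯₀.cell K₀} with hF
  have hFm : MeasurableSet F := by
    refine ((isClosed_closure.measurableSet.inter ?_).inter hΓm).inter ?_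
    · exact (isClosed_eq (by fun_prop) continuous_const).measurableSet
    · exact ((𝒯₀.isOpen_cell K₀).preimage (by fun_prop)).measurableSet
  have hFν : ∀ y ∈ F, inner ℝ ν y = 𝒯₀.height K₀ ν := fun y hy => hy.1.1.2
  have hvw : inner ℝ ν w ≠ 0 := by
    obtain ⟨y, hy⟩ := nonempty_of_measure_ne_zero hw.ne'
    have h1 := hy.2
    simp only [mem_ofPred_eq] at h1
    rw [𝒯₀.cell_eq] at h1
    have h2 := h1 ν hν
    rw [inner_add_right, hFν y hy] at h2
    intro h0
    linarith
  have hseg : ∀ y ∈ F, ∀ r ∈ Icc (0 : ℝ) 1, y + r • w ∈ closure (𝒯₀.cell K₀) := by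
    intro y hy r hr
    have := (𝒯₀.convex_cell K₀).closure.add_smul_sub_mem hy.1.1.1 (subset_closure hy.2) hr
    simpa using this
  set E := sweep F w with hE
  have hE0 : 0 < volume E := volume_sweep_pos hvw hFm hFν hw
  have hEΩ : E ⊆ closure Ω := by
    rintro x ⟨y, hy, r, hr, rfl⟩
    exact 𝒯₀.closure_cell_subset K₀ (hseg y hy r hr)
  have hEt : volume E ≠ ⊤ := ne_top_of_le_ne_top 𝒯₀.volume_closure_ne_top (measure_mono hEΩ)
  obtain ⟨C, hC, hiso⟩ := linked_closure hl hΩ hconn 𝒯₀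
  obtain ⟨c, hc, hsw⟩ := exists_volume_sweep_le hl ‖w‖
  refine ⟨(volume E)⁻¹ * (c * volume (closure Ω) + C), ?_, fun 𝒯 S => ?_⟩
  · exact ENNReal.mul_ne_top (by simpa using hE0.ne')
      (ENNReal.add_ne_top.2 ⟨ENNReal.mul_ne_top hc 𝒯₀.volume_closure_ne_top, hC⟩)
  -- Follow a point of `E` in the region of `S` back to its base point `y` on the Dirichlet
  -- boundary. If `y` belongs to a cell closure of `S`, the point is swept from a Dirichlet face of
  -- that cell; otherwise the path crosses the perimeter of `S`.
  have hA : volume (E ∩ 𝒯.region S) ≤ c * (𝒯.perimeter S + 𝒯.dirPerimeter S) := by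
    rw [mul_add]
    refine le_trans (measure_mono ?_) ((measure_union_le _ _).trans
      (add_le_add (𝒯.volume_crossing_le (hsw w le_rfl)) (𝒯.volume_dirSweep_le (hsw w le_rfl))))
    rintro x ⟨⟨y, hy, r, hr, rfl⟩, hxA⟩
    rcases 𝒯.closure_subset_region_union S (𝒯₀.closure_cell_subset K₀ hy.1.1.1) with hyA | hyB
    · right
      simp only [AdmissibleMesh.region, mem_iUnion] at hyA
      obtain ⟨K, hK, hyK⟩ := hyA
      obtain ⟨ν', hν', hyν⟩ := 𝒯.exists_mem_dirFace hΩ hΓ hy.1.2 hyK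
      exact mem_biUnion hK (mem_biUnion hν' ⟨y, hyν, r, hr, rfl⟩)
    · left
      obtain ⟨K, hK, L, hL, z, hz, hzi⟩ := 𝒯.exists_mem_interface hxA hyB
        (((𝒯₀.convex_cell K₀).closure.segment_subset (hseg y hy r hr) hy.1.1.1).trans
          (𝒯₀.closure_cell_subset K₀))
      rw [segment_eq_image'] at hz
      obtain ⟨θ, hθ, rfl⟩ := hz
      refine mem_biUnion hK (mem_biUnion hL ⟨_, hzi, θ * r,
        ⟨mul_nonneg hθ.1 hr.1, mul_le_one₀ hθ.2 hr.1 hr.2⟩, ?_⟩)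
      rw [mul_smul]
      simp
  have hB : volume (E ∩ 𝒯.region Sᶜ) * volume (𝒯.region S) ≤
      C * (𝒯.perimeter S + 𝒯.dirPerimeter S) := by
    have := hiso 𝒯 S
    rw [inter_eq_right.2 (𝒯.region_subset S), inter_eq_right.2 (𝒯.region_subset Sᶜ)] at this
    calc _ ≤ volume (𝒯.region Sᶜ) * volume (𝒯.region S) := by gcongr; exact inter_subset_right
      _ ≤ C * 𝒯.perimeter S := by rwa [mul_comm]
      _ ≤ _ := by gcongr; exact le_self_add
  have hEle : volume E ≤ volume (E ∩ 𝒯.region S) + volume (E ∩ 𝒯.region Sᶜ) := by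
    refine le_trans (measure_mono ?_) (measure_union_le _ _)
    rw [← inter_union_distrib_left]
    exact fun x hx => ⟨hx, 𝒯.closure_subset_region_union S (hEΩ hx)⟩
  -- The fixed set `E` is split by the region of `S`: `hA` handles the inner part, and the linkage
  -- of the closed domain with itself handles the outer part.
  rw [mul_assoc, ← ENNReal.div_eq_inv_mul, ENNReal.le_div_iff_mul_le (Or.inl hE0.ne') (Or.inl hEt)]
  calc volume (𝒯.region S) * volume E
      ≤ volume (𝒯.region S) * (volume (E ∩ 𝒯.region S) + volume (E ∩ 𝒯.region Sᶜ)) := by gcongr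
    _ = volume (E ∩ 𝒯.region S) * volume (𝒯.region S) +
        volume (E ∩ 𝒯.region Sᶜ) * volume (𝒯.region S) := by ring
    _ ≤ c * (𝒯.perimeter S + 𝒯.dirPerimeter S) * volume (closure Ω) +
        C * (𝒯.perimeter S + 𝒯.dirPerimeter S) := by
        gcongr
        exact 𝒯.region_subset S
    _ = _ := by ring

end Linked

/-! ### The discrete Poincaré inequality -/

namespace AdmissibleMesh

variable {l : ℕ} {Ω ΓD : Set (Space l)} {ξ : ℝ} (𝒯 : AdmissibleMesh Ω ΓD ξ)

theorem sum_nbrs_comm (f : Fin 𝒯.card → Fin 𝒯.card → ℝ) :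
    ∑ K, ∑ L ∈ 𝒯.nbrs K, f K L = ∑ K, ∑ L ∈ 𝒯.nbrs K, f L K :=
  Finset.sum_comm' fun K L => by simp [𝒯.mem_nbrs_comm (K := K) (L := L)]

theorem regular' (K : Fin 𝒯.card) :
    ∑ L ∈ 𝒯.nbrs K, 𝒯.areaInt K L * 𝒯.distInt K L +
      ∑ ν ∈ 𝒯.normals K, 𝒯.areaDir K ν * 𝒯.distDir K ν ≤ ξ * volume.real (𝒯.cell K) :=
  𝒯.regular K

theorem volume_cell_ne_top (K : Fin 𝒯.card) : volume (𝒯.cell K) ≠ ⊤ :=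
  (𝒯.cell_bounded K).measure_lt_top.ne

theorem volume_cell_pos (K : Fin 𝒯.card) : 0 < volume.real (𝒯.cell K) :=
  ENNReal.toReal_pos ((𝒯.isOpen_cell K).measure_pos volume ⟨_, 𝒯.center_mem K⟩).ne'
    (𝒯.volume_cell_ne_top K)

theorem sum_volume_le_region (S : Finset (Fin 𝒯.card)) :
    ∑ K ∈ S, volume (𝒯.cell K) ≤ volume (𝒯.region S) := by
  rw [← measure_biUnion_finset]
  · exact measure_mono (iUnion₂_mono fun K _ => subset_closure)
  · intro K _ L _ hKL
    exact disjoint_iff_inter_eq_empty.2 (𝒯.cell_disjoint K L hKL)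
  · exact fun K _ => (𝒯.isOpen_cell K).measurableSet

theorem sum_volume_le (𝒯 : AdmissibleMesh Ω ΓD ξ) (hΩb : Bornology.IsBounded Ω) :
    ∑ K, volume.real (𝒯.cell K) ≤ volume.real Ω := by
  simp only [Measure.real]
  rw [← ENNReal.toReal_sum fun K _ => 𝒯.volume_cell_ne_top K]
  refine ENNReal.toReal_mono hΩb.measure_lt_top.ne ?_
  rw [← measure_biUnion_finset]
  · exact measure_mono (iUnion₂_subset fun K _ => 𝒯.cell_subset K)
  · intro K _ L _ hKL
    exact disjoint_iff_inter_eq_empty.2 (𝒯.cell_disjoint K L hKL)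
  · exact fun K _ => (𝒯.isOpen_cell K).measurableSet

/-- Pairs that are not neighbours contribute nothing, their interface being null, so the perimeter
is a finite sum of areas. -/
theorem perimeter_eq (S : Finset (Fin 𝒯.card)) : 𝒯.perimeter S =
    ENNReal.ofReal (∑ K ∈ S, ∑ L ∈ (𝒯.nbrs K).filter (· ∉ S), 𝒯.areaInt K L) := by
  rw [ENNReal.ofReal_sum_of_nonneg
    fun K _ => Finset.sum_nonneg fun L _ => 𝒯.areaInt_nonneg K L, perimeter]
  refine Finset.sum_congr rfl fun K hK => ?_
  rw [ENNReal.ofReal_sum_of_nonneg fun L _ => 𝒯.areaInt_nonneg K L]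
  symm
  refine Finset.sum_subset_zero_on_sdiff ?_ ?_ ?_
  · intro L hL
    simpa using (Finset.mem_filter.1 hL).2
  · intro L hL
    simp only [Finset.mem_sdiff, Finset.mem_compl, Finset.mem_filter, not_and, not_not] at hL
    refine 𝒯.measure_interface_eq_zero ?_ fun h => hL.1 (hL.2 h)
    rintro rfl
    exact hL.1 hK
  · intro L hL
    exact (𝒯.measure_interface_eq_ofReal (Finset.mem_filter.1 hL).1).symm

theorem dirPerimeter_eq (S : Finset (Fin 𝒯.card)) : 𝒯.dirPerimeter S =
    ENNReal.ofReal (∑ K ∈ S, ∑ ν ∈ 𝒯.normals K, 𝒯.areaDir K ν) := by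
  rw [ENNReal.ofReal_sum_of_nonneg
    fun K _ => Finset.sum_nonneg fun ν _ => 𝒯.areaDir_nonneg K ν, dirPerimeter]
  refine Finset.sum_congr rfl fun K hK => ?_
  rw [ENNReal.ofReal_sum_of_nonneg fun L _ => 𝒯.areaDir_nonneg K L]
  exact Finset.sum_congr rfl fun ν hν => 𝒯.measure_dirFace_eq_ofReal hν

end AdmissibleMesh

section Poincare

variable {l : ℕ} {Ω ΓD : Set (Space l)} {ξ : ℝ}

theorem exists_sum_volume_le (hl : 1 ≤ l) (hΩ : IsOpen Ω) (hconn : IsConnected Ω)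
    (hΓ : ΓD ⊆ frontier Ω) (hΓm : MeasurableSet ΓD) (hΓpos : 0 < μHE[l - 1] ΓD)
    (𝒯₀ : AdmissibleMesh Ω ΓD ξ) :
    ∃ C : ℝ, 0 < C ∧ ∀ (𝒯 : AdmissibleMesh Ω ΓD ξ) (S : Finset (Fin 𝒯.card)),
      ∑ K ∈ S, volume.real (𝒯.cell K) ≤
        C * (∑ K ∈ S, ∑ L ∈ (𝒯.nbrs K).filter (· ∉ S), 𝒯.areaInt K L +
          ∑ K ∈ S, ∑ ν ∈ 𝒯.normals K, 𝒯.areaDir K ν) := by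
  obtain ⟨C, hC, h⟩ := exists_volume_region_le hl hΩ hconn hΓ hΓm hΓpos 𝒯₀
  refine ⟨C.toReal + 1, by positivity, fun 𝒯 S => ?_⟩
  set a := ∑ K ∈ S, ∑ L ∈ (𝒯.nbrs K).filter (· ∉ S), 𝒯.areaInt K L with ha
  set b := ∑ K ∈ S, ∑ ν ∈ 𝒯.normals K, 𝒯.areaDir K ν with hb
  have ha0 : 0 ≤ a := Finset.sum_nonneg fun K _ => Finset.sum_nonneg fun L _ =>
    𝒯.areaInt_nonneg K L
  have hb0 : 0 ≤ b := Finset.sum_nonneg fun K _ => Finset.sum_nonneg fun ν _ =>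
    𝒯.areaDir_nonneg K ν
  have h1 := (𝒯.sum_volume_le_region S).trans (h 𝒯 S)
  rw [𝒯.perimeter_eq, 𝒯.dirPerimeter_eq, ← ha, ← hb, ← ENNReal.ofReal_add ha0 hb0,
    ← ENNReal.ofReal_toReal hC, ← ENNReal.ofReal_mul ENNReal.toReal_nonneg] at h1
  have h2 := ENNReal.toReal_mono ENNReal.ofReal_ne_top h1
  rw [ENNReal.toReal_sum fun K _ => 𝒯.volume_cell_ne_top K,
    ENNReal.toReal_ofReal (by positivity)] at h2
  refine h2.trans ?_
  gcongr
  linarith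

/-- Poincaré inequality in `L¹` for piecewise constant nonnegative functions. -/
theorem exists_poincare_one (hl : 1 ≤ l) (hΩ : IsOpen Ω) (hconn : IsConnected Ω)
    (hΓ : ΓD ⊆ frontier Ω) (hΓm : MeasurableSet ΓD) (hΓpos : 0 < μHE[l - 1] ΓD)
    (𝒯₀ : AdmissibleMesh Ω ΓD ξ) :
    ∃ C : ℝ, 0 < C ∧ ∀ (𝒯 : AdmissibleMesh Ω ΓD ξ) (v : Fin 𝒯.card → ℝ), (∀ K, 0 ≤ v K) →
      ∑ K, volume.real (𝒯.cell K) * v K ≤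
        C * (∑ K, ∑ L ∈ 𝒯.nbrs K, 𝒯.areaInt K L * max (v K - v L) 0 +
          ∑ K, ∑ ν ∈ 𝒯.normals K, 𝒯.areaDir K ν * v K) := by
  obtain ⟨C, hC, h⟩ := exists_sum_volume_le hl hΩ hconn hΓ hΓm hΓpos 𝒯₀
  refine ⟨C, hC, fun 𝒯 v hv => ?_⟩
  -- Coarea argument: for `t ≥ 0` this is the isoperimetric inequality for the superlevel set `{v >
  -- t}`, a face being on its perimeter when `v L ≤ t < v K`. Integration in `t` turns the
  -- indicators into values and positive parts of jumps.
  have hpt : ∀ t : ℝ, ∑ K, volume.real (𝒯.cell K) * (Ico 0 (v K)).indicator 1 t ≤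
      C * (∑ K, ∑ L ∈ 𝒯.nbrs K, 𝒯.areaInt K L * (Ico (v L) (v K)).indicator 1 t +
          ∑ K, ∑ ν ∈ 𝒯.normals K, 𝒯.areaDir K ν * (Ico 0 (v K)).indicator 1 t) := by
    intro t
    have hind : ∀ a b : ℝ, 0 ≤ (Ico a b).indicator (1 : ℝ → ℝ) t := fun a b =>
      indicator_nonneg (fun _ _ => zero_le_one) t
    rcases lt_or_ge t 0 with ht | ht
    · have h0 : ∀ K, (Ico 0 (v K)).indicator (1 : ℝ → ℝ) t = 0 := fun K =>
        indicator_of_notMem (fun hm => absurd hm.1 (not_le.2 ht)) _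
      simp only [h0, mul_zero, Finset.sum_const_zero, add_zero]
      exact mul_nonneg hC.le (Finset.sum_nonneg fun K _ => Finset.sum_nonneg fun L _ =>
        mul_nonneg (𝒯.areaInt_nonneg K L) (hind _ _))
    · have h1 := h 𝒯 (Finset.univ.filter fun K => t < v K)
      refine le_of_eq_of_le ?_ (h1.trans_eq ?_)
      · rw [Finset.sum_filter]
        refine Finset.sum_congr rfl fun K _ => ?_
        simp [indicator_apply, ht]
      · congr 1
        congr 1
        · rw [Finset.sum_filter]
          refine Finset.sum_congr rfl fun K _ => ?_
          split_ifs with hK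
          · rw [Finset.sum_filter]
            refine Finset.sum_congr rfl fun L _ => ?_
            simp [indicator_apply, hK]
          · refine (Finset.sum_eq_zero fun L _ => ?_).symm
            simp [hK]
        · rw [Finset.sum_filter]
          refine Finset.sum_congr rfl fun K _ => ?_
          simp only [indicator_apply, mem_Ico, ht, true_and, Pi.one_apply]
          split_ifs <;> simp
  have hint : ∀ a b : ℝ, Integrable ((Ico a b).indicator (1 : ℝ → ℝ)) := fun a b =>
    (integrable_indicator_iff measurableSet_Ico).2 (by simp [Pi.one_def])
  have hval : ∀ a b : ℝ, ∫ t, (Ico a b).indicator (1 : ℝ → ℝ) t = max (b - a) 0 := by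
    intro a b
    rw [integral_indicator_one measurableSet_Ico, Real.volume_real_Ico]
  have hI := integral_mono (μ := volume)
    (integrable_finsetSum _ fun K _ => (hint 0 (v K)).const_mul (volume.real (𝒯.cell K)))
    (((integrable_finsetSum _ fun K _ => integrable_finsetSum _ fun L _ =>
      (hint (v L) (v K)).const_mul (𝒯.areaInt K L)).add
      (integrable_finsetSum Finset.univ fun K _ => integrable_finsetSum (𝒯.normals K) fun ν _ =>
        (hint 0 (v K)).const_mul (𝒯.areaDir K ν))).const_mul C) hpt
  rw [integral_finsetSum _ fun K _ => (hint 0 (v K)).const_mul _, integral_const_mul] at hI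
  simp only [Pi.add_apply] at hI
  rw [integral_add (integrable_finsetSum _ fun K _ => integrable_finsetSum _ fun L _ =>
      (hint (v L) (v K)).const_mul (𝒯.areaInt K L))
      (integrable_finsetSum Finset.univ fun K _ => integrable_finsetSum (𝒯.normals K) fun ν _ =>
        (hint 0 (v K)).const_mul (𝒯.areaDir K ν)),
    integral_finsetSum _ fun K _ => integrable_finsetSum _ fun L _ =>
      (hint (v L) (v K)).const_mul (𝒯.areaInt K L),
    integral_finsetSum _ fun K _ => integrable_finsetSum (𝒯.normals K) fun ν _ =>
        (hint 0 (v K)).const_mul (𝒯.areaDir K ν)] at hI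
  simp only [integral_const_mul, hval, sub_zero, max_eq_left (hv _)] at hI
  refine hI.trans_eq ?_
  congr 1
  congr 1
  · refine Finset.sum_congr rfl fun K _ => ?_
    rw [integral_finsetSum _ fun L _ => (hint (v L) (v K)).const_mul (𝒯.areaInt K L)]
    simp only [integral_const_mul, hval]
  · refine Finset.sum_congr rfl fun K _ => ?_
    rw [integral_finsetSum _ fun ν _ => (hint 0 (v K)).const_mul (𝒯.areaDir K ν)]
    simp only [integral_const_mul, hval, sub_zero, max_eq_left (hv _)]

/-- Young's inequality for the jump of a square. -/
theorem area_mul_jump_sq_le {A d μ x y : ℝ} (hA : 0 ≤ A) (hd : 0 < d) (hμ : 0 < μ) :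
    A * max (x ^ 2 - y ^ 2) 0 ≤
      μ * (A / d * |y - x| ^ 2) + (2 * μ)⁻¹ * (A * d * x ^ 2 + A * d * y ^ 2) := by
  rw [sq_abs]
  have h1 : (x ^ 2 - y ^ 2) ≤ μ / d * (y - x) ^ 2 + (2 * μ)⁻¹ * d * (x ^ 2 + y ^ 2) := by
    have h2 : 0 ≤ (2 * μ * (y - x) + d * (x + y)) ^ 2 / (4 * μ * d) := by positivity
    have h3 : (2 * μ * (y - x) + d * (x + y)) ^ 2 / (4 * μ * d) =
        μ / d * (y - x) ^ 2 + (y ^ 2 - x ^ 2) + (4 * μ)⁻¹ * d * (x + y) ^ 2 := by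
      field_simp; ring
    have h4 : (4 * μ)⁻¹ * d * (x + y) ^ 2 ≤ (2 * μ)⁻¹ * d * (x ^ 2 + y ^ 2) := by
      have : (2 * μ)⁻¹ * d * (x ^ 2 + y ^ 2) - (4 * μ)⁻¹ * d * (x + y) ^ 2 =
          (4 * μ)⁻¹ * d * (x - y) ^ 2 := by field_simp; ring
      have h5 : 0 ≤ (4 * μ)⁻¹ * d * (x - y) ^ 2 := by positivity
      linarith
    linarith
  have h6 : max (x ^ 2 - y ^ 2) 0 ≤ μ / d * (y - x) ^ 2 + (2 * μ)⁻¹ * d * (x ^ 2 + y ^ 2) :=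
    max_le h1 (by positivity)
  calc A * max (x ^ 2 - y ^ 2) 0
      ≤ A * (μ / d * (y - x) ^ 2 + (2 * μ)⁻¹ * d * (x ^ 2 + y ^ 2)) := by gcongr
    _ = _ := by ring

/-- Discrete Poincaré inequality for functions vanishing on the Dirichlet faces. -/
theorem exists_poincare_two (hl : 1 ≤ l) (hΩ : IsOpen Ω) (hconn : IsConnected Ω)
    (hΓ : ΓD ⊆ frontier Ω) (hΓm : MeasurableSet ΓD) (hΓpos : 0 < μHE[l - 1] ΓD) (hξ : 0 < ξ)
    (𝒯₀ : AdmissibleMesh Ω ΓD ξ) :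
    ∃ C : ℝ, 0 < C ∧ ∀ (𝒯 : AdmissibleMesh Ω ΓD ξ) (u : Fin 𝒯.card → ℝ),
      ∑ K, volume.real (𝒯.cell K) * u K ^ 2 ≤
        C * ∑ K, (∑ L ∈ 𝒯.nbrs K, 𝒯.τ K L * |u L - u K| ^ 2 +
          ∑ ν ∈ 𝒯.normals K, 𝒯.τDir K ν * |0 - u K| ^ 2) := by
  obtain ⟨C, hC, h⟩ := exists_poincare_one hl hΩ hconn hΓ hΓm hΓpos 𝒯₀
  refine ⟨4 * C ^ 2 * ξ, by positivity, fun 𝒯 u => ?_⟩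
  have h1 := h 𝒯 (fun K => u K ^ 2) fun K => sq_nonneg _
  set X := ∑ K, volume.real (𝒯.cell K) * u K ^ 2 with hX
  -- The Young parameter for which the zeroth-order remainder `C * μ⁻¹ * ξ * X` is `X / 2` and can
  -- be absorbed.
  set μ := 2 * C * ξ with hμ
  have hμ0 : 0 < μ := by positivity
  have hint : ∑ K, ∑ L ∈ 𝒯.nbrs K, 𝒯.areaInt K L * max (u K ^ 2 - u L ^ 2) 0 ≤
      μ * (∑ K, ∑ L ∈ 𝒯.nbrs K, 𝒯.τ K L * |u L - u K| ^ 2) +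
        μ⁻¹ * ∑ K, ∑ L ∈ 𝒯.nbrs K, 𝒯.areaInt K L * 𝒯.distInt K L * u K ^ 2 := by
    calc _ ≤ ∑ K, ∑ L ∈ 𝒯.nbrs K, (μ * (𝒯.τ K L * |u L - u K| ^ 2) +
          (2 * μ)⁻¹ * (𝒯.areaInt K L * 𝒯.distInt K L * u K ^ 2 +
            𝒯.areaInt K L * 𝒯.distInt K L * u L ^ 2)) :=
          Finset.sum_le_sum fun K _ => Finset.sum_le_sum fun L hL =>
            area_mul_jump_sq_le (𝒯.areaInt_nonneg K L) (𝒯.distInt_pos hL) hμ0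
      _ = _ := by
          simp only [Finset.sum_add_distrib, ← Finset.mul_sum]
          have hsw : ∑ K, ∑ L ∈ 𝒯.nbrs K, 𝒯.areaInt K L * 𝒯.distInt K L * u L ^ 2 =
              ∑ K, ∑ L ∈ 𝒯.nbrs K, 𝒯.areaInt K L * 𝒯.distInt K L * u K ^ 2 := by
            rw [𝒯.sum_nbrs_comm]
            refine Finset.sum_congr rfl fun K _ => Finset.sum_congr rfl fun L _ => ?_
            rw [𝒯.areaInt_comm, 𝒯.distInt_comm]
          have h2 : (2 * μ)⁻¹ = μ⁻¹ / 2 := by field_simp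
          rw [hsw, h2]
          simp only [AdmissibleMesh.τ]
          ring
  have hdir : ∑ K, ∑ ν ∈ 𝒯.normals K, 𝒯.areaDir K ν * u K ^ 2 ≤
      μ * (∑ K, ∑ ν ∈ 𝒯.normals K, 𝒯.τDir K ν * |0 - u K| ^ 2) +
        μ⁻¹ * ∑ K, ∑ ν ∈ 𝒯.normals K, 𝒯.areaDir K ν * 𝒯.distDir K ν * u K ^ 2 := by
    simp only [Finset.mul_sum, ← Finset.sum_add_distrib]
    refine Finset.sum_le_sum fun K _ => Finset.sum_le_sum fun ν hν => ?_
    have h3 := area_mul_jump_sq_le (x := u K) (y := 0) (𝒯.areaDir_nonneg K ν) (𝒯.distDir_pos hν) hμ0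
    have h4 : (2 * μ)⁻¹ ≤ μ⁻¹ := by gcongr; linarith
    have hA := 𝒯.areaDir_nonneg K ν
    have hd := (𝒯.distDir_pos hν).le
    have h5 : (2 * μ)⁻¹ * (𝒯.areaDir K ν * 𝒯.distDir K ν * u K ^ 2) ≤
      μ⁻¹ * (𝒯.areaDir K ν * 𝒯.distDir K ν * u K ^ 2) := by gcongr
    rw [max_eq_left (by nlinarith)] at h3
    simp only [AdmissibleMesh.τDir]
    nlinarith
  have hreg : (∑ K, ∑ L ∈ 𝒯.nbrs K, 𝒯.areaInt K L * 𝒯.distInt K L * u K ^ 2) +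
      ∑ K, ∑ ν ∈ 𝒯.normals K, 𝒯.areaDir K ν * 𝒯.distDir K ν * u K ^ 2 ≤ ξ * X := by
    rw [hX, ← Finset.sum_add_distrib, Finset.mul_sum]
    refine Finset.sum_le_sum fun K _ => ?_
    rw [← Finset.sum_mul, ← Finset.sum_mul, ← add_mul, ← mul_assoc]
    exact mul_le_mul_of_nonneg_right (𝒯.regular' K) (sq_nonneg _)
  rw [Finset.sum_add_distrib]
  set Y₁ := ∑ K, ∑ L ∈ 𝒯.nbrs K, 𝒯.τ K L * |u L - u K| ^ 2
  set Y₂ := ∑ K, ∑ ν ∈ 𝒯.normals K, 𝒯.τDir K ν * |0 - u K| ^ 2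
  set Z₁ := ∑ K, ∑ L ∈ 𝒯.nbrs K, 𝒯.areaInt K L * 𝒯.distInt K L * u K ^ 2
  set Z₂ := ∑ K, ∑ ν ∈ 𝒯.normals K, 𝒯.areaDir K ν * 𝒯.distDir K ν * u K ^ 2
  have h6 : X ≤ C * (μ * (Y₁ + Y₂) + μ⁻¹ * (ξ * X)) := by
    refine h1.trans (mul_le_mul_of_nonneg_left ?_ hC.le)
    have : μ⁻¹ * (Z₁ + Z₂) ≤ μ⁻¹ * (ξ * X) := by gcongr
    linarith
  have h7 : C * (μ * (Y₁ + Y₂) + μ⁻¹ * (ξ * X)) = 2 * C ^ 2 * ξ * (Y₁ + Y₂) + X / 2 := by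
    rw [hμ]; field_simp
  linarith

end Poincare

/-! ### The primitive of the inverse density -/

/-- The primitive of `1 / ρ` that vanishes at zero pressure. -/
def enthalpy (ρ : ℝ → ℝ) (q : ℝ) : ℝ := ∫ ζ in (0 : ℝ)..q, (ρ ζ)⁻¹

/-- The energy density `ρ g - p` of a compressible phase. -/
def compressEnergy (ρ : ℝ → ℝ) (q : ℝ) : ℝ := ρ q * enthalpy ρ q - q

section Density

variable {ρ : ℝ → ℝ} {ρm ρM : ℝ}

theorem enthalpy_zero : enthalpy ρ 0 = 0 := by simp [enthalpy]

theorem intervalIntegrable_inv_density (hc : Continuous ρ) (hm : 0 < ρm)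
    (hb : ∀ q, ρm ≤ ρ q ∧ ρ q ≤ ρM) (a b : ℝ) :
    IntervalIntegrable (fun ζ => (ρ ζ)⁻¹) volume a b :=
  (hc.inv₀ fun q => (hm.trans_le (hb q).1).ne').intervalIntegrable a b

theorem enthalpy_sub (hc : Continuous ρ) (hm : 0 < ρm) (hb : ∀ q, ρm ≤ ρ q ∧ ρ q ≤ ρM)
    (a b : ℝ) : enthalpy ρ b - enthalpy ρ a = ∫ ζ in a..b, (ρ ζ)⁻¹ :=
  intervalIntegral.integral_interval_sub_left (intervalIntegrable_inv_density hc hm hb _ _)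
    (intervalIntegrable_inv_density hc hm hb _ _)

theorem enthalpy_sub_bounds (hc : Continuous ρ) (hmono : Monotone ρ) (hm : 0 < ρm)
    (hb : ∀ q, ρm ≤ ρ q ∧ ρ q ≤ ρM) {a b : ℝ} (hab : a ≤ b) :
    (b - a) / ρ b ≤ enthalpy ρ b - enthalpy ρ a ∧
      enthalpy ρ b - enthalpy ρ a ≤ (b - a) / ρ a := by
  have hpos : ∀ q, 0 < ρ q := fun q => hm.trans_le (hb q).1
  have hint := intervalIntegrable_inv_density hc hm hb a b
  rw [enthalpy_sub hc hm hb]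
  constructor
  · calc (b - a) / ρ b = ∫ _ in a..b, (ρ b)⁻¹ := by
          rw [intervalIntegral.integral_const, smul_eq_mul, div_eq_mul_inv]
      _ ≤ _ := intervalIntegral.integral_mono_on hab intervalIntegrable_const hint fun x hx =>
          inv_anti₀ (hpos x) (hmono hx.2)
  · calc _ ≤ ∫ _ in a..b, (ρ a)⁻¹ := intervalIntegral.integral_mono_on hab hint
          intervalIntegrable_const fun x hx => inv_anti₀ (hpos a) (hmono hx.1)
      _ = _ := by rw [intervalIntegral.integral_const, smul_eq_mul, div_eq_mul_inv]

/-- The primitive of `1 / ρ` is concave. -/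
theorem enthalpy_le (hc : Continuous ρ) (hmono : Monotone ρ) (hm : 0 < ρm)
    (hb : ∀ q, ρm ≤ ρ q ∧ ρ q ≤ ρM) (q q' : ℝ) :
    enthalpy ρ q' ≤ enthalpy ρ q + (q' - q) / ρ q := by
  rcases le_total q q' with h | h
  · have := (enthalpy_sub_bounds hc hmono hm hb h).2
    linarith
  · have := (enthalpy_sub_bounds hc hmono hm hb h).1
    have h2 : (q' - q) / ρ q = -((q - q') / ρ q) := by ring
    linarith

theorem abs_enthalpy_le (hc : Continuous ρ) (hmono : Monotone ρ) (hm : 0 < ρm)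
    (hb : ∀ q, ρm ≤ ρ q ∧ ρ q ≤ ρM) (q : ℝ) : |enthalpy ρ q| ≤ |q| / ρm := by
  have hpos : ∀ q, 0 < ρ q := fun q => hm.trans_le (hb q).1
  rcases le_total 0 q with h | h
  · obtain ⟨h1, h2⟩ := enthalpy_sub_bounds hc hmono hm hb h
    rw [enthalpy_zero, sub_zero, sub_zero] at h1 h2
    have h3 : 0 ≤ q / ρ q := div_nonneg h (hpos q).le
    rw [abs_of_nonneg (h3.trans h1), abs_of_nonneg h]
    exact h2.trans (div_le_div_of_nonneg_left h hm (hb 0).1)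
  · obtain ⟨h1, h2⟩ := enthalpy_sub_bounds hc hmono hm hb h
    rw [enthalpy_zero, zero_sub, zero_sub] at h1 h2
    have h3 : 0 ≤ -q / ρ 0 := div_nonneg (by linarith) (hpos 0).le
    rw [abs_of_nonpos (by linarith), abs_of_nonpos h]
    exact h2.trans (div_le_div_of_nonneg_left (by linarith) hm (hb q).1)

/-- The tangent to the concave `enthalpy` at `q`, evaluated at zero pressure. -/
theorem compressEnergy_nonneg (hc : Continuous ρ) (hmono : Monotone ρ) (hm : 0 < ρm)
    (hb : ∀ q, ρm ≤ ρ q ∧ ρ q ≤ ρM) (q : ℝ) : 0 ≤ compressEnergy ρ q := by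
  have hpos : 0 < ρ q := hm.trans_le (hb q).1
  have h := enthalpy_le hc hmono hm hb q 0
  rw [enthalpy_zero, zero_sub, neg_div] at h
  have h2 : q / ρ q * ρ q ≤ enthalpy ρ q * ρ q := by gcongr; linarith
  rw [div_mul_cancel₀ _ hpos.ne'] at h2
  rw [compressEnergy]
  linarith

theorem compressEnergy_le (hc : Continuous ρ) (hmono : Monotone ρ) (hm : 0 < ρm)
    (hb : ∀ q, ρm ≤ ρ q ∧ ρ q ≤ ρM) (q : ℝ) :
    compressEnergy ρ q ≤ (ρM / ρm + 1) * |q| := by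
  have hpos : 0 < ρ q := hm.trans_le (hb q).1
  calc compressEnergy ρ q ≤ ρ q * |enthalpy ρ q| + |q| := by
        rw [compressEnergy, sub_eq_add_neg]
        gcongr
        · exact le_abs_self _
        · exact neg_le_abs q
    _ ≤ ρM * (|q| / ρm) + |q| := by
        gcongr
        · exact (hm.trans_le (hb 0).1).le.trans (hb 0).2
        · exact (hb q).2
        · exact abs_enthalpy_le hc hmono hm hb q
    _ = _ := by ring

/-- The accumulation of mass tested against the primitive of `1 / ρ`. -/
theorem accumulation_mul_enthalpy (hc : Continuous ρ) (hmono : Monotone ρ) (hm : 0 < ρm)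
    (hb : ∀ q, ρm ≤ ρ q ∧ ρ q ≤ ρM) (q q' a' : ℝ) {a : ℝ} (ha : 0 ≤ a) :
    compressEnergy ρ q' * a' - compressEnergy ρ q * a + q' * (a' - a) ≤
      (ρ q' * a' - ρ q * a) * enthalpy ρ q' := by
  have hpos : 0 < ρ q := hm.trans_le (hb q).1
  have h := enthalpy_le hc hmono hm hb q q'
  have h2 : ρ q * a * enthalpy ρ q' ≤ ρ q * a * (enthalpy ρ q + (q' - q) / ρ q) := by gcongr
  have h3 : ρ q * a * (enthalpy ρ q + (q' - q) / ρ q) = ρ q * a * enthalpy ρ q + a * (q' - q) := by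
    field_simp
  simp only [compressEnergy]
  linarith

theorem interfaceDensity_comm (a b : ℝ) : interfaceDensity ρ a b = interfaceDensity ρ b a := by
  unfold interfaceDensity
  by_cases h : a = b
  · simp [h]
  · rw [if_neg h, if_neg (Ne.symm h), intervalIntegral.integral_symm, ← neg_sub a b, inv_neg,
      neg_mul_neg]

/-- The reason for averaging `1/ρ`, not `ρ`, on an interface: jumps of `enthalpy` become exact
pressure jumps. -/
theorem interfaceDensity_mul (hc : Continuous ρ) (hmono : Monotone ρ) (hm : 0 < ρm)
    (hb : ∀ q, ρm ≤ ρ q ∧ ρ q ≤ ρM) (a b : ℝ) :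
    interfaceDensity ρ a b * (enthalpy ρ a - enthalpy ρ b) = a - b := by
  unfold interfaceDensity
  by_cases h : a = b
  · simp [h]
  · rw [if_neg h, ← enthalpy_sub hc hm hb]
    have h1 : enthalpy ρ b - enthalpy ρ a ≠ 0 := by
      have hpos : ∀ q, 0 < ρ q := fun q => hm.trans_le (hb q).1
      rcases lt_or_gt_of_ne h with h | h
      · have := (enthalpy_sub_bounds hc hmono hm hb h.le).1
        have h3 : 0 < (b - a) / ρ b := div_pos (by linarith) (hpos b)
        exact (h3.trans_le this).ne'
      · have := (enthalpy_sub_bounds hc hmono hm hb h.le).1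
        have h3 : 0 < (a - b) / ρ a := div_pos (by linarith) (hpos a)
        intro h0
        linarith
    have h2 : b - a ≠ 0 := sub_ne_zero.2 (Ne.symm h)
    rw [mul_inv, inv_inv]
    field_simp
    ring

theorem interfaceDensity_bounds (hc : Continuous ρ) (hmono : Monotone ρ) (hm : 0 < ρm)
    (hb : ∀ q, ρm ≤ ρ q ∧ ρ q ≤ ρM) (a b : ℝ) :
    0 ≤ interfaceDensity ρ a b ∧ interfaceDensity ρ a b ≤ ρM := by
  have hpos : ∀ q, 0 < ρ q := fun q => hm.trans_le (hb q).1
  wlog hab : a ≤ b generalizing a b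
  · rw [interfaceDensity_comm]
    exact this b a (not_le.1 hab).le
  rcases hab.eq_or_lt with rfl | hlt
  · simpa [interfaceDensity] using ⟨(hpos a).le, (hb a).2⟩
  · have h1 := (enthalpy_sub_bounds hc hmono hm hb hab).1
    rw [enthalpy_sub hc hm hb] at h1
    have hba : 0 < b - a := sub_pos.2 hlt
    unfold interfaceDensity
    rw [if_neg hlt.ne]
    have h2 : (ρ b)⁻¹ ≤ (b - a)⁻¹ * ∫ ζ in a..b, (ρ ζ)⁻¹ := by
      rw [le_inv_mul_iff₀ hba, ← div_eq_mul_inv]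
      exact h1
    have h3 : 0 < (ρ b)⁻¹ := inv_pos.2 (hpos b)
    refine ⟨inv_nonneg.2 (h3.le.trans h2), ?_⟩
    exact (inv_le_of_inv_le₀ (hpos b) h2).trans (hb b).2

end Density

/-! ### Numerical fluxes -/

theorem ext01_of_mem (f : ℝ → ℝ) {a : ℝ} (ha : a ∈ Icc (0 : ℝ) 1) : ext01 f a = f a := by
  rw [ext01, min_eq_right ha.2, max_eq_right ha.1]

theorem clamp_mem (a : ℝ) : max 0 (min 1 a) ∈ Icc (0 : ℝ) 1 :=
  ⟨le_max_left _ _, max_le zero_le_one (min_le_left _ _)⟩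

theorem faceFlux_antisymm (M ρ : ℝ → ℝ) (A d gn sK sL pK pL : ℝ) :
    faceFlux M ρ A d gn sK sL pK pL = -faceFlux M ρ A d (-gn) sL sK pL pK := by
  unfold faceFlux upwindFlux
  rw [interfaceDensity_comm pL pK, neg_neg, neg_sub pK pL, ← neg_sub pL pK]
  ring

theorem upwindFlux_mul (M : ℝ → ℝ) (sK sL pK pL : ℝ) :
    upwindFlux M sK sL (pL - pK) * (pK - pL) =
      ext01 M (upwindSat sK sL pK pL) * |pL - pK| ^ 2 := by
  unfold upwindFlux upwindSat
  rw [sq_abs]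
  split_ifs with h
  · rw [max_eq_right h, max_eq_left (by linarith)]; ring
  · push Not at h
    rw [max_eq_left h.le, max_eq_right (by linarith)]; ring

/-- One factor of the interface density is spent on the pressure jump. The diffusive part becomes a
square free of the density, and gravity, quadratic in the density, keeps one factor. -/
theorem faceFlux_mul_enthalpy {ρ : ℝ → ℝ} {ρm ρM : ℝ} (hc : Continuous ρ) (hmono : Monotone ρ)
    (hm : 0 < ρm) (hb : ∀ q, ρm ≤ ρ q ∧ ρ q ≤ ρM) (M : ℝ → ℝ) {A d : ℝ} (hd : d ≠ 0)
    (gn sK sL pK pL : ℝ) :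
    faceFlux M ρ A d gn sK sL pK pL * (enthalpy ρ pK - enthalpy ρ pL) =
      A / d * (ext01 M (upwindSat sK sL pK pL) * |pL - pK| ^ 2 +
        d * interfaceDensity ρ pK pL * (pK - pL) *
          (ext01 M sK * max gn 0 - ext01 M sL * max (-gn) 0)) := by
  have h := interfaceDensity_mul hc hmono hm hb pK pL
  have h2 := upwindFlux_mul M sK sL pK pL
  unfold faceFlux
  calc _ = A / d * (upwindFlux M sK sL (pL - pK) *
          (interfaceDensity ρ pK pL * (enthalpy ρ pK - enthalpy ρ pL))) +
        A * interfaceDensity ρ pK pL * (interfaceDensity ρ pK pL *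
          (enthalpy ρ pK - enthalpy ρ pL)) *
          (ext01 M sK * max gn 0 - ext01 M sL * max (-gn) 0) := by ring
    _ = _ := by rw [h, h2]; field_simp


/-! ### The global pressure -/

section GlobalPressure

variable {l : ℕ} {D : ProblemData l} {R : RockFluid l} {φ₀ φ₁ ρm ρM pcMax : ℝ}

theorem one_sub_mem {a : ℝ} (ha : a ∈ Icc (0 : ℝ) 1) : 1 - a ∈ Icc (0 : ℝ) 1 :=
  ⟨by linarith [ha.2], by linarith [ha.1]⟩

/-- The fractional flow of the liquid. -/
def fracFlow (D : ProblemData l) (z : ℝ) : ℝ :=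
  D.M Phase.liq z / (D.M Phase.liq z + D.M Phase.gas (1 - z))

theorem total_mobility_pos (hD : D.Admissible) {z : ℝ} (hz : z ∈ Icc (0 : ℝ) 1) :
    0 < D.M Phase.liq z + D.M Phase.gas (1 - z) := by
  obtain ⟨m₀, hm₀, h⟩ := hD.mobility_total
  exact hm₀.trans_le (h z hz)

theorem fracFlow_mem (hD : D.Admissible) {z : ℝ} (hz : z ∈ Icc (0 : ℝ) 1) :
    fracFlow D z ∈ Icc (0 : ℝ) 1 := by
  have h1 := hD.mobility_nonneg Phase.liq z hz
  have h2 := hD.mobility_nonneg Phase.gas (1 - z) (one_sub_mem hz)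
  exact ⟨div_nonneg h1 (by linarith), div_le_one_of_le₀ (by linarith) (by linarith)⟩

theorem fracFlow_mono (hD : D.Admissible) {y z : ℝ} (hy : y ∈ Icc (0 : ℝ) 1)
    (hz : z ∈ Icc (0 : ℝ) 1) (hyz : y ≤ z) : fracFlow D y ≤ fracFlow D z := by
  unfold fracFlow
  rw [div_le_div_iff₀ (total_mobility_pos hD hy) (total_mobility_pos hD hz)]
  have h1 := hD.mobility_mono Phase.liq hy hz hyz
  have h2 := hD.mobility_mono Phase.gas (one_sub_mem hz) (one_sub_mem hy) (by linarith)
  have h3 := hD.mobility_nonneg Phase.liq y hy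
  have h4 := hD.mobility_nonneg Phase.gas (1 - z) (one_sub_mem hz)
  nlinarith [mul_le_mul h1 h2 h4 (h3.trans h1)]

theorem continuousOn_fracFlow (hD : D.Admissible) : ContinuousOn (fracFlow D) (Icc 0 1) := by
  refine (hD.mobility_cont _).div ((hD.mobility_cont _).add ?_)
    fun z hz => (total_mobility_pos hD hz).ne'
  exact (hD.mobility_cont _).comp (by fun_prop) fun z hz => one_sub_mem hz

theorem continuousOn_derivWithin_pc (hR : R.Admissible D.Ω φ₀ φ₁ ρm ρM pcMax) :
    ContinuousOn (derivWithin R.pc (Icc 0 1)) (Icc 0 1) :=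
  hR.pc_contDiff.continuousOn_derivWithin (uniqueDiffOn_Icc zero_lt_one) le_rfl

theorem derivWithin_pc_nonpos (hR : R.Admissible D.Ω φ₀ φ₁ ρm ρM pcMax) {z : ℝ}
    (hz : z ∈ Icc (0 : ℝ) 1) : derivWithin R.pc (Icc 0 1) z ≤ 0 := by
  obtain ⟨c, hc, h⟩ := hR.pc_deriv
  linarith [h z hz]

theorem intervalIntegrable_of_continuousOn_unit {f : ℝ → ℝ} (hf : ContinuousOn f (Icc 0 1))
    {a b : ℝ} (ha : a ∈ Icc (0 : ℝ) 1) (hb : b ∈ Icc (0 : ℝ) 1) :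
    IntervalIntegrable f volume a b :=
  (hf.mono (uIcc_subset_Icc ha hb)).intervalIntegrable

theorem integral_derivWithin_pc (hR : R.Admissible D.Ω φ₀ φ₁ ρm ρM pcMax) {a b : ℝ}
    (ha : a ∈ Icc (0 : ℝ) 1) (hb : b ∈ Icc (0 : ℝ) 1) (hab : b ≤ a) :
    ∫ z in b..a, derivWithin R.pc (Icc 0 1) z = R.pc a - R.pc b := by
  refine intervalIntegral.integral_eq_sub_of_hasDerivAt_of_le hab
    (hR.pc_contDiff.continuousOn.mono (Icc_subset_Icc hb.1 ha.2)) ?_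
    (intervalIntegrable_of_continuousOn_unit (continuousOn_derivWithin_pc hR) hb ha)
  intro z hz
  have h01 : Icc (0 : ℝ) 1 ∈ 𝓝 z := Icc_mem_nhds (hb.1.trans_lt hz.1) (hz.2.trans_le ha.2)
  exact ((hR.pc_contDiff.differentiableOn one_ne_zero z
    (mem_of_mem_nhds h01)).hasDerivWithinAt).hasDerivAt h01

theorem pc_antitoneOn (hR : R.Admissible D.Ω φ₀ φ₁ ρm ρM pcMax) : AntitoneOn R.pc (Icc 0 1) := by
  intro b hb a ha hab
  have h := integral_derivWithin_pc hR ha hb hab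
  have h2 : 0 ≤ ∫ z in b..a, -derivWithin R.pc (Icc 0 1) z :=
    intervalIntegral.integral_nonneg hab fun z hz => neg_nonneg.2
      (derivWithin_pc_nonpos hR ⟨hb.1.trans hz.1, hz.2.trans ha.2⟩)
  rw [intervalIntegral.integral_neg] at h2
  linarith

/-- The fractional flow is nondecreasing, so its weighted mean against `-p_c'` lies between its end
values. The jump of the global pressure is thereby squeezed between two convex combinations of the
phase jumps, weighted by the mobilities at either end. -/
theorem capTilde_sub_bounds (hD : D.Admissible) (hR : R.Admissible D.Ω φ₀ φ₁ ρm ρM pcMax)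
    {a b : ℝ} (ha : a ∈ Icc (0 : ℝ) 1) (hb : b ∈ Icc (0 : ℝ) 1) (hab : b ≤ a) :
    fracFlow D b * (R.pc b - R.pc a) ≤ capTilde D R a - capTilde D R b ∧
      capTilde D R a - capTilde D R b ≤ fracFlow D a * (R.pc b - R.pc a) := by
  set q := derivWithin R.pc (Icc 0 1) with hq
  have hqc : ContinuousOn q (Icc 0 1) := continuousOn_derivWithin_pc hR
  have hfq : ContinuousOn (fun z => fracFlow D z * -q z) (Icc 0 1) :=
    (continuousOn_fracFlow hD).mul hqc.neg
  have hcon : ∀ c : ℝ, ContinuousOn (fun z => c * -q z) (Icc 0 1) := fun c =>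
    continuousOn_const.mul hqc.neg
  have h0 : (0 : ℝ) ∈ Icc (0 : ℝ) 1 := ⟨le_rfl, zero_le_one⟩
  have hdiff : capTilde D R a - capTilde D R b = ∫ z in b..a, fracFlow D z * -q z := by
    rw [← intervalIntegral.integral_interval_sub_left
      (intervalIntegrable_of_continuousOn_unit hfq h0 ha)
      (intervalIntegrable_of_continuousOn_unit hfq h0 hb)]
    simp only [capTilde, mul_neg, intervalIntegral.integral_neg]
    rfl
  have hval : ∀ c : ℝ, ∫ z in b..a, c * -q z = c * (R.pc b - R.pc a) := by
    intro c
    rw [intervalIntegral.integral_const_mul, intervalIntegral.integral_neg,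
      integral_derivWithin_pc hR ha hb hab, neg_sub]
  have hmem : ∀ z ∈ Icc b a, z ∈ Icc (0 : ℝ) 1 := fun z hz => ⟨hb.1.trans hz.1, hz.2.trans ha.2⟩
  have hq0 : ∀ z ∈ Icc b a, 0 ≤ -q z := fun z hz =>
    neg_nonneg.2 (derivWithin_pc_nonpos hR (hmem z hz))
  rw [hdiff, ← hval, ← hval]
  constructor
  · exact intervalIntegral.integral_mono_on hab
      (intervalIntegrable_of_continuousOn_unit (hcon _) hb ha)
      (intervalIntegrable_of_continuousOn_unit hfq hb ha) fun z hz =>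
        mul_le_mul_of_nonneg_right (fracFlow_mono hD hb (hmem z hz) hz.1) (hq0 z hz)
  · exact intervalIntegral.integral_mono_on hab
      (intervalIntegrable_of_continuousOn_unit hfq hb ha)
      (intervalIntegrable_of_continuousOn_unit (hcon _) hb ha) fun z hz =>
        mul_le_mul_of_nonneg_right (fracFlow_mono hD (hmem z hz) ha hz.2) (hq0 z hz)

theorem capTilde_mem (hD : D.Admissible) (hR : R.Admissible D.Ω φ₀ φ₁ ρm ρM pcMax) {a : ℝ}
    (ha : a ∈ Icc (0 : ℝ) 1) : capTilde D R a ∈ Icc 0 pcMax := by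
  have h0 : (0 : ℝ) ∈ Icc (0 : ℝ) 1 := ⟨le_rfl, zero_le_one⟩
  obtain ⟨h1, h2⟩ := capTilde_sub_bounds hD hR ha h0 ha.1
  have h3 : capTilde D R 0 = 0 := by simp [capTilde]
  have h4 := pc_antitoneOn hR h0 ha ha.1
  have h5 := hR.pc_nonneg a ha
  rw [h3, sub_zero] at h1 h2
  have h6 := fracFlow_mem hD h0
  have h7 := fracFlow_mem hD ha
  refine ⟨le_trans (mul_nonneg h6.1 (by linarith)) h1, h2.trans ?_⟩
  have h8 := hR.pc_zero_le
  calc _ ≤ 1 * (R.pc 0 - R.pc a) := mul_le_mul_of_nonneg_right h7.2 (by linarith)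
    _ ≤ pcMax := by linarith

/-! ### Estimates on a face -/

/-- The local state: saturations in `[0,1]` of sum one, pressures obeying the capillary law. -/
structure CapillaryState (R : RockFluid l) (p s : Phase → ℝ) : Prop where
  sat_mem : s Phase.liq ∈ Icc (0 : ℝ) 1
  sat_add : s Phase.liq + s Phase.gas = 1
  capillary : R.pc (s Phase.liq) = p Phase.gas - p Phase.liq

theorem CapillaryState.sat_mem' {p s : Phase → ℝ} (h : CapillaryState R p s) (α : Phase) :
    s α ∈ Icc (0 : ℝ) 1 := by
  cases α
  · exact h.sat_mem
  · have : s Phase.gas = 1 - s Phase.liq := by linarith [h.sat_add]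
    rw [this]
    exact one_sub_mem h.sat_mem

theorem capillaryState_dirichlet (hR : R.Admissible D.Ω φ₀ φ₁ ρm ρM pcMax) :
    CapillaryState R (fun _ => 0) satDir where
  sat_mem := ⟨zero_le_one, le_rfl⟩
  sat_add := by simp [satDir]
  capillary := by simp [satDir, hR.pc_one]

/-- The upwind mobility times the squared pressure jump of a phase on a face. -/
def upwindEnergy (D : ProblemData l) (pK sK pL sL : Phase → ℝ) (α : Phase) : ℝ :=
  ext01 (D.M α) (upwindSat (sK α) (sL α) (pK α) (pL α)) * |pL α - pK α| ^ 2

theorem upwindEnergy_comm (D : ProblemData l) (pK sK pL sL : Phase → ℝ) (α : Phase) :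
    upwindEnergy D pK sK pL sL α = upwindEnergy D pL sL pK sK α := by
  unfold upwindEnergy upwindSat
  rcases lt_trichotomy (pL α) (pK α) with h | h | h
  · rw [if_pos (by linarith), if_neg (by linarith), abs_sub_comm]
  · simp [h]
  · rw [if_neg (by linarith), if_pos (by linarith), abs_sub_comm]

theorem ext01_mobility_nonneg (hD : D.Admissible) (α : Phase) (a : ℝ) : 0 ≤ ext01 (D.M α) a :=
  hD.mobility_nonneg α _ (clamp_mem a)

theorem upwindEnergy_nonneg (hD : D.Admissible) (pK sK pL sL : Phase → ℝ) (α : Phase) :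
    0 ≤ upwindEnergy D pK sK pL sL α :=
  mul_nonneg (ext01_mobility_nonneg hD α _) (by positivity)

/-- The jump of the global pressure is controlled by those of the phases, weighted by mobilities
`ml`, `mg` (at the left end) and `ml'`, `mg'` (at the right end). -/
theorem sq_global_jump_le {m₀ ml mg ml' mg' δl δg θ : ℝ} (hm₀ : 0 < m₀) (hml' : 0 ≤ ml')
    (hmg : 0 ≤ mg) (hl : ml' ≤ ml) (hg : mg ≤ mg') (h : m₀ ≤ ml + mg) (h' : m₀ ≤ ml' + mg')
    (hδ : δg ≤ δl)
    (hθ : ml' / (ml' + mg') * (δl - δg) ≤ θ) (hθ' : θ ≤ ml / (ml + mg) * (δl - δg)) :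
    m₀ * (δg + θ) ^ 2 ≤
      (if 0 ≤ δl then ml else ml') * δl ^ 2 + (if 0 ≤ δg then mg else mg') * δg ^ 2 := by
  have hs : 0 < ml + mg := hm₀.trans_le h
  have hs' : 0 < ml' + mg' := hm₀.trans_le h'
  have hml : 0 ≤ ml := hml'.trans hl
  have hmg' : 0 ≤ mg' := hmg.trans hg
  -- The two bounds on `θ`, multiplied by the total mobility at each end: one bound from above with
  -- the left mobilities, one from below with the right ones.
  have hup : (ml + mg) * (δg + θ) ≤ ml * δl + mg * δg := by
    have := mul_le_mul_of_nonneg_left hθ' hs.le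
    have e : (ml + mg) * (ml / (ml + mg) * (δl - δg)) = ml * (δl - δg) := by field_simp
    linarith
  have hlo : ml' * δl + mg' * δg ≤ (ml' + mg') * (δg + θ) := by
    have := mul_le_mul_of_nonneg_left hθ hs'.le
    have e : (ml' + mg') * (ml' / (ml' + mg') * (δl - δg)) = ml' * (δl - δg) := by field_simp
    linarith
  set x := δg + θ
  have sq_up : ∀ s, 0 < s → m₀ ≤ s → ∀ A B y z : ℝ, 0 ≤ A → 0 ≤ B → A + B ≤ s →
      |s * x| ≤ A * |y| + B * |z| → m₀ * x ^ 2 ≤ A * y ^ 2 + B * z ^ 2 := by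
    intro s hs hms A B y z hA hB hAB hx
    have h1 : (s * x) ^ 2 ≤ (A * |y| + B * |z|) ^ 2 := by
      rw [← sq_abs (s * x)]
      exact pow_le_pow_left₀ (abs_nonneg _) hx 2
    have h2 : (A * |y| + B * |z|) ^ 2 ≤ (A + B) * (A * y ^ 2 + B * z ^ 2) := by
      have e : (A + B) * (A * y ^ 2 + B * z ^ 2) - (A * |y| + B * |z|) ^ 2 =
          A * B * (|y| - |z|) ^ 2 := by
        rw [← sq_abs y, ← sq_abs z]; ring
      have : 0 ≤ A * B * (|y| - |z|) ^ 2 := by positivity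
      linarith
    have h3 : (A + B) * (A * y ^ 2 + B * z ^ 2) ≤ s * (A * y ^ 2 + B * z ^ 2) := by gcongr
    have h4 : s * (s * x ^ 2) ≤ s * (A * y ^ 2 + B * z ^ 2) := by nlinarith
    have h5 := le_of_mul_le_mul_left h4 hs
    nlinarith [sq_nonneg x]
  -- When the jumps have the same sign, upwinding picks both mobilities at one end, and the bound
  -- made with these mobilities applies. The only mixed case is `δg < 0 ≤ δl`, because `δg ≤ δl`.
  rcases le_or_gt 0 δg with h0 | h0
  · have h0l : 0 ≤ δl := h0.trans hδ
    rw [if_pos h0l, if_pos h0]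
    have hx : 0 ≤ x := by
      have : 0 ≤ ml' * δl + mg' * δg := by positivity
      exact nonneg_of_mul_nonneg_right (this.trans hlo) hs'
    refine sq_up (ml + mg) hs h ml mg δl δg hml hmg le_rfl ?_
    rw [abs_of_nonneg (mul_nonneg hs.le hx), abs_of_nonneg h0, abs_of_nonneg h0l]
    exact hup
  · rw [if_neg (not_le.2 h0)]
    rcases le_or_gt 0 δl with h0l | h0l
    · rw [if_pos h0l]
      -- With mixed signs only one phase pushes in the direction of `x`; the other term has the
      -- opposite sign and is dropped.
      rcases le_total 0 x with hx | hx
      · have := sq_up (ml + mg) hs h ml 0 δl δg hml le_rfl (by linarith) (by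
          rw [abs_of_nonneg (mul_nonneg hs.le hx), abs_of_nonneg h0l]
          nlinarith)
        have h9 : 0 ≤ mg' * δg ^ 2 := by positivity
        linarith
      · have := sq_up (ml' + mg') hs' h' 0 mg' δl δg le_rfl hmg' (by linarith) (by
          rw [abs_of_nonpos (mul_nonpos_of_nonneg_of_nonpos hs'.le hx), abs_of_neg h0]
          nlinarith)
        have h9 : 0 ≤ ml * δl ^ 2 := by positivity
        linarith
    · rw [if_neg (not_le.2 h0l)]
      have hx : x ≤ 0 := by
        by_contra hx
        push Not at hx
        nlinarith [mul_pos hs hx]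
      refine sq_up (ml' + mg') hs' h' ml' mg' δl δg hml' hmg' le_rfl ?_
      rw [abs_of_nonpos (mul_nonpos_of_nonneg_of_nonpos hs'.le hx), abs_of_neg h0, abs_of_neg h0l]
      linarith

/-- Control of the global pressure by the phases on a face. If the mobility of a phase is larger
on the side of its lower pressure, then its pressure jump is controlled by that of the global
pressure. -/
theorem global_jump_bounds (hD : D.Admissible) (hR : R.Admissible D.Ω φ₀ φ₁ ρm ρM pcMax)
    {m₀ : ℝ} (hm₀ : 0 < m₀)
    (hm : ∀ a ∈ Icc (0 : ℝ) 1, m₀ ≤ D.M Phase.liq a + D.M Phase.gas (1 - a))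
    {pK sK pL sL : Phase → ℝ} (hK : CapillaryState R pK sK) (hL : CapillaryState R pL sL) :
    m₀ * |globalPressure D R (pL Phase.gas) (sL Phase.liq) -
        globalPressure D R (pK Phase.gas) (sK Phase.liq)| ^ 2 ≤
      upwindEnergy D pK sK pL sL Phase.liq + upwindEnergy D pK sK pL sL Phase.gas ∧
    ∀ α, (pK α < pL α → D.M α (sL α) < D.M α (sK α) →
        |pL α - pK α| ≤ |globalPressure D R (pL Phase.gas) (sL Phase.liq) -
          globalPressure D R (pK Phase.gas) (sK Phase.liq)|) ∧
      (pL α < pK α → D.M α (sK α) < D.M α (sL α) →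
        |pL α - pK α| ≤ |globalPressure D R (pL Phase.gas) (sL Phase.liq) -
          globalPressure D R (pK Phase.gas) (sK Phase.liq)|) := by
  wlog hab : sL Phase.liq ≤ sK Phase.liq generalizing pK sK pL sL
  · have := this hL hK (not_le.1 hab).le
    rw [upwindEnergy_comm D pK sK pL sL, upwindEnergy_comm D pK sK pL sL,
      abs_sub_comm (globalPressure D R (pL Phase.gas) (sL Phase.liq))]
    refine ⟨this.1, fun α => ?_⟩
    rw [abs_sub_comm (pL α)]
    exact (this.2 α).symm
  have hgK : sK Phase.gas = 1 - sK Phase.liq := by linarith [hK.sat_add]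
  have hgL : sL Phase.gas = 1 - sL Phase.liq := by linarith [hL.sat_add]
  obtain ⟨h1, h2⟩ := capTilde_sub_bounds hD hR hK.sat_mem hL.sat_mem hab
  have hf1 := fracFlow_mem hD hK.sat_mem
  have hf2 := fracFlow_mem hD hL.sat_mem
  have hpc := pc_antitoneOn hR hL.sat_mem hK.sat_mem hab
  have hκ : R.pc (sL Phase.liq) - R.pc (sK Phase.liq) =
      (pK Phase.liq - pL Phase.liq) - (pK Phase.gas - pL Phase.gas) := by
    rw [hK.capillary, hL.capillary]; ring
  have hκ0 : 0 ≤ (pK Phase.liq - pL Phase.liq) - (pK Phase.gas - pL Phase.gas) := by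
    rw [← hκ]; linarith
  rw [hκ] at h1 h2
  set θ := capTilde D R (sK Phase.liq) - capTilde D R (sL Phase.liq) with hθ
  have hθ0 : 0 ≤ θ := (mul_nonneg hf2.1 hκ0).trans h1
  have hθ1 : θ ≤ (pK Phase.liq - pL Phase.liq) - (pK Phase.gas - pL Phase.gas) :=
    h2.trans (mul_le_of_le_one_left hκ0 hf1.2)
  have hjump : globalPressure D R (pL Phase.gas) (sL Phase.liq) -
      globalPressure D R (pK Phase.gas) (sK Phase.liq) = -((pK Phase.gas - pL Phase.gas) + θ) := by
    simp only [globalPressure, hθ]; ring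
  rw [hjump, abs_neg]
  constructor
  · have key := sq_global_jump_le hm₀ (hD.mobility_nonneg Phase.liq _ hL.sat_mem)
      (hD.mobility_nonneg Phase.gas _ (one_sub_mem hK.sat_mem))
      (hD.mobility_mono Phase.liq hL.sat_mem hK.sat_mem hab)
      (hD.mobility_mono Phase.gas (one_sub_mem hK.sat_mem) (one_sub_mem hL.sat_mem) (by linarith))
      (hm _ hK.sat_mem) (hm _ hL.sat_mem) (sub_nonneg.1 hκ0) h1 h2
    rw [sq_abs]
    refine key.trans_eq ?_
    have hup : ∀ α, upwindEnergy D pK sK pL sL α =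
        (if 0 ≤ pK α - pL α then D.M α (sK α) else D.M α (sL α)) * (pK α - pL α) ^ 2 := by
      intro α
      unfold upwindEnergy upwindSat
      rw [sq_abs, sub_sq_comm]
      by_cases h : 0 ≤ pK α - pL α
      · rw [if_pos h, if_pos (by linarith), ext01_of_mem _ (hK.sat_mem' α)]
      · rw [if_neg h, if_neg (by linarith), ext01_of_mem _ (hL.sat_mem' α)]
    rw [hup, hup, hgK, hgL]
  -- On the side richer in liquid, the jump `δg + θ` lies between `δg` and `δl`. A liquid jump `δl <
  -- 0` forces `δg + θ ≤ δl < 0`, and a gas jump `δg > 0` forces `δg + θ ≥ δg`; the remaining sign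
  -- patterns contradict monotonicity of the mobility.
  · intro α
    cases α
    · constructor
      · intro hlt _
        rw [abs_of_pos (by linarith), abs_of_nonpos (by linarith)]
        linarith
      · intro _ hM
        have := hD.mobility_mono Phase.liq hL.sat_mem hK.sat_mem hab
        exact absurd hM (not_lt.2 this)
    · constructor
      · intro _ hM
        have := hD.mobility_mono Phase.gas (hK.sat_mem' Phase.gas) (hL.sat_mem' Phase.gas)
          (by linarith)
        exact absurd hM (not_lt.2 this)
      · intro hlt _
        rw [abs_of_neg (by linarith), abs_of_nonneg (by linarith)]
        linarith

/-- Lower bound of the gravity term of a phase on a face, by the pressure jump of the phase with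
its upwind mobility and by the jump `δ'` of the global pressure. -/
theorem gravity_term_ge {M : ℝ → ℝ} {r ρM γ d gn sK sL pK pL δ' Mmax : ℝ} (hr : 0 ≤ r)
    (hrM : r ≤ ρM) (hd : 0 ≤ d) (hgn : |gn| ≤ γ)
    (hM : ∀ a, 0 ≤ ext01 M a ∧ ext01 M a ≤ Mmax)
    (h1 : pK < pL → ext01 M sL < ext01 M sK → |pL - pK| ≤ |δ'|)
    (h2 : pL < pK → ext01 M sK < ext01 M sL → |pL - pK| ≤ |δ'|) :
    -(d * ρM * γ * (ext01 M (upwindSat sK sL pK pL) * |pL - pK| + Mmax * |δ'|)) ≤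
      d * r * (pK - pL) * (ext01 M sK * max gn 0 - ext01 M sL * max (-gn) 0) := by
  have hγ : 0 ≤ γ := (abs_nonneg _).trans hgn
  have hMmax : 0 ≤ Mmax := (hM 0).1.trans (hM 0).2
  have hU := hM (upwindSat sK sL pK pL)
  have hW : 0 ≤ γ * (ext01 M (upwindSat sK sL pK pL) * |pL - pK| + Mmax * |δ'|) :=
    mul_nonneg hγ (add_nonneg (mul_nonneg hU.1 (abs_nonneg _)) (mul_nonneg hMmax (abs_nonneg _)))
  -- Here `m` is the mobility used by gravity and `m'` the one upwinded by the pressure. If `m ≤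
  -- m'`, the energy controls the term; if not, the pressure jump is replaced by that of the global
  -- pressure. Where the two upwindings agree the gravity term is nonnegative and needs no bound.
  have bound : ∀ m m' g x : ℝ, 0 ≤ m → m ≤ Mmax → 0 ≤ m' → 0 ≤ g → g ≤ γ → 0 ≤ x →
      (m' < m → x ≤ |δ'|) → m * g * x ≤ γ * (m' * x + Mmax * |δ'|) := by
    intro m m' g x hm hmM hm' hg hgγ hx himp
    rcases le_or_gt m m' with hle | hlt
    · calc m * g * x ≤ m' * γ * x := by gcongr
        _ = γ * (m' * x + 0) := by ring
        _ ≤ _ := by gcongr; positivity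
    · calc m * g * x ≤ Mmax * γ * |δ'| := by gcongr; exact himp hlt
        _ = γ * (0 + Mmax * |δ'|) := by ring
        _ ≤ _ := by gcongr; positivity
  have hZ : -(γ * (ext01 M (upwindSat sK sL pK pL) * |pL - pK| + Mmax * |δ'|)) ≤
      (pK - pL) * (ext01 M sK * max gn 0 - ext01 M sL * max (-gn) 0) := by
    have hK := hM sK
    have hL := hM sL
    rcases le_total 0 gn with hg | hg
    · rw [max_eq_left hg, max_eq_right (by linarith), mul_zero, sub_zero]
      rw [abs_of_nonneg hg] at hgn
      rcases le_or_gt pL pK with hp | hp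
      · have : 0 ≤ (pK - pL) * (ext01 M sK * gn) :=
          mul_nonneg (by linarith) (mul_nonneg hK.1 hg)
        linarith
      · have hup : upwindSat sK sL pK pL = sL := if_neg (by linarith)
        rw [hup]
        have := bound _ _ gn |pL - pK| hK.1 hK.2 hL.1 hg hgn (abs_nonneg _) (h1 hp)
        have e : (pK - pL) * (ext01 M sK * gn) = -(ext01 M sK * gn * |pL - pK|) := by
          rw [abs_of_pos (by linarith)]; ring
        linarith
    · rw [max_eq_right hg, max_eq_left (by linarith), mul_zero, zero_sub]
      rw [abs_of_nonpos hg] at hgn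
      rcases le_or_gt pK pL with hp | hp
      · have : 0 ≤ (pL - pK) * (ext01 M sL * -gn) :=
          mul_nonneg (by linarith) (mul_nonneg hL.1 (by linarith))
        linarith
      · have hup : upwindSat sK sL pK pL = sK := if_pos (by linarith)
        rw [hup]
        have := bound _ _ (-gn) |pL - pK| hL.1 hL.2 hK.1 (by linarith) hgn (abs_nonneg _) (h2 hp)
        have e : (pK - pL) * -(ext01 M sL * -gn) = -(ext01 M sL * -gn * |pL - pK|) := by
          rw [abs_of_neg (by linarith)]; ring
        linarith
  have hdr : 0 ≤ d * r := mul_nonneg hd hr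
  have h3 := mul_le_mul_of_nonneg_left hZ hdr
  have h4 : d * r * (γ * (ext01 M (upwindSat sK sL pK pL) * |pL - pK| + Mmax * |δ'|)) ≤
      d * ρM * (γ * (ext01 M (upwindSat sK sL pK pL) * |pL - pK| + Mmax * |δ'|)) := by gcongr
  linarith

/-- The constant in front of the gravity contribution of a face. -/
def gravityConst (m₀ Mmax ρM γ : ℝ) : ℝ :=
  2 * (Mmax * (ρM * γ) ^ 2 + 2 / m₀ * (ρM * γ * Mmax) ^ 2)

/-- The weights leave a margin: the two phases together lose a quarter of their energies and `m₀ /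
4` times the squared global jump, itself at most another quarter. Half of the energy on the face
survives. -/
theorem young_gravity {m₀ Mmax ρM γ d m x y : ℝ} (hm₀ : 0 < m₀) (hm : 0 ≤ m) (hmM : m ≤ Mmax) :
    d * ρM * γ * (m * x + Mmax * y) ≤
      m * x ^ 2 / 4 + m₀ / 8 * y ^ 2 + d ^ 2 * (gravityConst m₀ Mmax ρM γ / 2) := by
  have h1 : 0 ≤ m * (x / 2 - d * ρM * γ) ^ 2 := by positivity
  have h2 : 0 ≤ m₀ / 8 * (y - 4 / m₀ * (d * ρM * γ * Mmax)) ^ 2 := by positivity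
  have e2 : m₀ / 8 * (y - 4 / m₀ * (d * ρM * γ * Mmax)) ^ 2 =
      m₀ / 8 * y ^ 2 - y * (d * ρM * γ * Mmax) + 2 / m₀ * (d * ρM * γ * Mmax) ^ 2 := by
    field_simp; ring
  have h3 : m * (d * ρM * γ) ^ 2 ≤ Mmax * (d * ρM * γ) ^ 2 := by gcongr
  have e3 : d ^ 2 * (gravityConst m₀ Mmax ρM γ / 2) =
      Mmax * (d * ρM * γ) ^ 2 + 2 / m₀ * (d * ρM * γ * Mmax) ^ 2 := by
    rw [gravityConst]; ring
  rw [e3]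
  nlinarith

/-- Energy estimate on a face: the fluxes of both phases tested against the jumps of the
primitives of `1 / ρ`. -/
theorem faceFlux_energy (hD : D.Admissible) (hR : R.Admissible D.Ω φ₀ φ₁ ρm ρM pcMax)
    (hρm : 0 < ρm) {m₀ Mmax γ : ℝ} (hm₀ : 0 < m₀)
    (hm : ∀ a ∈ Icc (0 : ℝ) 1, m₀ ≤ D.M Phase.liq a + D.M Phase.gas (1 - a))
    (hMmax : ∀ α, ∀ a ∈ Icc (0 : ℝ) 1, D.M α a ≤ Mmax)
    {pK sK pL sL : Phase → ℝ} (hK : CapillaryState R pK sK) (hL : CapillaryState R pL sL)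
    {A d gn : ℝ} (hA : 0 ≤ A) (hd : 0 < d) (hgn : |gn| ≤ γ) :
    A / d * (upwindEnergy D pK sK pL sL Phase.liq + upwindEnergy D pK sK pL sL Phase.gas) / 2 -
        gravityConst m₀ Mmax ρM γ * (A * d) ≤
      faceFlux (D.M Phase.liq) (R.ρ Phase.liq) A d gn (sK Phase.liq) (sL Phase.liq)
          (pK Phase.liq) (pL Phase.liq) *
          (enthalpy (R.ρ Phase.liq) (pK Phase.liq) - enthalpy (R.ρ Phase.liq) (pL Phase.liq)) +
        faceFlux (D.M Phase.gas) (R.ρ Phase.gas) A d gn (sK Phase.gas) (sL Phase.gas)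
          (pK Phase.gas) (pL Phase.gas) *
          (enthalpy (R.ρ Phase.gas) (pK Phase.gas) - enthalpy (R.ρ Phase.gas) (pL Phase.gas)) := by
  obtain ⟨hglob, hbad⟩ := global_jump_bounds hD hR hm₀ hm hK hL
  set δ' := globalPressure D R (pL Phase.gas) (sL Phase.liq) -
        globalPressure D R (pK Phase.gas) (sK Phase.liq) with hδ'
  have hM : ∀ α a, 0 ≤ ext01 (D.M α) a ∧ ext01 (D.M α) a ≤ Mmax := fun α a =>
    ⟨ext01_mobility_nonneg hD α a, hMmax α _ (clamp_mem a)⟩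
  have phase : ∀ α, A / d * (3 / 4 * upwindEnergy D pK sK pL sL α - m₀ / 8 * |δ'| ^ 2 -
      d ^ 2 * (gravityConst m₀ Mmax ρM γ / 2)) ≤
      faceFlux (D.M α) (R.ρ α) A d gn (sK α) (sL α) (pK α) (pL α) *
        (enthalpy (R.ρ α) (pK α) - enthalpy (R.ρ α) (pL α)) := by
    intro α
    have hc := (hR.ρ_contDiff α).continuous
    rw [faceFlux_mul_enthalpy hc (hR.ρ_mono α) hρm (hR.ρ_bounds α) _ hd.ne']
    refine mul_le_mul_of_nonneg_left ?_ (div_nonneg hA hd.le)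
    obtain ⟨hr0, hr1⟩ := interfaceDensity_bounds hc (hR.ρ_mono α) hρm (hR.ρ_bounds α) (pK α) (pL α)
    have hg := gravity_term_ge (δ' := δ') (pK := pK α) (pL := pL α) (sK := sK α) (sL := sL α)
      hr0 hr1 hd.le hgn (hM α)
      (by rw [ext01_of_mem _ (hK.sat_mem' α), ext01_of_mem _ (hL.sat_mem' α)]; exact (hbad α).1)
      (by rw [ext01_of_mem _ (hK.sat_mem' α), ext01_of_mem _ (hL.sat_mem' α)]; exact (hbad α).2)
    have hU := hM α (upwindSat (sK α) (sL α) (pK α) (pL α))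
    have hy := young_gravity (d := d) (ρM := ρM) (γ := γ) (x := |pL α - pK α|) (y := |δ'|)
      hm₀ hU.1 hU.2
    simp only [upwindEnergy]
    linarith
  have e : A / d * d ^ 2 = A * d := by field_simp
  have h1 := phase Phase.liq
  have h2 := phase Phase.gas
  have h3 := mul_le_mul_of_nonneg_left hglob (div_nonneg hA hd.le)
  have e2 : A / d * (d ^ 2 * (gravityConst m₀ Mmax ρM γ / 2)) =
      gravityConst m₀ Mmax ρM γ * (A * d) / 2 := by rw [← mul_assoc, e]; ring
  rw [mul_sub, e2] at h1 h2
  linarith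

end GlobalPressure

/-! ### Mean values -/

section Means

variable {X : Type*} [MeasurableSpace X] {μ : Measure X}

theorem measureReal_mul_average {f : X → ℝ} {S : Set X} (h0 : μ S ≠ 0) (ht : μ S ≠ ⊤) :
    μ.real S * ⨍ x in S, f x ∂μ = ∫ x in S, f x ∂μ := by
  rw [setAverage_eq, smul_eq_mul, ← mul_assoc, mul_inv_cancel₀, one_mul]
  exact (ENNReal.toReal_pos h0 ht).ne'

/-- Jensen's inequality for the square, from the nonnegativity of the variance. -/
theorem measureReal_mul_average_sq_le {f : X → ℝ} {S : Set X} (h0 : μ S ≠ 0) (ht : μ S ≠ ⊤)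
    (hf : MemLp f 2 (μ.restrict S)) :
    μ.real S * (⨍ x in S, f x ∂μ) ^ 2 ≤ ∫ x in S, f x ^ 2 ∂μ := by
  have : IsFiniteMeasure (μ.restrict S) := ⟨by simpa using ht.lt_top⟩
  set m := ⨍ x in S, f x ∂μ with hm
  have hint : Integrable f (μ.restrict S) := hf.integrable (by norm_num)
  have h : 0 ≤ ∫ x in S, (f x - m) ^ 2 ∂μ := integral_nonneg fun x => sq_nonneg _
  have e : ∫ x in S, (f x - m) ^ 2 ∂μ =
      ∫ x in S, f x ^ 2 ∂μ - 2 * m * ∫ x in S, f x ∂μ + μ.real S * m ^ 2 := by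
    have e1 : ∀ x, (f x - m) ^ 2 = (f x ^ 2 - 2 * m * f x) + m ^ 2 := fun x => by ring
    simp_rw [e1]
    have h2 : Integrable (fun x => f x ^ 2 - 2 * m * f x) (μ.restrict S) :=
      hf.integrable_sq.sub (hint.const_mul _)
    rw [integral_add h2 (integrable_const _), integral_sub hf.integrable_sq (hint.const_mul _), integral_const_mul, integral_const]
    simp
  rw [e, ← measureReal_mul_average (f := f) h0 ht, ← hm] at h
  linarith

theorem measureReal_mul_abs_average_le {f : X → ℝ} {S : Set X} (h0 : μ S ≠ 0) (ht : μ S ≠ ⊤) :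
    μ.real S * |⨍ x in S, f x ∂μ| ≤ ∫ x in S, |f x| ∂μ := by
  rw [← abs_of_nonneg (measureReal_nonneg : 0 ≤ μ.real S), ← abs_mul,
    measureReal_mul_average h0 ht]
  exact abs_integral_le_integral_abs

theorem sum_setIntegral_le {ι : Type*} (I : Finset ι) {S : ι → Set X} {Q : Set X} {g : X → ℝ}
    (hS : ∀ i ∈ I, MeasurableSet (S i)) (hd : (I : Set ι).PairwiseDisjoint S)
    (hQ : ∀ i ∈ I, S i ⊆ Q) (hg : IntegrableOn g Q μ) (hg0 : ∀ x, 0 ≤ g x) :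
    ∑ i ∈ I, ∫ x in S i, g x ∂μ ≤ ∫ x in Q, g x ∂μ := by
  rw [← integral_biUnion_finset I hS hd fun i hi => hg.mono_set (hQ i hi)]
  refine setIntegral_mono_set hg ?_ (iUnion₂_subset hQ).eventuallyLE
  exact Filter.Eventually.of_forall hg0

end Means

/-! ### Averages of the data over cells and space-time slabs -/

section Scheme

variable {l : ℕ} {D : ProblemData l} {R : RockFluid l} {φ₀ φ₁ ρm ρM pcMax ξ : ℝ}
  (𝒯 : AdmissibleMesh D.Ω D.ΓD ξ) {N : ℕ}

theorem timeStep_pos (hD : D.Admissible) (N : ℕ) : 0 < timeStep D N :=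
  div_pos hD.T_pos (by positivity)

theorem volume_cell_ne_zero (K : Fin 𝒯.card) : volume (𝒯.cell K) ≠ 0 :=
  ((𝒯.isOpen_cell K).measure_pos volume ⟨_, 𝒯.center_mem K⟩).ne'

theorem cellMean_mem {f : Space l → ℝ} {a b : ℝ}
    (hf : AEStronglyMeasurable f (volume.restrict D.Ω))
    (h : ∀ᵐ x ∂volume.restrict D.Ω, f x ∈ Icc a b) (K : Fin 𝒯.card) :
    cellMean D 𝒯 f K ∈ Icc a b := by
  have hae := ae_restrict_of_ae_restrict_of_subset (𝒯.cell_subset K) h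
  refine (convex_Icc a b).set_average_mem isClosed_Icc (volume_cell_ne_zero 𝒯 K)
    (𝒯.volume_cell_ne_top K) hae ?_
  have : IsFiniteMeasure (volume.restrict (𝒯.cell K)) :=
    ⟨by simpa using (𝒯.volume_cell_ne_top K).lt_top⟩
  refine Integrable.of_bound (hf.mono_measure (Measure.restrict_mono (𝒯.cell_subset K) le_rfl))
    (max |a| |b|) ?_
  filter_upwards [hae] with x hx
  exact abs_le_max_abs_abs hx.1 hx.2

/-- The space-time slab `(t^n, t^(n+1)) × K`. -/
def slab (N n : ℕ) (K : Fin 𝒯.card) : Set (ℝ × Space l) :=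
  Ioo (n * timeStep D N) ((n + 1) * timeStep D N) ×ˢ 𝒯.cell K

theorem measurableSet_slab (n : ℕ) (K : Fin 𝒯.card) : MeasurableSet (slab 𝒯 N n K) :=
  measurableSet_Ioo.prod (𝒯.isOpen_cell K).measurableSet

theorem slab_subset (hD : D.Admissible) {n : ℕ} (hn : n ≤ N) (K : Fin 𝒯.card) :
    slab 𝒯 N n K ⊆ D.cylinder := by
  have hdt := timeStep_pos hD N
  refine prod_mono (Ioo_subset_Ioo (by positivity) ?_) (𝒯.cell_subset K)
  have hT : (N + 1 : ℝ) * timeStep D N = D.T := by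
    unfold timeStep; field_simp
  rw [← hT]
  gcongr

theorem volume_slab (n : ℕ) (K : Fin 𝒯.card) :
    volume (slab 𝒯 N n K) = ENNReal.ofReal (timeStep D N) * volume (𝒯.cell K) := by
  rw [slab, Measure.volume_eq_prod, Measure.prod_prod, Real.volume_Ioo]
  congr 2
  ring

theorem volumeReal_slab (hD : D.Admissible) (n : ℕ) (K : Fin 𝒯.card) :
    volume.real (slab 𝒯 N n K) = timeStep D N * volume.real (𝒯.cell K) := by
  rw [Measure.real, volume_slab, ENNReal.toReal_mul, ENNReal.toReal_ofReal (timeStep_pos hD N).le,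
    Measure.real]

theorem volume_slab_ne_zero (hD : D.Admissible) (n : ℕ) (K : Fin 𝒯.card) :
    volume (slab 𝒯 N n K) ≠ 0 := by
  rw [volume_slab]
  exact mul_ne_zero (ENNReal.ofReal_pos.2 (timeStep_pos hD N)).ne' (volume_cell_ne_zero 𝒯 K)

theorem volume_slab_ne_top (n : ℕ) (K : Fin 𝒯.card) : volume (slab 𝒯 N n K) ≠ ⊤ := by
  rw [volume_slab]
  exact ENNReal.mul_ne_top ENNReal.ofReal_ne_top (𝒯.volume_cell_ne_top K)

theorem pairwiseDisjoint_slab (hD : D.Admissible) (I : Set (ℕ × Fin 𝒯.card)) :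
    I.PairwiseDisjoint fun i => slab 𝒯 N i.1 i.2 := by
  have hdt := timeStep_pos hD N
  have hlt : ∀ {n m : ℕ}, n < m →
      Disjoint (Ioo (n * timeStep D N) ((n + 1) * timeStep D N))
        (Ioo (m * timeStep D N) ((m + 1) * timeStep D N)) := by
    intro n m hnm
    rw [disjoint_left]
    rintro t ⟨-, h1⟩ ⟨h2, -⟩
    have h3 : (n + 1 : ℝ) ≤ m := by exact_mod_cast hnm
    nlinarith
  rintro ⟨n, K⟩ - ⟨m, L⟩ - hne
  by_cases hKL : K = L
  · have hnm : n ≠ m := fun h => hne (by rw [h, hKL])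
    rcases lt_or_gt_of_ne hnm with h | h
    · exact disjoint_prod.2 (Or.inl (hlt h))
    · exact disjoint_prod.2 (Or.inl (hlt h).symm)
  · exact disjoint_prod.2 (Or.inr (disjoint_iff_inter_eq_empty.2 (𝒯.cell_disjoint K L hKL)))

theorem memLp_slab (hD : D.Admissible) {f : ℝ × Space l → ℝ}
    (hf : MemLp f 2 (volume.restrict D.cylinder)) {n : ℕ} (hn : n ≤ N) (K : Fin 𝒯.card) :
    MemLp f 2 (volume.restrict (slab 𝒯 N n K)) :=
  hf.mono_measure (Measure.restrict_mono (slab_subset 𝒯 hD hn K) le_rfl)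

theorem cylMean_nonneg (hD : D.Admissible) {f : ℝ × Space l → ℝ}
    (h : ∀ᵐ z ∂volume.restrict D.cylinder, 0 ≤ f z) {n : ℕ} (hn : n ≤ N) (K : Fin 𝒯.card) :
    0 ≤ cylMean D 𝒯 N f n K := by
  rw [cylMean, setAverage_eq, smul_eq_mul]
  refine mul_nonneg (inv_nonneg.2 measureReal_nonneg) (integral_nonneg_of_ae ?_)
  exact ae_restrict_of_ae_restrict_of_subset (slab_subset 𝒯 hD hn K) h

theorem cylMean_mem (hD : D.Admissible) {f : ℝ × Space l → ℝ} {a b : ℝ}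
    (hf : AEStronglyMeasurable f (volume.restrict D.cylinder))
    (h : ∀ᵐ z ∂volume.restrict D.cylinder, f z ∈ Icc a b) {n : ℕ} (hn : n ≤ N)
    (K : Fin 𝒯.card) : cylMean D 𝒯 N f n K ∈ Icc a b := by
  have hae := ae_restrict_of_ae_restrict_of_subset (slab_subset 𝒯 hD hn K) h
  refine (convex_Icc a b).set_average_mem isClosed_Icc (volume_slab_ne_zero 𝒯 hD n K)
    (volume_slab_ne_top 𝒯 n K) hae ?_
  have : IsFiniteMeasure (volume.restrict (slab 𝒯 N n K)) :=
    ⟨by simpa using (volume_slab_ne_top 𝒯 n K).lt_top⟩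
  change Integrable f (volume.restrict (slab 𝒯 N n K))
  refine Integrable.of_bound
    (hf.mono_measure (Measure.restrict_mono (slab_subset 𝒯 hD hn K) le_rfl)) (max |a| |b|) ?_
  filter_upwards [hae] with x hx
  exact abs_le_max_abs_abs hx.1 hx.2

/-- Discrete `L²` norms of cell averages of a source term. -/
theorem sum_cylMean_sq_le (hD : D.Admissible) {f : ℝ × Space l → ℝ}
    (hf : MemLp f 2 (volume.restrict D.cylinder)) :
    ∑ n ∈ Finset.range (N + 1), timeStep D N *
      ∑ K, volume.real (𝒯.cell K) * cylMean D 𝒯 N f n K ^ 2 ≤ ∫ z in D.cylinder, f z ^ 2 := by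
  have h := sum_setIntegral_le (μ := volume) (Finset.range (N + 1) ×ˢ Finset.univ)
    (S := fun i : ℕ × Fin 𝒯.card => slab 𝒯 N i.1 i.2) (Q := D.cylinder) (g := fun z => f z ^ 2)
    (fun i _ => measurableSet_slab 𝒯 i.1 i.2) (pairwiseDisjoint_slab 𝒯 hD _)
    (fun i hi => slab_subset 𝒯 hD
      (Nat.lt_succ_iff.1 (Finset.mem_range.1 (Finset.mem_product.1 hi).1)) i.2)
    hf.integrable_sq fun z => sq_nonneg _
  refine le_trans ?_ h
  rw [Finset.sum_product]
  refine Finset.sum_le_sum fun n hn => ?_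
  rw [Finset.mul_sum]
  refine Finset.sum_le_sum fun K _ => ?_
  rw [← mul_assoc, ← volumeReal_slab 𝒯 hD n K]
  exact measureReal_mul_average_sq_le (volume_slab_ne_zero 𝒯 hD n K) (volume_slab_ne_top 𝒯 n K)
    (memLp_slab 𝒯 hD hf (Nat.lt_succ_iff.1 (Finset.mem_range.1 hn)) K)

theorem sum_abs_cellMean_le (hD : D.Admissible) {f : Space l → ℝ}
    (hf : MemLp f 2 (volume.restrict D.Ω)) :
    ∑ K, volume.real (𝒯.cell K) * |cellMean D 𝒯 f K| ≤ ∫ x in D.Ω, |f x| := by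
  have : IsFiniteMeasure (volume.restrict D.Ω) :=
    ⟨by simpa using hD.isBounded.measure_lt_top⟩
  have h := sum_setIntegral_le (μ := volume) Finset.univ (S := 𝒯.cell) (Q := D.Ω)
    (g := fun x => |f x|) (fun K _ => (𝒯.isOpen_cell K).measurableSet)
    (fun K _ L _ hKL => disjoint_iff_inter_eq_empty.2 (𝒯.cell_disjoint K L hKL))
    (fun K _ => 𝒯.cell_subset K) (hf.integrable (by norm_num)).abs fun x => abs_nonneg _
  exact le_trans (Finset.sum_le_sum fun K _ => measureReal_mul_abs_average_le
    (volume_cell_ne_zero 𝒯 K) (𝒯.volume_cell_ne_top K)) h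

/-! ### The maximum principle -/

theorem ext01_mobility_of_nonpos (hD : D.Admissible) (α : Phase) {a : ℝ} (ha : a ≤ 0) :
    ext01 (D.M α) a = 0 := by
  rw [ext01, max_eq_left ((min_le_right _ _).trans ha), hD.mobility_zero]

/-- The extended mobility vanishes at nonpositive saturations, so nothing can leave the cell by
either the pressure or the gravity term. -/
theorem faceFlux_nonpos (hD : D.Admissible) (hR : R.Admissible D.Ω φ₀ φ₁ ρm ρM pcMax)
    (hρm : 0 < ρm) (α : Phase) {A d gn sK sL pK pL : ℝ} (hA : 0 ≤ A) (hd : 0 ≤ d)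
    (hs : sK ≤ 0) : faceFlux (D.M α) (R.ρ α) A d gn sK sL pK pL ≤ 0 := by
  obtain ⟨hr, -⟩ := interfaceDensity_bounds (hR.ρ_contDiff α).continuous (hR.ρ_mono α) hρm
    (hR.ρ_bounds α) pK pL
  have hM := ext01_mobility_nonneg hD α sL
  unfold faceFlux upwindFlux
  rw [ext01_mobility_of_nonpos hD α hs]
  have h1 : 0 ≤ A / d * interfaceDensity (R.ρ α) pK pL * (ext01 (D.M α) sL * max (pL - pK) 0) :=
    mul_nonneg (mul_nonneg (div_nonneg hA hd) hr) (mul_nonneg hM (le_max_right _ _))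
  have h2 : 0 ≤ A * interfaceDensity (R.ρ α) pK pL ^ 2 * (ext01 (D.M α) sL * max (-gn) 0) :=
    mul_nonneg (mul_nonneg hA (sq_nonneg _)) (mul_nonneg hM (le_max_right _ _))
  linarith

theorem cellMean_porosity (hR : R.Admissible D.Ω φ₀ φ₁ ρm ρM pcMax) (K : Fin 𝒯.card) :
    cellMean D 𝒯 R.φ K ∈ Icc φ₀ φ₁ :=
  cellMean_mem 𝒯 hR.φ_meas hR.φ_bounds K

variable {𝒯} {p s : Phase → ℕ → Fin 𝒯.card → ℝ}

theorem netFlux_nonpos (hD : D.Admissible) (hR : R.Admissible D.Ω φ₀ φ₁ ρm ρM pcMax)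
    (hρm : 0 < ρm) (α : Phase) (q a : Fin 𝒯.card → ℝ) {K : Fin 𝒯.card} (ha : a K ≤ 0) :
    netFlux D R 𝒯 α q a K ≤ 0 := by
  refine add_nonpos (Finset.sum_nonpos fun L hL => ?_) (Finset.sum_nonpos fun ν hν => ?_)
  · exact faceFlux_nonpos hD hR hρm α (𝒯.areaInt_nonneg K L) (𝒯.distInt_pos hL).le ha
  · exact faceFlux_nonpos hD hR hρm α (𝒯.areaDir_nonneg K ν) (𝒯.distDir_pos hν).le ha

/-- Maximum principle: the saturations of a solution are nonnegative. -/
theorem IsSolution.sat_nonneg (hsol : IsSolution D R 𝒯 N p s) (hD : D.Admissible)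
    (hR : R.Admissible D.Ω φ₀ φ₁ ρm ρM pcMax) (hφ₀ : 0 < φ₀) (hρm : 0 < ρm) (α : Phase) :
    ∀ n ≤ N + 1, ∀ K, 0 ≤ s α n K := by
  intro n
  induction n with
  | zero =>
    intro _ K
    rw [hsol.init_s]
    exact (cellMean_mem 𝒯 (hD.s0_meas α) (hD.s0_mem α) K).1
  | succ n ih =>
    intro hn K
    have hn' : n ≤ N := by omega
    -- With a negative new saturation, the accumulation is negative and both the outflow and the
    -- production term are nonpositive, while the injection term is nonnegative.
    by_contra hneg
    push Not at hneg
    have hm := hsol.mass α n hn' K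
    have hρ : ∀ q, 0 < R.ρ α q := fun q => hρm.trans_le (hR.ρ_bounds α q).1
    have hV := 𝒯.volume_cell_pos K
    have hφ : 0 < cellMean D 𝒯 R.φ K := hφ₀.trans_le (cellMean_porosity 𝒯 hR K).1
    have hflux := netFlux_nonpos (𝒯 := 𝒯) hD hR hρm α (p α (n + 1)) (s α (n + 1)) hneg.le
    have h1 : R.ρ α (p α (n + 1) K) * s α (n + 1) K < 0 := mul_neg_of_pos_of_neg (hρ _) hneg
    have h2 : 0 ≤ R.ρ α (p α n K) * s α n K := mul_nonneg (hρ _).le (ih (by omega) K)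
    have h3 : volume.real (𝒯.cell K) * cellMean D 𝒯 R.φ K *
        ((R.ρ α (p α (n + 1) K) * s α (n + 1) K - R.ρ α (p α n K) * s α n K) /
          timeStep D N) < 0 :=
      mul_neg_of_pos_of_neg (mul_pos hV hφ) (div_neg_of_neg_of_pos (by linarith) (timeStep_pos hD N))
    have hP := cylMean_nonneg 𝒯 hD hD.fP_nonneg hn' K
    have hI := cylMean_nonneg 𝒯 hD hD.fI_nonneg hn' K
    have hsI := (cylMean_mem 𝒯 hD (hD.sI_meas α) (hD.sI_mem α) hn' K).1
    have h4 : volume.real (𝒯.cell K) * R.ρ α (p α (n + 1) K) * s α (n + 1) K *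
        cylMean D 𝒯 N D.fP n K ≤ 0 := by
      refine mul_nonpos_of_nonpos_of_nonneg ?_ hP
      rw [mul_assoc]
      exact (mul_neg_of_pos_of_neg hV h1).le
    have h5 : 0 ≤ volume.real (𝒯.cell K) * R.ρ α (p α (n + 1) K) * cylMean D 𝒯 N (D.sI α) n K *
        cylMean D 𝒯 N D.fI n K :=
      mul_nonneg (mul_nonneg (mul_nonneg hV.le (hρ _).le) hsI) hI
    linarith

theorem IsSolution.sat_sum (hsol : IsSolution D R 𝒯 N p s) (hD : D.Admissible) :
    ∀ n ≤ N + 1, ∀ K, s Phase.liq n K + s Phase.gas n K = 1 := by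
  intro n hn K
  rcases n with _ | n
  · rw [hsol.init_s, hsol.init_s]
    have : IsFiniteMeasure (volume.restrict (𝒯.cell K)) :=
      ⟨by simpa using (𝒯.volume_cell_ne_top K).lt_top⟩
    have hint : ∀ α, IntegrableOn (D.s0 α) (𝒯.cell K) := by
      intro α
      refine Integrable.of_bound ((hD.s0_meas α).mono_measure
        (Measure.restrict_mono (𝒯.cell_subset K) le_rfl)) 1 ?_
      filter_upwards [ae_restrict_of_ae_restrict_of_subset (𝒯.cell_subset K) (hD.s0_mem α)]
        with x hx
      rw [Real.norm_eq_abs, abs_of_nonneg hx.1]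
      exact hx.2
    simp only [cellMean, setAverage_eq, smul_eq_mul]
    rw [← mul_add, ← integral_add (hint _) (hint _)]
    have hone : ∫ x in 𝒯.cell K, (D.s0 Phase.liq x + D.s0 Phase.gas x) =
        ∫ _ in 𝒯.cell K, (1 : ℝ) :=
      integral_congr_ae (ae_restrict_of_ae_restrict_of_subset (𝒯.cell_subset K) hD.s0_add)
    rw [hone, setIntegral_const, smul_eq_mul, mul_one, inv_mul_cancel₀]
    exact (𝒯.volume_cell_pos K).ne'
  · exact hsol.sat_add n (by omega) K

theorem IsSolution.sat_le_one (hsol : IsSolution D R 𝒯 N p s) (hD : D.Admissible)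
    (hR : R.Admissible D.Ω φ₀ φ₁ ρm ρM pcMax) (hφ₀ : 0 < φ₀) (hρm : 0 < ρm) (α : Phase)
    {n : ℕ} (hn : n ≤ N + 1) (K : Fin 𝒯.card) : s α n K ≤ 1 := by
  have h := hsol.sat_sum hD n hn K
  have h1 := hsol.sat_nonneg hD hR hφ₀ hρm Phase.liq n hn K
  have h2 := hsol.sat_nonneg hD hR hφ₀ hρm Phase.gas n hn K
  cases α <;> linarith

theorem IsSolution.capillaryState (hsol : IsSolution D R 𝒯 N p s) (hD : D.Admissible)
    (hR : R.Admissible D.Ω φ₀ φ₁ ρm ρM pcMax) (hφ₀ : 0 < φ₀) (hρm : 0 < ρm) {n : ℕ} (hn : n ≤ N)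
    (K : Fin 𝒯.card) :
    CapillaryState R (fun α => p α (n + 1) K) (fun α => s α (n + 1) K) where
  sat_mem := ⟨hsol.sat_nonneg hD hR hφ₀ hρm _ _ (by omega) K,
    hsol.sat_le_one hD hR hφ₀ hρm _ (by omega) K⟩
  sat_add := hsol.sat_add n hn K
  capillary := hsol.capillary n hn K

end Scheme

section Energy

variable {l : ℕ} {D : ProblemData l} {R : RockFluid l} {φ₀ φ₁ ρm ρM pcMax ξ : ℝ}

/-! ### The energy of a cell -/

/-- The primitive of the capillary pressure. -/
def capPrim (R : RockFluid l) (a : ℝ) : ℝ := ∫ z in (0 : ℝ)..a, R.pc z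

/-- Concavity of the primitive, as `p_c` is nonincreasing; this controls the saturation increments
left over from the two accumulation terms. -/
theorem capPrim_le (hR : R.Admissible D.Ω φ₀ φ₁ ρm ρM pcMax) {a b : ℝ} (ha : a ∈ Icc (0 : ℝ) 1)
    (hb : b ∈ Icc (0 : ℝ) 1) : capPrim R b ≤ capPrim R a + R.pc a * (b - a) := by
  have hc := hR.pc_contDiff.continuousOn
  have h0 : (0 : ℝ) ∈ Icc (0 : ℝ) 1 := ⟨le_rfl, zero_le_one⟩
  have hsub : ∀ {x y : ℝ}, x ∈ Icc (0 : ℝ) 1 → y ∈ Icc (0 : ℝ) 1 →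
      capPrim R y - capPrim R x = ∫ z in x..y, R.pc z := fun hx hy =>
    intervalIntegral.integral_interval_sub_left (intervalIntegrable_of_continuousOn_unit hc h0 hy)
      (intervalIntegrable_of_continuousOn_unit hc h0 hx)
  rcases le_total a b with hab | hab
  · have h1 : ∫ z in a..b, R.pc z ≤ ∫ _ in a..b, R.pc a :=
      intervalIntegral.integral_mono_on hab (intervalIntegrable_of_continuousOn_unit hc ha hb)
        intervalIntegrable_const fun z hz =>
          pc_antitoneOn hR ha ⟨ha.1.trans hz.1, hz.2.trans hb.2⟩ hz.1
    rw [← hsub ha hb, intervalIntegral.integral_const, smul_eq_mul] at h1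
    linarith
  · have h1 : ∫ _ in b..a, R.pc a ≤ ∫ z in b..a, R.pc z :=
      intervalIntegral.integral_mono_on hab intervalIntegrable_const
        (intervalIntegrable_of_continuousOn_unit hc hb ha) fun z hz =>
          pc_antitoneOn hR ⟨hb.1.trans hz.1, hz.2.trans ha.2⟩ ha hz.2
    rw [← hsub hb ha, intervalIntegral.integral_const, smul_eq_mul] at h1
    linarith

theorem capPrim_mem (hR : R.Admissible D.Ω φ₀ φ₁ ρm ρM pcMax) {a : ℝ}
    (ha : a ∈ Icc (0 : ℝ) 1) : capPrim R a ∈ Icc 0 pcMax := by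
  have h0 : (0 : ℝ) ∈ Icc (0 : ℝ) 1 := ⟨le_rfl, zero_le_one⟩
  constructor
  · exact intervalIntegral.integral_nonneg ha.1 fun z hz =>
      hR.pc_nonneg z ⟨hz.1, hz.2.trans ha.2⟩
  · have h1 := capPrim_le hR h0 ha
    have h2 : capPrim R 0 = 0 := by simp [capPrim]
    have h3 := hR.pc_nonneg 0 h0
    have h4 : R.pc 0 * a ≤ R.pc 0 * 1 := mul_le_mul_of_nonneg_left ha.2 h3
    have h5 := hR.pc_zero_le
    rw [h2] at h1
    linarith

/-- The energy density of a cell of pressures `q` and saturations `a`. -/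
def cellEnergy (R : RockFluid l) (q a : Phase → ℝ) : ℝ :=
  compressEnergy (R.ρ Phase.liq) (q Phase.liq) * a Phase.liq +
    compressEnergy (R.ρ Phase.gas) (q Phase.gas) * a Phase.gas - capPrim R (a Phase.liq)

theorem cellEnergy_ge (hR : R.Admissible D.Ω φ₀ φ₁ ρm ρM pcMax) (hρm : 0 < ρm)
    {q a : Phase → ℝ} (ha : ∀ α, a α ∈ Icc (0 : ℝ) 1) : -pcMax ≤ cellEnergy R q a := by
  have h : ∀ α, 0 ≤ compressEnergy (R.ρ α) (q α) * a α := fun α =>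
    mul_nonneg (compressEnergy_nonneg (hR.ρ_contDiff α).continuous (hR.ρ_mono α) hρm
      (hR.ρ_bounds α) _) (ha α).1
  have h1 := h Phase.liq
  have h2 := h Phase.gas
  have h3 := (capPrim_mem hR (ha Phase.liq)).2
  unfold cellEnergy
  linarith

theorem cellEnergy_le (hR : R.Admissible D.Ω φ₀ φ₁ ρm ρM pcMax) (hρm : 0 < ρm)
    {q a : Phase → ℝ} (ha : ∀ α, a α ∈ Icc (0 : ℝ) 1) :
    cellEnergy R q a ≤ (ρM / ρm + 1) * (|q Phase.liq| + |q Phase.gas|) := by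
  have h : ∀ α, compressEnergy (R.ρ α) (q α) * a α ≤ (ρM / ρm + 1) * |q α| := fun α =>
    (mul_le_of_le_one_right (compressEnergy_nonneg (hR.ρ_contDiff α).continuous (hR.ρ_mono α) hρm
      (hR.ρ_bounds α) _) (ha α).2).trans
      (compressEnergy_le (hR.ρ_contDiff α).continuous (hR.ρ_mono α) hρm (hR.ρ_bounds α) _)
  have h1 := h Phase.liq
  have h2 := h Phase.gas
  have h3 := (capPrim_mem hR (ha Phase.liq)).1
  unfold cellEnergy
  linarith

/-- The accumulation terms of both phases dominate the increment of the energy. -/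
theorem cellEnergy_sub_le (hR : R.Admissible D.Ω φ₀ φ₁ ρm ρM pcMax) (hρm : 0 < ρm)
    {q a q' a' : Phase → ℝ} (ha : ∀ α, a α ∈ Icc (0 : ℝ) 1)
    (hsum : a Phase.liq + a Phase.gas = 1) (h' : CapillaryState R q' a') :
    cellEnergy R q' a' - cellEnergy R q a ≤
      (R.ρ Phase.liq (q' Phase.liq) * a' Phase.liq - R.ρ Phase.liq (q Phase.liq) * a Phase.liq) *
          enthalpy (R.ρ Phase.liq) (q' Phase.liq) +
        (R.ρ Phase.gas (q' Phase.gas) * a' Phase.gas - R.ρ Phase.gas (q Phase.gas) * a Phase.gas) *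
          enthalpy (R.ρ Phase.gas) (q' Phase.gas) := by
  have h : ∀ α, _ := fun α => accumulation_mul_enthalpy (hR.ρ_contDiff α).continuous (hR.ρ_mono α)
    hρm (hR.ρ_bounds α) (q α) (q' α) (a' α) (ha α).1
  have h1 := h Phase.liq
  have h2 := h Phase.gas
  -- The tangent is taken at the new state, the only one where the capillary law is needed; the
  -- initial data are not required to satisfy it.
  have h3 := capPrim_le hR h'.sat_mem (ha Phase.liq)
  rw [h'.capillary] at h3
  have h4 : a' Phase.gas - a Phase.gas = -(a' Phase.liq - a Phase.liq) := by
    linarith [h'.sat_add]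
  rw [h4] at h2
  unfold cellEnergy
  linarith

/-! ### Fluxes tested against the primitives of the inverse densities -/

variable (𝒯 : AdmissibleMesh D.Ω D.ΓD ξ)

theorem sum_nbrs_antisymm (F : Fin 𝒯.card → Fin 𝒯.card → ℝ) (hF : ∀ K L, F K L = -F L K)
    (g : Fin 𝒯.card → ℝ) :
    ∑ K, ∑ L ∈ 𝒯.nbrs K, F K L * g K = (∑ K, ∑ L ∈ 𝒯.nbrs K, F K L * (g K - g L)) / 2 := by
  have h1 : ∑ K, ∑ L ∈ 𝒯.nbrs K, F K L * g L = -∑ K, ∑ L ∈ 𝒯.nbrs K, F K L * g K := by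
    rw [𝒯.sum_nbrs_comm, ← Finset.sum_neg_distrib]
    refine Finset.sum_congr rfl fun K _ => ?_
    rw [← Finset.sum_neg_distrib]
    refine Finset.sum_congr rfl fun L _ => ?_
    rw [hF]; ring
  simp only [mul_sub, Finset.sum_sub_distrib, h1]
  ring

theorem eta_antisymm (K L : Fin 𝒯.card) : 𝒯.η K L = -𝒯.η L K := by
  rw [AdmissibleMesh.η, AdmissibleMesh.η, 𝒯.distInt_comm, ← smul_neg, neg_sub]

theorem norm_eta_le (K L : Fin 𝒯.card) : ‖𝒯.η K L‖ ≤ 1 := by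
  rw [AdmissibleMesh.η, norm_smul, norm_inv, AdmissibleMesh.distInt, Real.norm_eq_abs,
    abs_of_nonneg dist_nonneg, ← dist_eq_norm, dist_comm (𝒯.center L)]
  exact inv_mul_le_one

/-- The dissipation: weighted sum over all faces of the upwind energies of both phases. -/
def dissipation (q a : Phase → Fin 𝒯.card → ℝ) : ℝ :=
  ∑ K, (∑ L ∈ 𝒯.nbrs K, 𝒯.τ K L *
      (upwindEnergy D (fun α => q α K) (fun α => a α K) (fun α => q α L) (fun α => a α L) Phase.liq +
      upwindEnergy D (fun α => q α K) (fun α => a α K) (fun α => q α L) (fun α => a α L) Phase.gas) +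
    ∑ ν ∈ 𝒯.normals K, 𝒯.τDir K ν *
      (upwindEnergy D (fun α => q α K) (fun α => a α K) (fun _ => 0) satDir Phase.liq +
      upwindEnergy D (fun α => q α K) (fun α => a α K) (fun _ => 0) satDir Phase.gas))

theorem tau_nonneg (K L : Fin 𝒯.card) : 0 ≤ 𝒯.τ K L :=
  div_nonneg (𝒯.areaInt_nonneg K L) dist_nonneg

theorem tauDir_nonneg {K : Fin 𝒯.card} {ν : Space l} (hν : ν ∈ 𝒯.normals K) : 0 ≤ 𝒯.τDir K ν :=
  div_nonneg (𝒯.areaDir_nonneg K ν) (𝒯.distDir_pos hν).le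

/-- Summation by parts. Every interior face occurs twice in `dissipation`, which turns the surviving
half of the energy into a quarter. Dirichlet faces leave no boundary term, since `enthalpy` vanishes
at zero pressure, and the gravity errors `|σ| d` add up to at most `ξ |Ω|`. -/
theorem netFlux_energy (hD : D.Admissible) (hR : R.Admissible D.Ω φ₀ φ₁ ρm ρM pcMax)
    (hρm : 0 < ρm) {m₀ Mmax : ℝ} (hm₀ : 0 < m₀) (hMmax0 : 0 ≤ Mmax) (hξ : 0 ≤ ξ)
    (hm : ∀ a ∈ Icc (0 : ℝ) 1, m₀ ≤ D.M Phase.liq a + D.M Phase.gas (1 - a))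
    (hMmax : ∀ α, ∀ a ∈ Icc (0 : ℝ) 1, D.M α a ≤ Mmax) {q a : Phase → Fin 𝒯.card → ℝ}
    (hcap : ∀ K, CapillaryState R (fun α => q α K) (fun α => a α K)) :
    dissipation 𝒯 q a / 4 - gravityConst m₀ Mmax ρM ‖D.grav‖ * (ξ * volume.real D.Ω) ≤
      ∑ K, (netFlux D R 𝒯 Phase.liq (q Phase.liq) (a Phase.liq) K *
          enthalpy (R.ρ Phase.liq) (q Phase.liq K) +
        netFlux D R 𝒯 Phase.gas (q Phase.gas) (a Phase.gas) K *
          enthalpy (R.ρ Phase.gas) (q Phase.gas K)) := by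
  set c := gravityConst m₀ Mmax ρM ‖D.grav‖ with hc
  have hc0 : 0 ≤ c := by rw [hc, gravityConst]; positivity
  set g : Phase → Fin 𝒯.card → ℝ := fun α K => enthalpy (R.ρ α) (q α K) with hg
  set F : Phase → Fin 𝒯.card → Fin 𝒯.card → ℝ := fun α K L =>
    faceFlux (D.M α) (R.ρ α) (𝒯.areaInt K L) (𝒯.distInt K L)
      (inner ℝ D.grav (𝒯.η K L)) (a α K) (a α L) (q α K) (q α L) with hF
  set G : Phase → Fin 𝒯.card → Space l → ℝ := fun α K ν =>
    faceFlux (D.M α) (R.ρ α) (𝒯.areaDir K ν) (𝒯.distDir K ν)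
      (inner ℝ D.grav ν) (a α K) (satDir α) (q α K) 0 with hG
  have hanti : ∀ α K L, F α K L = -F α L K := by
    intro α K L
    simp only [hF]
    rw [faceFlux_antisymm, 𝒯.areaInt_comm, 𝒯.distInt_comm, eta_antisymm, inner_neg_right, neg_neg]
  have hphase : ∀ α, ∑ K, netFlux D R 𝒯 α (q α) (a α) K * enthalpy (R.ρ α) (q α K) =
      (∑ K, ∑ L ∈ 𝒯.nbrs K, F α K L * (g α K - g α L)) / 2 +
        ∑ K, ∑ ν ∈ 𝒯.normals K, G α K ν * g α K := by
    intro α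
    rw [← sum_nbrs_antisymm 𝒯 (F α) (hanti α), ← Finset.sum_add_distrib]
    refine Finset.sum_congr rfl fun K _ => ?_
    rw [netFlux, add_mul, Finset.sum_mul, Finset.sum_mul]
  rw [Finset.sum_add_distrib, hphase, hphase]
  have hint : ∀ K, ∀ L ∈ 𝒯.nbrs K, 𝒯.τ K L *
      (upwindEnergy D (fun α => q α K) (fun α => a α K) (fun α => q α L) (fun α => a α L) Phase.liq +
      upwindEnergy D (fun α => q α K) (fun α => a α K) (fun α => q α L) (fun α => a α L) Phase.gas) / 2
        - c * (𝒯.areaInt K L * 𝒯.distInt K L) ≤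
      F Phase.liq K L * (g Phase.liq K - g Phase.liq L) +
        F Phase.gas K L * (g Phase.gas K - g Phase.gas L) := by
    intro K L hL
    refine faceFlux_energy hD hR hρm hm₀ hm hMmax (hcap K) (hcap L) (𝒯.areaInt_nonneg K L)
      (𝒯.distInt_pos hL) ?_
    calc |inner ℝ D.grav (𝒯.η K L)| ≤ ‖D.grav‖ * ‖𝒯.η K L‖ := abs_real_inner_le_norm _ _
      _ ≤ ‖D.grav‖ * 1 := by gcongr; exact norm_eta_le 𝒯 K L
      _ = ‖D.grav‖ := mul_one _
  have hdir : ∀ K, ∀ ν ∈ 𝒯.normals K, 𝒯.τDir K ν *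
      (upwindEnergy D (fun α => q α K) (fun α => a α K) (fun _ => 0) satDir Phase.liq +
      upwindEnergy D (fun α => q α K) (fun α => a α K) (fun _ => 0) satDir Phase.gas) / 2
        - c * (𝒯.areaDir K ν * 𝒯.distDir K ν) ≤
      G Phase.liq K ν * g Phase.liq K + G Phase.gas K ν * g Phase.gas K := by
    intro K ν hν
    have h := faceFlux_energy hD hR hρm hm₀ hm hMmax (hcap K) (capillaryState_dirichlet hR)
      (gn := inner ℝ D.grav ν) (γ := ‖D.grav‖) (𝒯.areaDir_nonneg K ν) (𝒯.distDir_pos hν) (by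
        have h := abs_real_inner_le_norm D.grav ν
        rwa [𝒯.norm_normals K ν hν, mul_one] at h)
    simp only [enthalpy_zero, sub_zero] at h
    exact h
  have hintS := Finset.sum_le_sum fun K (_ : K ∈ Finset.univ) => Finset.sum_le_sum (hint K)
  have hdirS := Finset.sum_le_sum fun K (_ : K ∈ Finset.univ) => Finset.sum_le_sum (hdir K)
  simp only [Finset.sum_sub_distrib, Finset.sum_add_distrib, ← Finset.mul_sum,
    ← Finset.sum_div] at hintS hdirS
  have hreg : (∑ K, ∑ L ∈ 𝒯.nbrs K, 𝒯.areaInt K L * 𝒯.distInt K L) +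
      ∑ K, ∑ ν ∈ 𝒯.normals K, 𝒯.areaDir K ν * 𝒯.distDir K ν ≤ ξ * volume.real D.Ω := by
    rw [← Finset.sum_add_distrib]
    refine (Finset.sum_le_sum fun K _ => 𝒯.regular' K).trans ?_
    rw [← Finset.mul_sum]
    exact mul_le_mul_of_nonneg_left (𝒯.sum_volume_le hD.isBounded) hξ
  -- Dirichlet faces are counted once and keep one half of their energy, more than the quarter
  -- retained; the excess is discarded by sign.
  have hdirX : 0 ≤ ∑ K, ∑ ν ∈ 𝒯.normals K, 𝒯.τDir K ν *
      (upwindEnergy D (fun α => q α K) (fun α => a α K) (fun _ => 0) satDir Phase.liq +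
      upwindEnergy D (fun α => q α K) (fun α => a α K) (fun _ => 0) satDir Phase.gas) :=
    Finset.sum_nonneg fun K _ => Finset.sum_nonneg fun ν hν => mul_nonneg (tauDir_nonneg 𝒯 hν)
      (add_nonneg (upwindEnergy_nonneg hD _ _ _ _ _) (upwindEnergy_nonneg hD _ _ _ _ _))
  have hAd : 0 ≤ ∑ K, ∑ L ∈ 𝒯.nbrs K, 𝒯.areaInt K L * 𝒯.distInt K L :=
    Finset.sum_nonneg fun K _ => Finset.sum_nonneg fun L _ =>
      mul_nonneg (𝒯.areaInt_nonneg K L) dist_nonneg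
  have hcreg := mul_le_mul_of_nonneg_left hreg hc0
  have hcAd := mul_nonneg hc0 hAd
  rw [mul_add] at hcreg
  simp only [dissipation, Finset.sum_add_distrib]
  linarith

/-! ### Source terms -/

/-- The capillary corrections `p̃` and `p_c` both lie in `[0, pcMax]`. Subtracting the Dirichlet
value gives a quantity to which the Poincaré inequality applies. -/
theorem abs_pressure_le (hD : D.Admissible) (hR : R.Admissible D.Ω φ₀ φ₁ ρm ρM pcMax)
    {q a : Phase → ℝ} (h : CapillaryState R q a) (α : Phase) :
    |q α| ≤ |globalPressure D R (q Phase.gas) (a Phase.liq) -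
      globalPressure D R 0 (satDir Phase.liq)| + 2 * pcMax := by
  have h1 := capTilde_mem hD hR h.sat_mem
  have h2 := capTilde_mem hD hR (a := satDir Phase.liq) ⟨zero_le_one, le_rfl⟩
  have h3 := hR.pc_nonneg _ h.sat_mem
  have h4 := (pc_antitoneOn hR ⟨le_rfl, zero_le_one⟩ h.sat_mem h.sat_mem.1).trans hR.pc_zero_le
  have h5 := h.capillary
  simp only [globalPressure]
  set u := q Phase.gas + capTilde D R (a Phase.liq) - (0 + capTilde D R (satDir Phase.liq)) with hu
  have h6 := le_abs_self u
  have h7 := neg_abs_le u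
  have h8 := h1.1
  have h9 := h1.2
  have h10 := h2.1
  have h11 := h2.2
  cases α <;> rw [abs_le] <;> constructor <;> linarith

/-- Young's inequality twice: the part in `|u|` with weight `lam`, to be absorbed by the
dissipation, and the part in `P` with weight one. -/
theorem source_le {k lam P G₁ G₂ q₁ q₂ u a₁ a₂ b₁ b₂ f f' : ℝ} (hk : 0 ≤ k) (hlam : 0 < lam)
    (hG₁ : |G₁| ≤ k * |q₁|) (hG₂ : |G₂| ≤ k * |q₂|)
    (hq₁ : |q₁| ≤ |u| + 2 * P) (hq₂ : |q₂| ≤ |u| + 2 * P)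
    (ha₁ : a₁ ∈ Icc (0 : ℝ) 1) (ha₂ : a₂ ∈ Icc (0 : ℝ) 1) (hb₁ : b₁ ∈ Icc (0 : ℝ) 1)
    (hb₂ : b₂ ∈ Icc (0 : ℝ) 1) (hf : 0 ≤ f) (hf' : 0 ≤ f') :
    G₁ * (a₁ * f - b₁ * f') + G₂ * (a₂ * f - b₂ * f') ≤
      lam * u ^ 2 + (1 / (4 * lam) + 1) * (2 * k) ^ 2 * 2 * (f ^ 2 + f' ^ 2) + P ^ 2 := by
  have one : ∀ {G q a b : ℝ}, |G| ≤ k * |q| → |q| ≤ |u| + 2 * P → a ∈ Icc (0 : ℝ) 1 →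
      b ∈ Icc (0 : ℝ) 1 → G * (a * f - b * f') ≤ k * (|u| + 2 * P) * (f + f') := by
    intro G q a b hG hq ha hb
    have h1 : |a * f - b * f'| ≤ f + f' := by
      rw [abs_le]
      constructor <;> nlinarith [ha.1, ha.2, hb.1, hb.2]
    calc G * (a * f - b * f') ≤ |G| * |a * f - b * f'| := by
          rw [← abs_mul]; exact le_abs_self _
      _ ≤ (k * |q|) * (f + f') := by gcongr
      _ ≤ _ := by gcongr
  have h1 := one hG₁ hq₁ ha₁ hb₁
  have h2 := one hG₂ hq₂ ha₂ hb₂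
  set Fs := f + f' with hFs
  have h3 : 0 ≤ lam * (|u| - (2 * k) * Fs / (2 * lam)) ^ 2 := by positivity
  have e3 : lam * (|u| - (2 * k) * Fs / (2 * lam)) ^ 2 =
      lam * u ^ 2 - 2 * k * |u| * Fs + 1 / (4 * lam) * ((2 * k) ^ 2 * Fs ^ 2) := by
    rw [← sq_abs u]; field_simp; ring
  have h4 : 0 ≤ (2 * k * Fs - P) ^ 2 := sq_nonneg _
  have h5 : Fs ^ 2 ≤ 2 * (f ^ 2 + f' ^ 2) := by
    rw [hFs]; nlinarith [sq_nonneg (f - f')]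
  have h6 : (1 / (4 * lam) + 1) * ((2 * k) ^ 2 * Fs ^ 2) ≤
      (1 / (4 * lam) + 1) * ((2 * k) ^ 2 * (2 * (f ^ 2 + f' ^ 2))) := by gcongr
  nlinarith

end Energy

/-! ### The energy estimate over one time step and over all of them -/

section Estimate

variable {l : ℕ} {D : ProblemData l} {R : RockFluid l} {φ₀ φ₁ ρm ρM pcMax ξ : ℝ}
  (𝒯 : AdmissibleMesh D.Ω D.ΓD ξ) {N : ℕ}

/-- The discrete gradient energy of the global pressure at one time level. -/
def globalDissipation (D : ProblemData l) (R : RockFluid l) (𝒯 : AdmissibleMesh D.Ω D.ΓD ξ)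
    (q a : Phase → Fin 𝒯.card → ℝ) : ℝ :=
  ∑ K, (∑ L ∈ 𝒯.nbrs K, 𝒯.τ K L *
      |globalPressure D R (q Phase.gas L) (a Phase.liq L) -
        globalPressure D R (q Phase.gas K) (a Phase.liq K)| ^ 2 +
    ∑ ν ∈ 𝒯.normals K, 𝒯.τDir K ν *
      |globalPressure D R 0 (satDir Phase.liq) -
        globalPressure D R (q Phase.gas K) (a Phase.liq K)| ^ 2)

theorem globalDissipation_le (hD : D.Admissible) (hR : R.Admissible D.Ω φ₀ φ₁ ρm ρM pcMax)
    {m₀ : ℝ} (hm₀ : 0 < m₀)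
    (hm : ∀ a ∈ Icc (0 : ℝ) 1, m₀ ≤ D.M Phase.liq a + D.M Phase.gas (1 - a))
    {q a : Phase → Fin 𝒯.card → ℝ}
    (hcap : ∀ K, CapillaryState R (fun α => q α K) (fun α => a α K)) :
    m₀ * globalDissipation D R 𝒯 q a ≤ dissipation 𝒯 q a := by
  rw [globalDissipation, dissipation, Finset.mul_sum]
  refine Finset.sum_le_sum fun K _ => ?_
  rw [mul_add, Finset.mul_sum, Finset.mul_sum]
  refine add_le_add (Finset.sum_le_sum fun L _ => ?_) (Finset.sum_le_sum fun ν hν => ?_)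
  · rw [mul_left_comm]
    exact mul_le_mul_of_nonneg_left (global_jump_bounds hD hR hm₀ hm (hcap K) (hcap L)).1
      (tau_nonneg 𝒯 K L)
  · rw [mul_left_comm]
    exact mul_le_mul_of_nonneg_left
      (global_jump_bounds hD hR hm₀ hm (hcap K) (capillaryState_dirichlet hR)).1
      (tauDir_nonneg 𝒯 hν)

variable {𝒯} {p s : Phase → ℕ → Fin 𝒯.card → ℝ}

theorem phaseEnergy_le (hD : D.Admissible) (α : Phase) :
    phaseEnergy D 𝒯 N p s α ≤ ∑ n ∈ Finset.range (N + 1), timeStep D N *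
      dissipation 𝒯 (fun α => p α (n + 1)) (fun α => s α (n + 1)) := by
  have hU : ∀ (pK sK pL sL : Phase → ℝ), upwindEnergy D pK sK pL sL α ≤
      upwindEnergy D pK sK pL sL Phase.liq + upwindEnergy D pK sK pL sL Phase.gas := by
    intro pK sK pL sL
    have h1 := upwindEnergy_nonneg hD pK sK pL sL Phase.liq
    have h2 := upwindEnergy_nonneg hD pK sK pL sL Phase.gas
    cases α <;> linarith
  refine Finset.sum_le_sum fun n _ => mul_le_mul_of_nonneg_left ?_ (timeStep_pos hD N).le
  refine Finset.sum_le_sum fun K _ => add_le_add (Finset.sum_le_sum fun L _ => ?_)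
    (Finset.sum_le_sum fun ν hν => ?_)
  · rw [mul_assoc]
    exact mul_le_mul_of_nonneg_left
      (hU (fun α => p α (n + 1) K) (fun α => s α (n + 1) K) (fun α => p α (n + 1) L)
        fun α => s α (n + 1) L) (tau_nonneg 𝒯 K L)
  · rw [mul_assoc]
    exact mul_le_mul_of_nonneg_left
      (hU (fun α => p α (n + 1) K) (fun α => s α (n + 1) K) (fun _ => 0) satDir)
      (tauDir_nonneg 𝒯 hν)

theorem globalEnergy_eq : globalEnergy D R 𝒯 N p s = ∑ n ∈ Finset.range (N + 1), timeStep D N *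
    globalDissipation D R 𝒯 (fun α => p α (n + 1)) (fun α => s α (n + 1)) := rfl

/-- The total energy at a time level. -/
def discreteEnergy (R : RockFluid l) (𝒯 : AdmissibleMesh D.Ω D.ΓD ξ)
    (p s : Phase → ℕ → Fin 𝒯.card → ℝ) (n : ℕ) : ℝ :=
  ∑ K, volume.real (𝒯.cell K) * cellMean D 𝒯 R.φ K *
    cellEnergy R (fun α => p α n K) (fun α => s α n K)

theorem pcMax_nonneg (hR : R.Admissible D.Ω φ₀ φ₁ ρm ρM pcMax) : 0 ≤ pcMax :=
  (hR.pc_nonneg 0 ⟨le_rfl, zero_le_one⟩).trans hR.pc_zero_le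

theorem phi_max_nonneg (hD : D.Admissible) (hR : R.Admissible D.Ω φ₀ φ₁ ρm ρM pcMax)
    (hφ₀ : 0 < φ₀) : 0 ≤ φ₁ := by
  have : (ae (volume.restrict D.Ω)).NeBot :=
    ae_restrict_neBot.2 (hD.isOpen.measure_pos volume hD.isConnected.nonempty).ne'
  obtain ⟨x, hx⟩ := hR.φ_bounds.exists
  exact hφ₀.le.trans (hx.1.trans hx.2)

/-- Energy balance over one time step. -/
theorem IsSolution.energy_step (hsol : IsSolution D R 𝒯 N p s) (hD : D.Admissible)
    (hR : R.Admissible D.Ω φ₀ φ₁ ρm ρM pcMax) (hφ₀ : 0 < φ₀) (hρm : 0 < ρm) (hξ : 0 ≤ ξ)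
    {m₀ Mmax CP lam : ℝ} (hm₀ : 0 < m₀) (hMmax0 : 0 ≤ Mmax)
    (hm : ∀ a ∈ Icc (0 : ℝ) 1, m₀ ≤ D.M Phase.liq a + D.M Phase.gas (1 - a))
    (hMmax : ∀ α, ∀ a ∈ Icc (0 : ℝ) 1, D.M α a ≤ Mmax) (hCP : 0 < CP)
    (hlam : lam = m₀ / (8 * CP))
    (hpoin : ∀ u : Fin 𝒯.card → ℝ, ∑ K, volume.real (𝒯.cell K) * u K ^ 2 ≤
        CP * ∑ K, (∑ L ∈ 𝒯.nbrs K, 𝒯.τ K L * |u L - u K| ^ 2 +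
          ∑ ν ∈ 𝒯.normals K, 𝒯.τDir K ν * |0 - u K| ^ 2)) {n : ℕ} (hn : n ≤ N) :
    (discreteEnergy R 𝒯 p s (n + 1) - discreteEnergy R 𝒯 p s n) / timeStep D N +
        dissipation 𝒯 (fun α => p α (n + 1)) (fun α => s α (n + 1)) / 8 ≤
      (gravityConst m₀ Mmax ρM ‖D.grav‖ * ξ + pcMax ^ 2) * volume.real D.Ω +
        (1 / (4 * lam) + 1) * (2 * (ρM / ρm)) ^ 2 * 2 *
          (∑ K, volume.real (𝒯.cell K) * cylMean D 𝒯 N D.fI n K ^ 2 +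
            ∑ K, volume.real (𝒯.cell K) * cylMean D 𝒯 N D.fP n K ^ 2) := by
  have hlam0 : 0 < lam := by rw [hlam]; positivity
  have hdt := timeStep_pos hD N
  have hcap : ∀ K, CapillaryState R (fun α => p α (n + 1) K) (fun α => s α (n + 1) K) := fun K =>
    hsol.capillaryState hD hR hφ₀ hρm hn K
  set u : Fin 𝒯.card → ℝ := fun K =>
    globalPressure D R (p Phase.gas (n + 1) K) (s Phase.liq (n + 1) K) -
      globalPressure D R 0 (satDir Phase.liq) with hu
  set κ := (1 / (4 * lam) + 1) * (2 * (ρM / ρm)) ^ 2 * 2 with hκ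
  have hflux := netFlux_energy 𝒯 hD hR hρm hm₀ hMmax0 hξ hm hMmax
    (q := fun α => p α (n + 1)) (a := fun α => s α (n + 1)) hcap
  set X := dissipation 𝒯 (fun α => p α (n + 1)) (fun α => s α (n + 1)) with hX
  -- Poincaré followed by the control of the global pressure by the phases. The value of `lam` is
  -- the one that makes the source terms consume an eighth of the dissipation, out of the quarter
  -- supplied by the fluxes.
  have hu2 : lam * ∑ K, volume.real (𝒯.cell K) * u K ^ 2 ≤ X / 8 := by
    have h1 := hpoin u
    have h2 := globalDissipation_le 𝒯 hD hR hm₀ hm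
      (q := fun α => p α (n + 1)) (a := fun α => s α (n + 1)) hcap
    have h3 : ∑ K, (∑ L ∈ 𝒯.nbrs K, 𝒯.τ K L * |u L - u K| ^ 2 +
          ∑ ν ∈ 𝒯.normals K, 𝒯.τDir K ν * |0 - u K| ^ 2) =
        globalDissipation D R 𝒯 (fun α => p α (n + 1)) (fun α => s α (n + 1)) := by
      simp only [globalDissipation, hu, sub_sub_sub_cancel_right, zero_sub, neg_sub]
    rw [h3] at h1
    calc lam * ∑ K, volume.real (𝒯.cell K) * u K ^ 2
        ≤ lam * (CP * globalDissipation D R 𝒯 (fun α => p α (n + 1)) (fun α => s α (n + 1))) := by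
          gcongr
      _ = m₀ * globalDissipation D R 𝒯 (fun α => p α (n + 1)) (fun α => s α (n + 1)) / 8 := by
          rw [hlam]; field_simp
      _ ≤ X / 8 := by gcongr
  have hk : 0 ≤ ρM / ρm := div_nonneg ((hρm.trans_le (hR.ρ_bounds Phase.liq 0).1).le.trans
    (hR.ρ_bounds Phase.liq 0).2) hρm.le
  have hcell : ∀ K, volume.real (𝒯.cell K) * cellMean D 𝒯 R.φ K *
        cellEnergy R (fun α => p α (n + 1) K) (fun α => s α (n + 1) K) / timeStep D N -
      volume.real (𝒯.cell K) * cellMean D 𝒯 R.φ K *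
        cellEnergy R (fun α => p α n K) (fun α => s α n K) / timeStep D N +
      (netFlux D R 𝒯 Phase.liq (p Phase.liq (n + 1)) (s Phase.liq (n + 1)) K *
          enthalpy (R.ρ Phase.liq) (p Phase.liq (n + 1) K) +
        netFlux D R 𝒯 Phase.gas (p Phase.gas (n + 1)) (s Phase.gas (n + 1)) K *
          enthalpy (R.ρ Phase.gas) (p Phase.gas (n + 1) K)) ≤
      lam * (volume.real (𝒯.cell K) * u K ^ 2) +
        κ * (volume.real (𝒯.cell K) * cylMean D 𝒯 N D.fI n K ^ 2 +
          volume.real (𝒯.cell K) * cylMean D 𝒯 N D.fP n K ^ 2) +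
        pcMax ^ 2 * volume.real (𝒯.cell K) := by
    intro K
    have hV := 𝒯.volume_cell_pos K
    have hφ : 0 < cellMean D 𝒯 R.φ K := hφ₀.trans_le (cellMean_porosity 𝒯 hR K).1
    have hmem : ∀ α, ∀ m ≤ N + 1, s α m K ∈ Icc (0 : ℝ) 1 := fun α m hm =>
      ⟨hsol.sat_nonneg hD hR hφ₀ hρm α m hm K, hsol.sat_le_one hD hR hφ₀ hρm α hm K⟩
    have hacc := cellEnergy_sub_le hR hρm (q := fun α => p α n K) (a := fun α => s α n K)
      (fun α => hmem α n (by omega)) (hsol.sat_sum hD n (by omega) K) (hcap K)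
    have hG : ∀ α, |R.ρ α (p α (n + 1) K) * enthalpy (R.ρ α) (p α (n + 1) K)| ≤
        ρM / ρm * |p α (n + 1) K| := by
      intro α
      have hρ := hR.ρ_bounds α (p α (n + 1) K)
      rw [abs_mul, abs_of_pos (hρm.trans_le hρ.1)]
      calc _ ≤ ρM * (|p α (n + 1) K| / ρm) := by
            gcongr
            · exact hρm.le.trans (hρ.1.trans hρ.2)
            · exact hρ.2
            · exact abs_enthalpy_le (hR.ρ_contDiff α).continuous (hR.ρ_mono α) hρm
                (hR.ρ_bounds α) _
        _ = _ := by ring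
    have hsI : ∀ α, cylMean D 𝒯 N (D.sI α) n K ∈ Icc (0 : ℝ) 1 := fun α =>
      cylMean_mem 𝒯 hD (hD.sI_meas α) (hD.sI_mem α) hn K
    have hsrc := source_le (P := pcMax) hk hlam0 (hG Phase.liq) (hG Phase.gas)
      (abs_pressure_le hD hR (hcap K) Phase.liq) (abs_pressure_le hD hR (hcap K) Phase.gas)
      (hsI Phase.liq) (hsI Phase.gas) (hmem Phase.liq (n + 1) (by omega))
      (hmem Phase.gas (n + 1) (by omega)) (cylMean_nonneg 𝒯 hD hD.fI_nonneg hn K)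
      (cylMean_nonneg 𝒯 hD hD.fP_nonneg hn K)
    have hmass : ∀ α, volume.real (𝒯.cell K) * cellMean D 𝒯 R.φ K / timeStep D N *
          ((R.ρ α (p α (n + 1) K) * s α (n + 1) K - R.ρ α (p α n K) * s α n K) *
            enthalpy (R.ρ α) (p α (n + 1) K)) +
        netFlux D R 𝒯 α (p α (n + 1)) (s α (n + 1)) K * enthalpy (R.ρ α) (p α (n + 1) K) =
        volume.real (𝒯.cell K) * (R.ρ α (p α (n + 1) K) * enthalpy (R.ρ α) (p α (n + 1) K) *
          (cylMean D 𝒯 N (D.sI α) n K * cylMean D 𝒯 N D.fI n K -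
            s α (n + 1) K * cylMean D 𝒯 N D.fP n K)) := by
      intro α
      -- The mass balance tested against the primitive of `1 / ρ`.
      linear_combination enthalpy (R.ρ α) (p α (n + 1) K) * hsol.mass α n hn K
    have h1 := hmass Phase.liq
    have h2 := hmass Phase.gas
    have h3 := mul_le_mul_of_nonneg_left hacc
      (div_nonneg (mul_nonneg hV.le hφ.le) hdt.le : 0 ≤ volume.real (𝒯.cell K) *
        cellMean D 𝒯 R.φ K / timeStep D N)
    have h4 := mul_le_mul_of_nonneg_left hsrc hV.le
    have e3 : volume.real (𝒯.cell K) * cellMean D 𝒯 R.φ K *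
        cellEnergy R (fun α => p α (n + 1) K) (fun α => s α (n + 1) K) / timeStep D N -
      volume.real (𝒯.cell K) * cellMean D 𝒯 R.φ K *
        cellEnergy R (fun α => p α n K) (fun α => s α n K) / timeStep D N =
      volume.real (𝒯.cell K) * cellMean D 𝒯 R.φ K / timeStep D N *
        (cellEnergy R (fun α => p α (n + 1) K) (fun α => s α (n + 1) K) -
          cellEnergy R (fun α => p α n K) (fun α => s α n K)) := by ring
    rw [e3]
    rw [mul_add] at h3
    refine le_trans ?_ (h4.trans_eq (by simp only [hu, hκ]; ring))
    linarith
  have hS := Finset.sum_le_sum fun K (_ : K ∈ Finset.univ) => hcell K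
  simp only [Finset.sum_add_distrib, Finset.sum_sub_distrib, ← Finset.mul_sum,
    ← Finset.sum_div] at hS hflux
  have hvol := mul_le_mul_of_nonneg_left (𝒯.sum_volume_le hD.isBounded) (sq_nonneg pcMax)
  simp only [discreteEnergy, sub_div]
  linarith

/-- The energy estimate, summed over the time steps. -/
theorem IsSolution.sum_dissipation_le (hsol : IsSolution D R 𝒯 N p s) (hD : D.Admissible)
    (hR : R.Admissible D.Ω φ₀ φ₁ ρm ρM pcMax) (hφ₀ : 0 < φ₀) (hρm : 0 < ρm) (hξ : 0 ≤ ξ)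
    {m₀ Mmax CP lam : ℝ} (hm₀ : 0 < m₀) (hMmax0 : 0 ≤ Mmax)
    (hm : ∀ a ∈ Icc (0 : ℝ) 1, m₀ ≤ D.M Phase.liq a + D.M Phase.gas (1 - a))
    (hMmax : ∀ α, ∀ a ∈ Icc (0 : ℝ) 1, D.M α a ≤ Mmax) (hCP : 0 < CP)
    (hlam : lam = m₀ / (8 * CP))
    (hpoin : ∀ u : Fin 𝒯.card → ℝ, ∑ K, volume.real (𝒯.cell K) * u K ^ 2 ≤
        CP * ∑ K, (∑ L ∈ 𝒯.nbrs K, 𝒯.τ K L * |u L - u K| ^ 2 +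
          ∑ ν ∈ 𝒯.normals K, 𝒯.τDir K ν * |0 - u K| ^ 2)) :
    (∑ n ∈ Finset.range (N + 1), timeStep D N *
        dissipation 𝒯 (fun α => p α (n + 1)) (fun α => s α (n + 1))) / 8 ≤
      φ₁ * ((ρM / ρm + 1) * ((∫ x in D.Ω, |D.p0 Phase.liq x|) + ∫ x in D.Ω, |D.p0 Phase.gas x|)) +
        φ₁ * (pcMax * volume.real D.Ω) +
        D.T * ((gravityConst m₀ Mmax ρM ‖D.grav‖ * ξ + pcMax ^ 2) * volume.real D.Ω) +
        (1 / (4 * lam) + 1) * (2 * (ρM / ρm)) ^ 2 * 2 *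
          ((∫ z in D.cylinder, D.fI z ^ 2) + ∫ z in D.cylinder, D.fP z ^ 2) := by
  have hlam0 : 0 < lam := by rw [hlam]; positivity
  have hdt := timeStep_pos hD N
  have hP := pcMax_nonneg hR
  set κ := (1 / (4 * lam) + 1) * (2 * (ρM / ρm)) ^ 2 * 2 with hκ
  have hκ0 : 0 ≤ κ := by positivity
  set c := (gravityConst m₀ Mmax ρM ‖D.grav‖ * ξ + pcMax ^ 2) * volume.real D.Ω with hc
  set E := discreteEnergy R 𝒯 p s with hE
  have hk : 0 ≤ ρM / ρm := div_nonneg ((hρm.trans_le (hR.ρ_bounds Phase.liq 0).1).le.trans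
    (hR.ρ_bounds Phase.liq 0).2) hρm.le
  have hmem : ∀ m ≤ N + 1, ∀ K α, s α m K ∈ Icc (0 : ℝ) 1 := fun m hm K α =>
    ⟨hsol.sat_nonneg hD hR hφ₀ hρm α m hm K, hsol.sat_le_one hD hR hφ₀ hρm α hm K⟩
  have hφ : ∀ K, 0 ≤ cellMean D 𝒯 R.φ K ∧ cellMean D 𝒯 R.φ K ≤ φ₁ := fun K =>
    ⟨hφ₀.le.trans (cellMean_porosity 𝒯 hR K).1, (cellMean_porosity 𝒯 hR K).2⟩
  have hφ₁ : 0 ≤ φ₁ := phi_max_nonneg hD hR hφ₀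
  have hstep : ∀ n ∈ Finset.range (N + 1), timeStep D N *
      dissipation 𝒯 (fun α => p α (n + 1)) (fun α => s α (n + 1)) / 8 ≤
      -(E (n + 1) - E n) + timeStep D N * c +
        κ * (timeStep D N * ∑ K, volume.real (𝒯.cell K) * cylMean D 𝒯 N D.fI n K ^ 2 +
          timeStep D N * ∑ K, volume.real (𝒯.cell K) * cylMean D 𝒯 N D.fP n K ^ 2) := by
    intro n hn
    have h := mul_le_mul_of_nonneg_left (hsol.energy_step hD hR hφ₀ hρm hξ hm₀ hMmax0 hm hMmax hCP
      hlam hpoin (Nat.lt_succ_iff.1 (Finset.mem_range.1 hn))) hdt.le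
    have e : timeStep D N * ((E (n + 1) - E n) / timeStep D N) = E (n + 1) - E n := by
      field_simp
    rw [mul_add, e] at h
    linarith
  have hsum := Finset.sum_le_sum hstep
  rw [Finset.sum_add_distrib, Finset.sum_add_distrib, Finset.sum_neg_distrib,
    Finset.sum_range_sub, ← Finset.mul_sum (f := fun n => timeStep D N *
      ∑ K, volume.real (𝒯.cell K) * cylMean D 𝒯 N D.fI n K ^ 2 +
        timeStep D N * ∑ K, volume.real (𝒯.cell K) * cylMean D 𝒯 N D.fP n K ^ 2),
    Finset.sum_add_distrib, ← Finset.sum_div] at hsum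
  have hT : ∑ n ∈ Finset.range (N + 1), timeStep D N * c = D.T * c := by
    rw [Finset.sum_const, Finset.card_range, nsmul_eq_mul, ← mul_assoc]
    congr 1
    unfold timeStep; push_cast; field_simp
  rw [hT] at hsum
  have hsrc := mul_le_mul_of_nonneg_left (add_le_add (sum_cylMean_sq_le 𝒯 (N := N) hD hD.fI_memLp)
    (sum_cylMean_sq_le 𝒯 (N := N) hD hD.fP_memLp)) hκ0
  -- After telescoping only the end energies remain. The initial one grows at most linearly in the
  -- pressures, so the `L¹` norms of the initial pressures bound it.
  have hfirst : E 0 ≤ φ₁ * ((ρM / ρm + 1) *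
      ((∫ x in D.Ω, |D.p0 Phase.liq x|) + ∫ x in D.Ω, |D.p0 Phase.gas x|)) := by
    have hl := sum_abs_cellMean_le 𝒯 hD (hD.p0_memLp Phase.liq)
    have hg := sum_abs_cellMean_le 𝒯 hD (hD.p0_memLp Phase.gas)
    calc E 0 ≤ ∑ K, φ₁ * ((ρM / ρm + 1) *
          (volume.real (𝒯.cell K) * |cellMean D 𝒯 (D.p0 Phase.liq) K| +
            volume.real (𝒯.cell K) * |cellMean D 𝒯 (D.p0 Phase.gas) K|)) := by
          refine Finset.sum_le_sum fun K _ => ?_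
          have hV := (𝒯.volume_cell_pos K).le
          have h := cellEnergy_le hR hρm (q := fun α => p α 0 K) (a := fun α => s α 0 K)
            (hmem 0 (by omega) K)
          simp only [hsol.init_p] at h
          have hφK := hφ K
          calc _ ≤ volume.real (𝒯.cell K) * cellMean D 𝒯 R.φ K * ((ρM / ρm + 1) *
                (|cellMean D 𝒯 (D.p0 Phase.liq) K| + |cellMean D 𝒯 (D.p0 Phase.gas) K|)) := by
                simp only [hsol.init_p]
                exact mul_le_mul_of_nonneg_left h (mul_nonneg hV hφK.1)
            _ ≤ volume.real (𝒯.cell K) * φ₁ * ((ρM / ρm + 1) *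
                (|cellMean D 𝒯 (D.p0 Phase.liq) K| + |cellMean D 𝒯 (D.p0 Phase.gas) K|)) := by
                gcongr
                exact hφK.2
            _ = _ := by ring
      _ ≤ _ := by
          rw [← Finset.mul_sum, ← Finset.mul_sum, Finset.sum_add_distrib]
          gcongr
  -- The final energy is bounded below because only the primitive of `p_c` enters with a negative
  -- sign.
  have hlast : -E (N + 1) ≤ φ₁ * (pcMax * volume.real D.Ω) := by
    calc -E (N + 1) ≤ ∑ K, φ₁ * (pcMax * volume.real (𝒯.cell K)) := by
          rw [hE, discreteEnergy, ← Finset.sum_neg_distrib]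
          refine Finset.sum_le_sum fun K _ => ?_
          have hV := (𝒯.volume_cell_pos K).le
          have h := cellEnergy_ge hR hρm (q := fun α => p α (N + 1) K)
            (a := fun α => s α (N + 1) K) (hmem (N + 1) le_rfl K)
          have hφK := hφ K
          calc _ = volume.real (𝒯.cell K) * cellMean D 𝒯 R.φ K *
                -cellEnergy R (fun α => p α (N + 1) K) (fun α => s α (N + 1) K) := by ring
            _ ≤ volume.real (𝒯.cell K) * cellMean D 𝒯 R.φ K * pcMax :=
                mul_le_mul_of_nonneg_left (by linarith) (mul_nonneg hV hφK.1)
            _ ≤ volume.real (𝒯.cell K) * φ₁ * pcMax := by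
                gcongr
                exact hφK.2
            _ = _ := by ring
      _ ≤ _ := by
          rw [← Finset.mul_sum, ← Finset.mul_sum]
          gcongr
          exact 𝒯.sum_volume_le hD.isBounded
  linarith

end Estimate

end

end TwoPhaseFV

/-! ### Choice of the constant and conclusion -/

theorem proposition5p2 (l : ℕ) (hl : 1 ≤ l) (D : ProblemData l) (hD : D.Admissible)
    (φ₀ φ₁ ρm ρM pcMax ξ : ℝ) (hφ₀ : 0 < φ₀) (hρm : 0 < ρm) (hξ : 0 < ξ) :
    ∃ C : ℝ, 0 < C ∧
      ∀ R : RockFluid l, R.Admissible D.Ω φ₀ φ₁ ρm ρM pcMax →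
      ∀ (𝒯 : AdmissibleMesh D.Ω D.ΓD ξ) (N : ℕ) (p s : Phase → ℕ → Fin 𝒯.card → ℝ),
        IsSolution D R 𝒯 N p s →
          (∀ α : Phase, phaseEnergy D 𝒯 N p s α ≤ C) ∧ globalEnergy D R 𝒯 N p s ≤ C := by
  -- The reference mesh is chosen from `Ω`, `ΓD` and `ξ` alone, before the mesh of the scheme, so
  -- the Poincaré constant it yields is uniform.
  rcases isEmpty_or_nonempty (AdmissibleMesh D.Ω D.ΓD ξ) with hempty | ⟨⟨𝒯₀⟩⟩
  · exact ⟨1, one_pos, fun R _ 𝒯 => hempty.elim 𝒯⟩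
  obtain ⟨CP, hCP, hpoin⟩ := exists_poincare_two hl hD.isOpen hD.isConnected hD.dirichlet_subset
    hD.dirichlet_measurable hD.dirichlet_pos hξ 𝒯₀
  obtain ⟨m₀, hm₀, hm⟩ := hD.mobility_total
  have h1 : (1 : ℝ) ∈ Icc (0 : ℝ) 1 := ⟨zero_le_one, le_rfl⟩
  set Mmax := max (D.M Phase.liq 1) (D.M Phase.gas 1) with hMdef
  have hMmax0 : 0 ≤ Mmax := (hD.mobility_nonneg Phase.liq 1 h1).trans (le_max_left _ _)
  have hMmax : ∀ α, ∀ a ∈ Icc (0 : ℝ) 1, D.M α a ≤ Mmax := by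
    intro α a ha
    refine (hD.mobility_mono α ha h1 ha.2).trans ?_
    cases α
    · exact le_max_left _ _
    · exact le_max_right _ _
  set B := φ₁ * ((ρM / ρm + 1) *
      ((∫ x in D.Ω, |D.p0 Phase.liq x|) + ∫ x in D.Ω, |D.p0 Phase.gas x|)) +
    φ₁ * (pcMax * volume.real D.Ω) +
    D.T * ((gravityConst m₀ Mmax ρM ‖D.grav‖ * ξ + pcMax ^ 2) * volume.real D.Ω) +
    (1 / (4 * (m₀ / (8 * CP))) + 1) * (2 * (ρM / ρm)) ^ 2 * 2 *
      ((∫ z in D.cylinder, D.fI z ^ 2) + ∫ z in D.cylinder, D.fP z ^ 2) with hB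
  -- `8 * |B|` bounds the phases and `8 * |B| / m₀` the global pressure. The absolute value is taken
  -- because `φ₁`, `ρM` and `pcMax` have no prescribed sign until an admissible `R` is given.
  refine ⟨8 * |B| + 8 * |B| / m₀ + 1, by positivity, fun R hR 𝒯 N p s hsol => ?_⟩
  have hX := hsol.sum_dissipation_le hD hR hφ₀ hρm hξ.le hm₀ hMmax0 hm hMmax hCP rfl (hpoin 𝒯)
  rw [← hB] at hX
  set X := ∑ n ∈ Finset.range (N + 1), timeStep D N *
    dissipation 𝒯 (fun α => p α (n + 1)) (fun α => s α (n + 1)) with hXdef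
  have hXB : X ≤ 8 * |B| := by
    have := le_abs_self B
    linarith
  have hB0 : 0 ≤ 8 * |B| / m₀ := by positivity
  constructor
  · intro α
    have h := phaseEnergy_le (p := p) (s := s) (N := N) (𝒯 := 𝒯) hD α
    linarith
  · have h : m₀ * globalEnergy D R 𝒯 N p s ≤ X := by
      rw [globalEnergy_eq, Finset.mul_sum, hXdef]
      refine Finset.sum_le_sum fun n hn => ?_
      have hcap : ∀ K, CapillaryState R (fun α => p α (n + 1) K) (fun α => s α (n + 1) K) :=
        fun K => hsol.capillaryState hD hR hφ₀ hρm
          (Nat.lt_succ_iff.1 (Finset.mem_range.1 hn)) K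
      have hle := globalDissipation_le 𝒯 hD hR hm₀ hm (q := fun α => p α (n + 1))
        (a := fun α => s α (n + 1)) hcap
      have hmul := mul_le_mul_of_nonneg_left hle (timeStep_pos hD N).le
      rwa [mul_left_comm] at hmul
    have h2 : globalEnergy D R 𝒯 N p s ≤ 8 * |B| / m₀ := by
      rw [le_div_iff₀ hm₀]
      linarith
    have h3 : 0 ≤ 8 * |B| := by positivity
    linarith
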